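/- Let $p$ be a prime and $\mathbb{K}$ a field of characteristic zero. For finite groups $G,H$, a finite $(H,G)$-biset is $p$-bifree if the left and right stabilizers of all its points are $p'$-groups (groups of order not divisible by $p$). Let $B^\Delta(H,G)$ be the Grothendieck group, with respect to disjoint unions, of the category of $p$-bifree $(H,G)$-bisets, and let $\mathbb{K}\mathcal{C}^\Delta$ be the category whose objects are the finite groups, with $\mathrm{Hom}(G,H)=\mathbb{K}B^\Delta(H,G)=\mathbb{K}\otimes_{\mathbb{Z}}B^\Delta(H,G)$, composition induced by $(Y,X)\mapsto Y\times_H X$, and identities $[G]$. A $p$-bifree biset functor is a $\mathbb{K}$-linear functor from $\mathbb{K}\mathcal{C}^\Delta$ to $\mathbb{K}$-modules. The Burnside functor $\mathbb{K}B$ sends $G$ to $\mathbb{K}\otimes_{\mathbb{Z}} B(G)$, and a $p$-bifree $(H,G)$-biset $X$ acts on it by $U\mapsto X\times_G U$. For a finite group $G$ put $E_G=\mathbb{K}B^\Delta(G,G)$, and let $I_G\subseteq E_G$ be the ideal spanned by the endomorphisms that factor through a group of order smaller than $|G|$; then $E_G/I_G\cong\mathbb{K}\mathrm{Out}(G)$.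 For a $\mathbb{K}\mathrm{Out}(G)$-module $V$, regarded as an $E_G$-module, let $L_{G,V}(H)=\mathbb{K}B^\Delta(H,G)\otimes_{E_G}V$, let $J_{G,V}(H)$ be the set of $\sum_i x_i\otimes v_i\in L_{G,V}(H)$ with $\sum_i (yx_i)v_i=0$ for all $y\in\mathbb{K}B^\Delta(G,H)$, and put $S^\Delta_{G,V}=L_{G,V}/J_{G,V}$. Write $S^\Delta_{G,\mathbb{K}}$ for the case of the trivial module $V=\mathbb{K}$. Let $e^G_G\in\mathbb{K}B(G)$ be the primitive idempotent whose mark (number of fixed points, extended linearly) is $1$ at $G$ and $0$ at every proper subgroup of $G$, and let $\mathbf{e}^\Delta_G\subseteq\mathbb{K}B$ be the subfunctor generated by $e^G_G$. For $N\trianglelefteq G$ let $$m_{G,N}=\frac1{|G|}\sum_{X\le G,\;XN=G}|X|\,\mu(X,G),$$ where $\mu$ is the Möbius function of the poset of subgroups of $G$. A finite group $G$ is a $B^\Delta_p$-group if $m_{G,N}=0$ for every nontrivial normal $p'$-subgroup $N$ of $G$. Let $[B^\Delta_p\text{-gr}]$ be the set of isomorphism classes of $B^\Delta_p$-groups. Write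 $G\gg H$ if $H$ is isomorphic to a quotient of $G$ by a normal $p'$-subgroup, and call $\mathcal{M}\subseteq[B^\Delta_p\text{-gr}]$ closed if $H\in\mathcal{M}$ and $G\gg H$ imply $G\in\mathcal{M}$. For a $B^\Delta_p$-group $G$ put $$\mathbf{j}_G=\sum_{H\in[B^\Delta_p\text{-gr}],\;H\gg G,\;H\not\cong G}\mathbf{e}^\Delta_H .$$ Then the following hold. 1. The map $\Theta: F\mapsto\{H\in[B^\Delta_p\text{-gr}] : \mathbf{e}^\Delta_H\subseteq F\}$ is an isomorphism from the poset of subfunctors of $\mathbb{K}B$ to the poset of closed subsets of $[B^\Delta_p\text{-gr}]$ (both ordered by inclusion), with inverse $A\mapsto\sum_{H\in A}\mathbf{e}^\Delta_H$. 2. Let $G$ be a $B^\Delta_p$-group. Then $\mathbf{j}_G$ is a proper subfunctor of $\mathbf{e}^\Delta_G$ that contains every proper subfunctor of $\mathbf{e}^\Delta_G$ (in particular it is its unique maximal subfunctor), and $\mathbf{e}^\Delta_G/\mathbf{j}_G\cong S^\Delta_{G,\mathbb{K}}$. 3. Let $F\subset F'$ be subfunctors of $\mathbb{K}B$ such that $F'/F$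 is simple. Then there is a $B^\Delta_p$-group $G$, unique up to isomorphism, such that $\mathbf{e}^\Delta_G\subseteq F'$ and $\mathbf{e}^\Delta_G\not\subseteq F$. Moreover $\mathbf{e}^\Delta_G+F=F'$, $\mathbf{e}^\Delta_G\cap F=\mathbf{j}_G$ and $F'/F\cong S^\Delta_{G,\mathbb{K}}$. 4. The composition factors of $\mathbb{K}B$ (the simple $p$-bifree biset functors isomorphic to $F'/F$ for some subfunctors $F\subseteq F'\subseteq\mathbb{K}B$) are, up to isomorphism, exactly the functors $S^\Delta_{G,\mathbb{K}}$ for $G\in[B^\Delta_p\text{-gr}]$, and $S^\Delta_{G,\mathbb{K}}\cong S^\Delta_{H,\mathbb{K}}$ for $B^\Delta_p$-groups $G,H$ only if $G\cong H$. -/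

import Mathlib

universe u v w

open CategoryTheory MulOpposite
open scoped TensorProduct Pointwise

noncomputable section

namespace BifreeBiset

/-! ### Finite bisets -/

/-- A finite `(H, G)`-biset: a finite set with commuting left `H`-action and right `G`-action. -/
structure FinBiset (H G : Type v) [Group H] [Group G] where
  carrier : Type v
  [finite : Finite carrier]
  [left : MulAction H carrier]
  [right : MulAction Gᵐᵒᵖ carrier]
  [comm : SMulCommClass H Gᵐᵒᵖ carrier]

attribute [instance] FinBiset.finite FinBiset.left FinBiset.right FinBiset.comm

namespace FinBiset

variable {K H G F : Type v} [Group K] [Group H] [Group G] [Group F]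

instance : CoeSort (FinBiset H G) (Type v) := ⟨FinBiset.carrier⟩

/-- Isomorphisms of `(H, G)`-bisets. -/
structure Iso (X Y : FinBiset H G) extends X ≃ Y where
  map_left : ∀ (h : H) (x : X), toEquiv (h • x) = h • toEquiv x
  map_right : ∀ (g : G) (x : X), toEquiv (op g • x) = op g • toEquiv x

/-- The disjoint union of two bisets. -/
def sum (X Y : FinBiset H G) : FinBiset H G where
  carrier := X ⊕ Y

/-- The first inclusion into a disjoint union. -/
def inl {X Y : FinBiset H G} (x : X) : sum X Y := Sum.inl x

/-- The second inclusion into a disjoint union. -/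
def inr {X Y : FinBiset H G} (y : Y) : sum X Y := Sum.inr y

theorem sum_cases {X Y : FinBiset H G} (z : sum X Y) : (∃ x, z = inl x) ∨ ∃ y, z = inr y :=
  match z with
  | Sum.inl x => Or.inl ⟨x, rfl⟩
  | Sum.inr y => Or.inr ⟨y, rfl⟩

/-- Functions out of a disjoint union. -/
def selim {X Y : FinBiset H G} {A : Type*} (f : X → A) (g : Y → A) (z : sum X Y) : A :=
  Sum.elim f g z

/-- The relation `(x h, y) ∼ (x, h y)` on `X × Y`. -/
def tensorSetoid (X : FinBiset K H) (Y : FinBiset H G) : Setoid (X × Y) where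
  r a b := ∃ h : H, b.1 = op h • a.1 ∧ a.2 = h • b.2
  iseqv :=
    { refl := fun a => ⟨1, by simp⟩
      symm := by
        rintro a b ⟨h, h1, h2⟩
        exact ⟨h⁻¹, by rw [h1, smul_smul, ← op_mul]; simp, by rw [h2]; simp⟩
      trans := by
        rintro a b c ⟨h, h1, h2⟩ ⟨k, k1, k2⟩
        exact ⟨h * k, by rw [k1, h1, smul_smul, op_mul], by rw [h2, k2, smul_smul]⟩ }

instance tensorLeft (X : FinBiset K H) (Y : FinBiset H G) :
    MulAction K (Quotient (tensorSetoid X Y)) where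
  smul k := Quotient.map (fun a => (k • a.1, a.2)) (by
    rintro a b ⟨h, h1, h2⟩
    exact ⟨h, by simp only [h1]; exact smul_comm k (op h) a.1, h2⟩)
  one_smul := by
    rintro ⟨a⟩
    exact congrArg (Quotient.mk _) (Prod.ext (one_smul K a.1) rfl)
  mul_smul := by
    rintro k l ⟨a⟩
    exact congrArg (Quotient.mk _) (Prod.ext (mul_smul k l a.1) rfl)

instance tensorRight (X : FinBiset K H) (Y : FinBiset H G) :
    MulAction Gᵐᵒᵖ (Quotient (tensorSetoid X Y)) where
  smul g := Quotient.map (fun a => (a.1, g • a.2)) (by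
    rintro a b ⟨h, h1, h2⟩
    exact ⟨h, h1, by simp only [h2]; exact (smul_comm h g b.2).symm⟩)
  one_smul := by
    rintro ⟨a⟩
    exact congrArg (Quotient.mk _) (Prod.ext rfl (one_smul _ a.2))
  mul_smul := by
    rintro k l ⟨a⟩
    exact congrArg (Quotient.mk _) (Prod.ext rfl (mul_smul k l a.2))

/-- The composition `X ×_H Y` of bisets, with `k · [x, y] · g = [k x, y g]`. -/
def tensor (X : FinBiset K H) (Y : FinBiset H G) : FinBiset K G where
  carrier := Quotient (tensorSetoid X Y)
  comm := ⟨by rintro k g ⟨a⟩; rfl⟩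

/-- The class of `(x, y)` in `X ×_H Y`. -/
def tmk {X : FinBiset K H} {Y : FinBiset H G} (x : X) (y : Y) : tensor X Y :=
  Quotient.mk (tensorSetoid X Y) (x, y)

theorem tmk_eq_iff {X : FinBiset K H} {Y : FinBiset H G} {x x' : X} {y y' : Y} :
    (tmk x y : tensor X Y) = tmk x' y' ↔ ∃ h : H, x' = op h • x ∧ y = h • y' :=
  Quotient.eq (r := tensorSetoid X Y)

theorem tmk_smul {X : FinBiset K H} {Y : FinBiset H G} (x : X) (h : H) (y : Y) :
    (tmk (op h • x) y : tensor X Y) = tmk x (h • y) :=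
  (tmk_eq_iff.2 ⟨h, rfl, rfl⟩).symm

theorem smul_tmk {X : FinBiset K H} {Y : FinBiset H G} (k : K) (x : X) (y : Y) :
    k • (tmk x y : tensor X Y) = tmk (k • x) y := rfl

theorem op_smul_tmk {X : FinBiset K H} {Y : FinBiset H G} (g : Gᵐᵒᵖ) (x : X) (y : Y) :
    g • (tmk x y : tensor X Y) = tmk x (g • y) := rfl

theorem tmk_surj {X : FinBiset K H} {Y : FinBiset H G} (t : tensor X Y) :
    ∃ x y, tmk x y = t := by
  obtain ⟨⟨x, y⟩, rfl⟩ := Quotient.exists_rep t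
  exact ⟨x, y, rfl⟩

/-- Functions out of `X ×_H Y`. -/
def tlift {X : FinBiset K H} {Y : FinBiset H G} {A : Type*} (f : X → Y → A)
    (hf : ∀ x (h : H) y, f (op h • x) y = f x (h • y)) (t : tensor X Y) : A :=
  Quotient.lift (fun a : X × Y => f a.1 a.2) (by
    rintro ⟨x, y⟩ ⟨x', y'⟩ ⟨h, h1, h2⟩
    simp only at h1 h2
    subst h1 h2
    exact (hf x h y').symm) t

theorem tlift_tmk {X : FinBiset K H} {Y : FinBiset H G} {A : Type*} (f : X → Y → A)
    (hf : ∀ x (h : H) y, f (op h • x) y = f x (h • y)) (x : X) (y : Y) :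
    tlift f hf (tmk x y) = f x y := rfl

/-- Associativity of the composition of bisets. -/
def tensorAssoc (X : FinBiset F K) (Y : FinBiset K H) (Z : FinBiset H G) :
    Iso (tensor (tensor X Y) Z) (tensor X (tensor Y Z)) where
  toFun := tlift (fun t z => tlift (fun x y => tmk x (tmk y z))
      (by intro x h y; rw [tmk_smul]; rfl) t)
    (by
      intro t h z
      obtain ⟨x, y, rfl⟩ := tmk_surj t
      rw [op_smul_tmk, tlift_tmk, tlift_tmk, tmk_smul])
  invFun := tlift (fun x t => tlift (fun y z => tmk (tmk x y) z)
      (by intro y h z; rw [← tmk_smul]; rfl) t)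
    (by
      intro x h t
      obtain ⟨y, z, rfl⟩ := tmk_surj t
      rw [smul_tmk, tlift_tmk, tlift_tmk, tmk_smul])
  left_inv := by
    intro t
    obtain ⟨t, z, rfl⟩ := tmk_surj t
    obtain ⟨x, y, rfl⟩ := tmk_surj t
    rfl
  right_inv := by
    intro t
    obtain ⟨x, t, rfl⟩ := tmk_surj t
    obtain ⟨y, z, rfl⟩ := tmk_surj t
    rfl
  map_left := by
    intro k t
    obtain ⟨t, z, rfl⟩ := tmk_surj t
    obtain ⟨x, y, rfl⟩ := tmk_surj t
    rfl
  map_right := by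
    intro k t
    obtain ⟨t, z, rfl⟩ := tmk_surj t
    obtain ⟨x, y, rfl⟩ := tmk_surj t
    rfl

/-- The `(G, G)`-biset `Iso(θ)` of an automorphism `θ`: the set `G` with `h · x · g = h x θ(g)`. -/
def ofAut (θ : MulAut G) [Finite G] : FinBiset G G where
  carrier := G
  right :=
    { smul := fun g x => x * θ g.unop
      one_smul := fun x => by change x * θ 1 = x; simp
      mul_smul := fun a b x => by
        change x * θ (b.unop * a.unop) = x * θ b.unop * θ a.unop
        simp [mul_assoc] }
  comm :=
    letI : MulAction Gᵐᵒᵖ G :=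
      { smul := fun g x => x * θ g.unop
        one_smul := fun x => by change x * θ 1 = x; simp
        mul_smul := fun a b x => by
          change x * θ (b.unop * a.unop) = x * θ b.unop * θ a.unop
          simp [mul_assoc] }
    @SMulCommClass.mk _ _ _ _ _ (fun a b x => (mul_assoc a x (θ b.unop)).symm)

/-- The identity biset: `G` acting on itself by left and right multiplication. -/
def refl (G : Type v) [Group G] [Finite G] : FinBiset G G where
  carrier := G

/-- `G ×_G Y ≅ Y`. -/
def reflTensor [Finite H] (Y : FinBiset H G) : Iso (tensor (refl H) Y) Y where
  toFun := tlift (fun (h : H) y => h • y) (fun (x : H) h y => mul_smul x h y)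
  invFun y := tmk (X := refl H) (1 : H) y
  left_inv := by
    intro t
    obtain ⟨x, y, rfl⟩ := tmk_surj t
    refine (tmk_smul (X := refl H) (1 : H) x y).symm.trans ?_
    exact congrArg (fun z => tmk (X := refl H) z y) (one_mul (M := H) x)
  right_inv y := one_smul H y
  map_left := by
    intro k t
    obtain ⟨x, y, rfl⟩ := tmk_surj t
    exact mul_smul (α := H) k x y
  map_right := by
    intro k t
    obtain ⟨x, y, rfl⟩ := tmk_surj t
    exact smul_comm (M := H) x (op k) y

/-- `X ×_H H ≅ X`. -/
def tensorRefl [Finite H] (X : FinBiset K H) : Iso (tensor X (refl H)) X where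
  toFun := tlift (fun x (h : H) => op h • x) (fun x h (y : H) => by
    change op y • op h • x = op (h * y) • x
    rw [op_mul, mul_smul])
  invFun x := tmk (Y := refl H) x (1 : H)
  left_inv := by
    intro t
    obtain ⟨x, y, rfl⟩ := tmk_surj t
    refine (tmk_smul (Y := refl H) x y (1 : H)).trans ?_
    exact congrArg (fun z => tmk (Y := refl H) x z) (mul_one (M := H) y)
  right_inv x := one_smul Hᵐᵒᵖ x
  map_left := by
    intro k t
    obtain ⟨x, y, rfl⟩ := tmk_surj t
    exact (smul_comm (N := Hᵐᵒᵖ) k (op y) x).symm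
  map_right := by
    intro k t
    obtain ⟨x, y, rfl⟩ := tmk_surj t
    exact mul_smul (α := Hᵐᵒᵖ) (op k) (op y) x

/-- `X ×_H -` preserves disjoint unions. -/
def tensorSum (X : FinBiset K H) {Y Y' Z : FinBiset H G} (e : Iso Z (sum Y Y')) :
    Iso (tensor X Z) (sum (tensor X Y) (tensor X Y')) where
  toFun := tlift (fun x z => selim (fun y => inl (tmk x y)) (fun y => inr (tmk x y)) (e.toEquiv z))
    (by
      intro x h z
      rw [e.map_left]
      obtain ⟨y, hy⟩ | ⟨y, hy⟩ := sum_cases (e.toEquiv z) <;> rw [hy]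
      · exact congrArg inl (tmk_smul x h y)
      · exact congrArg inr (tmk_smul x h y))
  invFun := selim
    (tlift (fun x y => tmk x (e.toEquiv.symm (inl y))) (by
      intro x h y
      rw [tmk_smul]
      refine congrArg (tmk x) (e.toEquiv.injective ?_)
      rw [e.map_left, Equiv.apply_symm_apply, Equiv.apply_symm_apply]
      rfl))
    (tlift (fun x y => tmk x (e.toEquiv.symm (inr y))) (by
      intro x h y
      rw [tmk_smul]
      refine congrArg (tmk x) (e.toEquiv.injective ?_)
      rw [e.map_left, Equiv.apply_symm_apply, Equiv.apply_symm_apply]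
      rfl))
  left_inv := by
    intro t
    obtain ⟨x, z, rfl⟩ := tmk_surj t
    obtain ⟨y, rfl⟩ := e.toEquiv.symm.surjective z
    rw [tlift_tmk, Equiv.apply_symm_apply]
    obtain ⟨y, rfl⟩ | ⟨y, rfl⟩ := sum_cases y <;> rfl
  right_inv := by
    intro t
    obtain ⟨t, rfl⟩ | ⟨t, rfl⟩ := sum_cases t <;> obtain ⟨x, y, rfl⟩ := tmk_surj t
    · change selim _ _ (e.toEquiv (e.toEquiv.symm (inl y))) = _
      rw [Equiv.apply_symm_apply]; rfl
    · change selim _ _ (e.toEquiv (e.toEquiv.symm (inr y))) = _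
      rw [Equiv.apply_symm_apply]; rfl
  map_left := by
    intro k t
    obtain ⟨x, z, rfl⟩ := tmk_surj t
    change selim _ _ (e.toEquiv z) = k • selim _ _ (e.toEquiv z)
    obtain ⟨y, hy⟩ | ⟨y, hy⟩ := sum_cases (e.toEquiv z) <;> rw [hy] <;> rfl
  map_right := by
    intro k t
    obtain ⟨x, z, rfl⟩ := tmk_surj t
    change selim _ _ (e.toEquiv (op k • z)) = op k • selim _ _ (e.toEquiv z)
    rw [e.map_right]
    obtain ⟨y, hy⟩ | ⟨y, hy⟩ := sum_cases (e.toEquiv z) <;> rw [hy] <;> rfl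

/-- `- ×_H Y` preserves disjoint unions. -/
def sumTensor {X X' Z : FinBiset K H} (e : Iso Z (sum X X')) (Y : FinBiset H G) :
    Iso (tensor Z Y) (sum (tensor X Y) (tensor X' Y)) where
  toFun := tlift (fun z y => selim (fun x => inl (tmk x y)) (fun x => inr (tmk x y)) (e.toEquiv z))
    (by
      intro z h y
      rw [e.map_right]
      obtain ⟨x, hx⟩ | ⟨x, hx⟩ := sum_cases (e.toEquiv z) <;> rw [hx]
      · exact congrArg inl (tmk_smul x h y)
      · exact congrArg inr (tmk_smul x h y))
  invFun := selim
    (tlift (fun x y => tmk (e.toEquiv.symm (inl x)) y) (by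
      intro x h y
      rw [← tmk_smul]
      refine congrArg (tmk · y) (e.toEquiv.injective ?_)
      rw [e.map_right, Equiv.apply_symm_apply, Equiv.apply_symm_apply]
      rfl))
    (tlift (fun x y => tmk (e.toEquiv.symm (inr x)) y) (by
      intro x h y
      rw [← tmk_smul]
      refine congrArg (tmk · y) (e.toEquiv.injective ?_)
      rw [e.map_right, Equiv.apply_symm_apply, Equiv.apply_symm_apply]
      rfl))
  left_inv := by
    intro t
    obtain ⟨z, y, rfl⟩ := tmk_surj t
    obtain ⟨x, rfl⟩ := e.toEquiv.symm.surjective z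
    rw [tlift_tmk, Equiv.apply_symm_apply]
    obtain ⟨x, rfl⟩ | ⟨x, rfl⟩ := sum_cases x <;> rfl
  right_inv := by
    intro t
    obtain ⟨t, rfl⟩ | ⟨t, rfl⟩ := sum_cases t <;> obtain ⟨x, y, rfl⟩ := tmk_surj t
    · change selim _ _ (e.toEquiv (e.toEquiv.symm (inl x))) = _
      rw [Equiv.apply_symm_apply]; rfl
    · change selim _ _ (e.toEquiv (e.toEquiv.symm (inr x))) = _
      rw [Equiv.apply_symm_apply]; rfl
  map_left := by
    intro k t
    obtain ⟨z, y, rfl⟩ := tmk_surj t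
    change selim _ _ (e.toEquiv (k • z)) = k • selim _ _ (e.toEquiv z)
    rw [e.map_left]
    obtain ⟨x, hx⟩ | ⟨x, hx⟩ := sum_cases (e.toEquiv z) <;> rw [hx] <;> rfl
  map_right := by
    intro k t
    obtain ⟨z, y, rfl⟩ := tmk_surj t
    change selim _ _ (e.toEquiv z) = op k • selim _ _ (e.toEquiv z)
    obtain ⟨x, hx⟩ | ⟨x, hx⟩ := sum_cases (e.toEquiv z) <;> rw [hx] <;> rfl

end FinBiset

/-! ### `p`-bifree bisets -/

/-- A finite group is a `p'`-group if `p` does not divide its order. -/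
def IsPPrimeGroup (p : ℕ) (G : Type*) [Group G] : Prop := ¬ p ∣ Nat.card G

/-- A biset is `p`-bifree if all left and right stabilizers of its points are `p'`-groups. -/
def FinBiset.IsBifree (p : ℕ) {H G : Type v} [Group H] [Group G] (X : FinBiset H G) : Prop :=
  ∀ x : X, IsPPrimeGroup p (MulAction.stabilizer H x) ∧
    IsPPrimeGroup p (MulAction.stabilizer Gᵐᵒᵖ x)

namespace FinBiset

variable {p : ℕ} [hp : Fact p.Prime] {K H G : Type v} [Group K] [Group H] [Group G]

theorem pow_smul_eq_of_comm {A B X : Type*} [Group A] [Group B] [MulAction A X] [MulAction B X]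
    [SMulCommClass A B X] {a : A} {b : B} {x : X} (h : a • x = b • x) (n : ℕ) :
    a ^ n • x = b ^ n • x := by
  induction n with
  | zero => simp
  | succ n ih => rw [pow_succ, mul_smul, h, smul_comm, ih, smul_smul, ← pow_succ']

theorem isPPrimeGroup_stabilizer_of {A B X Y : Type*} [Group A] [Finite A] [Group B]
    [MulAction A X] [MulAction B X] [SMulCommClass A B X] [MulAction A Y] (x : X) (y : Y)
    (S : Subgroup B) (hS : IsPPrimeGroup p S) (hx : IsPPrimeGroup p (MulAction.stabilizer A x))
    (h : ∀ a : A, a • y = y → ∃ b ∈ S, a • x = b • x) :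
    IsPPrimeGroup p (MulAction.stabilizer A y) := by
  intro hdvd
  obtain ⟨⟨a, ha⟩, hord⟩ := exists_prime_orderOf_dvd_card' p hdvd
  obtain ⟨b, hb, hab⟩ := h a ha
  have hbn : b ^ Nat.card S = 1 :=
    congrArg Subtype.val (pow_card_eq_one' (x := (⟨b, hb⟩ : S)))
  have h1 : a ^ Nat.card S ∈ MulAction.stabilizer A x := by
    rw [MulAction.mem_stabilizer_iff, pow_smul_eq_of_comm hab, hbn, one_smul]
  have h2 : (a ^ Nat.card S) ^ Nat.card (MulAction.stabilizer A x) = 1 :=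
    congrArg Subtype.val (pow_card_eq_one' (x := (⟨_, h1⟩ : MulAction.stabilizer A x)))
  rw [← pow_mul] at h2
  have h3 : orderOf a = p := by rw [← hord, Subgroup.orderOf_mk]
  have h4 := orderOf_dvd_of_pow_eq_one h2
  rw [h3] at h4
  exact (hp.out.dvd_mul.1 h4).elim hS hx

theorem IsBifree.tensor [Finite K] [Finite G] {X : FinBiset K H} {Y : FinBiset H G}
    (hX : X.IsBifree p) (hY : Y.IsBifree p) : (X.tensor Y).IsBifree p := by
  intro t
  obtain ⟨x, y, rfl⟩ := tmk_surj t
  have : Finite Gᵐᵒᵖ := Finite.of_equiv G opEquiv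
  constructor
  · refine isPPrimeGroup_stabilizer_of (B := Hᵐᵒᵖ) x _ ((MulAction.stabilizer H y).op) ?_ (hX x).1 ?_
    · unfold IsPPrimeGroup
      rw [Nat.card_congr (Subgroup.equivOp _).symm]
      exact (hY y).1
    · intro a ha
      rw [smul_tmk, tmk_eq_iff] at ha
      obtain ⟨h, h1, h2⟩ := ha
      refine ⟨(op h)⁻¹, ?_, ?_⟩
      · rw [inv_mem_iff, Subgroup.mem_op, MulAction.mem_stabilizer_iff, unop_op]
        exact h2.symm
      · rw [eq_inv_smul_iff]
        exact h1.symm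
  · have := SMulCommClass.symm H Gᵐᵒᵖ Y
    refine isPPrimeGroup_stabilizer_of (B := H) y _ ((MulAction.stabilizer Hᵐᵒᵖ x).unop) ?_
      (hY y).2 ?_
    · unfold IsPPrimeGroup
      rw [Nat.card_congr (Subgroup.equivOp _)]
      exact (hX x).2
    · intro a ha
      rw [op_smul_tmk, tmk_eq_iff] at ha
      obtain ⟨h, h1, h2⟩ := ha
      refine ⟨h, ?_, h2⟩
      rw [Subgroup.mem_unop, MulAction.mem_stabilizer_iff]
      exact h1.symm

theorem isPPrimeGroup_of_eq_bot {A : Type*} [Group A] {S : Subgroup A} (h : S = ⊥) :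
    IsPPrimeGroup p S := by
  subst h
  simpa [IsPPrimeGroup] using hp.out.one_lt.ne'

theorem isBifree_ofAut [Finite G] (θ : MulAut G) : (ofAut θ).IsBifree p := by
  intro x
  constructor <;> apply isPPrimeGroup_of_eq_bot <;> rw [eq_bot_iff] <;> intro g hg
  · exact (mul_eq_right (M := G)).1 hg
  · have h : θ g.unop = 1 := (mul_eq_left (M := G)).1 hg
    rw [Subgroup.mem_bot, ← unop_eq_one_iff]
    simpa using h

theorem isBifree_refl [Finite G] : (refl G).IsBifree p := by
  intro x
  constructor <;> apply isPPrimeGroup_of_eq_bot <;> rw [eq_bot_iff] <;> intro g hg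
  · exact (mul_eq_right (M := G)).1 hg
  · have h : g.unop = 1 := (mul_eq_left (M := G)).1 hg
    rw [Subgroup.mem_bot, ← unop_eq_one_iff]
    exact h

end FinBiset

/-! ### Grothendieck groups of bisets, with coefficients -/

section Groth

variable (R : Type u) [CommRing R] {K H G F : Type v} [Group K] [Group H] [Group G] [Group F]

/-- The relations `[Z] = [X] + [Y]` for `Z ≅ X ⊔ Y`. -/
def grothRel (P : FinBiset H G → Prop) : Submodule R ({X : FinBiset H G // P X} →₀ R) :=
  Submodule.span R {d | ∃ X Y Z : {X : FinBiset H G // P X},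
    Nonempty (FinBiset.Iso Z.1 (X.1.sum Y.1)) ∧
      d = Finsupp.single Z 1 - Finsupp.single X 1 - Finsupp.single Y 1}

/-- `R ⊗ B_P(H, G)`, where `B_P(H, G)` is the Grothendieck group, for disjoint unions, of the
category of finite `(H, G)`-bisets that satisfy `P`: the `R`-module with one generator `[X]` for
every such biset `X` and the relations `[Z] = [X] + [Y]` whenever `Z ≅ X ⊔ Y`. (With `Y` empty
this gives `[Z] = [X]` for `Z ≅ X`.) -/
def Groth (P : FinBiset H G → Prop) : Type (max u (v + 1)) :=
  ({X : FinBiset H G // P X} →₀ R) ⧸ grothRel R P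

instance (P : FinBiset H G → Prop) : AddCommGroup (Groth R P) :=
  inferInstanceAs (AddCommGroup (({X : FinBiset H G // P X} →₀ R) ⧸ grothRel R P))

instance (P : FinBiset H G → Prop) : Module R (Groth R P) :=
  inferInstanceAs (Module R (({X : FinBiset H G // P X} →₀ R) ⧸ grothRel R P))

namespace Groth

variable {P : FinBiset H G → Prop}

/-- The class `[X]` of a biset. -/
def mk (X : FinBiset H G) (hX : P X) : Groth R P :=
  (grothRel R P).mkQ (Finsupp.single ⟨X, hX⟩ 1)

theorem mk_sum {X Y Z : FinBiset H G} (hX : P X) (hY : P Y) (hZ : P Z)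
    (e : FinBiset.Iso Z (X.sum Y)) : mk R Z hZ = mk R X hX + mk R Y hY := by
  rw [← sub_eq_zero, ← sub_sub]
  refine (Submodule.Quotient.mk_eq_zero (grothRel R P)).2
    (Submodule.subset_span ⟨⟨X, hX⟩, ⟨Y, hY⟩, ⟨Z, hZ⟩, ⟨e⟩, rfl⟩)

variable {R} {M : Type*} [AddCommGroup M] [Module R M]

/-- Linear maps out of a Grothendieck group, from additive invariants of bisets. -/
def lift (f : ∀ X : FinBiset H G, P X → M)
    (hf : ∀ (X Y Z : FinBiset H G) (hX : P X) (hY : P Y) (hZ : P Z),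
      FinBiset.Iso Z (X.sum Y) → f Z hZ = f X hX + f Y hY) : Groth R P →ₗ[R] M :=
  (grothRel R P).liftQ (Finsupp.lift M R _ (fun X => f X.1 X.2)) (by
    refine Submodule.span_le.2 ?_
    rintro _ ⟨X, Y, Z, ⟨e⟩, rfl⟩
    rw [SetLike.mem_coe, LinearMap.mem_ker, map_sub, map_sub]
    simp [Finsupp.lift_apply, hf X.1 Y.1 Z.1 X.2 Y.2 Z.2 e])

theorem lift_mk (f : ∀ X : FinBiset H G, P X → M)
    (hf : ∀ (X Y Z : FinBiset H G) (hX : P X) (hY : P Y) (hZ : P Z),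
      FinBiset.Iso Z (X.sum Y) → f Z hZ = f X hX + f Y hY) (X : FinBiset H G) (hX : P X) :
    lift (R := R) f hf (mk R X hX) = f X hX := by
  refine ((grothRel R P).liftQ_apply _ _).trans ?_
  simp [Finsupp.lift_apply]

theorem hom_ext {f g : Groth R P →ₗ[R] M}
    (h : ∀ X hX, f (mk R X hX) = g (mk R X hX)) : f = g := by
  refine Submodule.linearMap_qext _ (Finsupp.lhom_ext' fun X => LinearMap.ext_ring ?_)
  exact h X.1 X.2

theorem induction {C : Groth R P → Prop} (h0 : C 0) (hmk : ∀ X hX, C (mk R X hX))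
    (hadd : ∀ a b, C a → C b → C (a + b)) (hsmul : ∀ (r : R) a, C a → C (r • a))
    (a : Groth R P) : C a := by
  obtain ⟨a, rfl⟩ := Submodule.mkQ_surjective (grothRel R P) a
  induction a using Finsupp.induction_linear with
  | zero => rw [map_zero]; exact h0
  | add f g hf hg => rw [map_add]; exact hadd _ _ hf hg
  | single X r =>
    rw [← mul_one r, ← smul_eq_mul, ← Finsupp.smul_single, map_smul]
    exact hsmul _ _ (hmk X.1 X.2)

instance emptyMulAction (H : Type*) [Group H] : MulAction H PEmpty.{v + 1} where
  smul _ x := x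
  one_smul _ := rfl
  mul_smul _ _ x := x.elim

/-- The empty biset. -/
def _root_.BifreeBiset.FinBiset.empty (H G : Type v) [Group H] [Group G] : FinBiset H G where
  carrier := PEmpty
  comm := ⟨fun _ _ x => x.elim⟩

/-- `X ⊔ ∅ ≅ X`. -/
def _root_.BifreeBiset.FinBiset.sumEmpty {X Y : FinBiset H G} (e : FinBiset.Iso X Y) :
    FinBiset.Iso X (Y.sum (FinBiset.empty H G)) where
  toEquiv := e.toEquiv.trans (Equiv.sumEmpty Y PEmpty).symm
  map_left h x := congrArg Sum.inl (e.map_left h x)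
  map_right h x := congrArg Sum.inl (e.map_right h x)

theorem mk_iso (h0 : P (FinBiset.empty H G)) {X Y : FinBiset H G} (hX : P X) (hY : P Y)
    (e : FinBiset.Iso X Y) : mk R X hX = mk R Y hY := by
  have h1 := mk_sum R hX h0 hX (FinBiset.sumEmpty ⟨Equiv.refl X, fun _ _ => rfl, fun _ _ => rfl⟩)
  have h2 := mk_sum R hY h0 hX (FinBiset.sumEmpty e)
  rw [left_eq_add] at h1
  rw [h2, h1, add_zero]

/-- The bilinear map induced by the composition of bisets. -/
def comp {P₁ : FinBiset K H → Prop} {P₂ : FinBiset H G → Prop} {P₃ : FinBiset K G → Prop}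
    (hP : ∀ X Y, P₁ X → P₂ Y → P₃ (X.tensor Y)) :
    Groth R P₁ →ₗ[R] Groth R P₂ →ₗ[R] Groth R P₃ :=
  lift (fun X hX => lift (fun Y hY => mk R (X.tensor Y) (hP X Y hX hY))
      (fun Y Y' Z hY hY' hZ e => mk_sum R _ _ _ (X.tensorSum e)))
    (fun X X' Z hX hX' hZ e => hom_ext fun Y hY => by
      rw [LinearMap.add_apply, lift_mk, lift_mk, lift_mk]
      exact mk_sum R _ _ _ (FinBiset.sumTensor e Y))

theorem comp_mk {P₁ : FinBiset K H → Prop} {P₂ : FinBiset H G → Prop} {P₃ : FinBiset K G → Prop}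
    (hP : ∀ X Y, P₁ X → P₂ Y → P₃ (X.tensor Y)) (X Y) (hX : P₁ X) (hY : P₂ Y) :
    comp (R := R) hP (mk R X hX) (mk R Y hY) = mk R (X.tensor Y) (hP X Y hX hY) := by
  rw [comp, lift_mk, lift_mk]

theorem comp_assoc {P₁ : FinBiset F K → Prop} {P₂ : FinBiset K H → Prop} {P₃ : FinBiset H G → Prop}
    {P₁₂ : FinBiset F H → Prop} {P₂₃ : FinBiset K G → Prop} {Q : FinBiset F G → Prop}
    (h₁₂ : ∀ X Y, P₁ X → P₂ Y → P₁₂ (X.tensor Y)) (h₂₃ : ∀ X Y, P₂ X → P₃ Y → P₂₃ (X.tensor Y))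
    (h : ∀ X Y, P₁₂ X → P₃ Y → Q (X.tensor Y)) (h' : ∀ X Y, P₁ X → P₂₃ Y → Q (X.tensor Y))
    (h0 : Q (FinBiset.empty F G)) (a : Groth R P₁) (b : Groth R P₂) (c : Groth R P₃) :
    comp h (comp h₁₂ a b) c = comp h' a (comp h₂₃ b c) := by
  induction a using induction with
  | h0 => simp
  | hadd x y hx hy => simp only [map_add, LinearMap.add_apply, hx, hy]
  | hsmul r x hx => simp only [map_smul, LinearMap.smul_apply, hx]
  | hmk X hX =>
    induction b using induction with
    | h0 => simp
    | hadd x y hx hy => simp only [map_add, LinearMap.add_apply, hx, hy]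
    | hsmul r x hx => simp only [map_smul, LinearMap.smul_apply, hx]
    | hmk Y hY =>
      induction c using induction with
      | h0 => simp
      | hadd x y hx hy => simp only [map_add, hx, hy]
      | hsmul r x hx => simp only [map_smul, hx]
      | hmk Z hZ =>
        simp only [comp_mk]
        exact mk_iso h0 _ _ (FinBiset.tensorAssoc X Y Z)

theorem refl_comp [Finite H] {P₁ : FinBiset H H → Prop} {P₂ : FinBiset H G → Prop}
    (hP : ∀ X Y, P₁ X → P₂ Y → P₂ (X.tensor Y)) (h0 : P₂ (FinBiset.empty H G))
    (h1 : P₁ (FinBiset.refl H)) (a : Groth R P₂) :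
    comp hP (mk R (FinBiset.refl H) h1) a = a := by
  induction a using induction with
  | h0 => simp
  | hadd x y hx hy => rw [map_add, hx, hy]
  | hsmul r x hx => rw [map_smul, hx]
  | hmk Y hY =>
    rw [comp_mk]
    exact mk_iso h0 _ _ (FinBiset.reflTensor Y)

theorem comp_refl [Finite H] {P₁ : FinBiset K H → Prop} {P₂ : FinBiset H H → Prop}
    (hP : ∀ X Y, P₁ X → P₂ Y → P₁ (X.tensor Y)) (h0 : P₁ (FinBiset.empty K H))
    (h1 : P₂ (FinBiset.refl H)) (a : Groth R P₁) :
    comp hP a (mk R (FinBiset.refl H) h1) = a := by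
  induction a using induction with
  | h0 => simp
  | hadd x y hx hy => rw [map_add, LinearMap.add_apply, hx, hy]
  | hsmul r x hx => rw [map_smul, LinearMap.smul_apply, hx]
  | hmk X hX =>
    rw [comp_mk]
    exact mk_iso h0 _ _ (FinBiset.tensorRefl X)

end Groth

end Groth

/-! ### The category of `p`-bifree bisets -/

/-- `R B^Δ(H, G)`: the Grothendieck group of `p`-bifree `(H, G)`-bisets, over `R`. -/
abbrev BDelta (p : ℕ) (R : Type u) [CommRing R] (H G : Type v) [Group H] [Group G] :
    Type (max u (v + 1)) :=
  Groth R (fun X : FinBiset H G => X.IsBifree p)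

theorem isBifree_empty (p : ℕ) (H G : Type v) [Group H] [Group G] :
    (FinBiset.empty H G).IsBifree p := fun x => PEmpty.elim x

/-- The product `B^Δ(K, H) × B^Δ(H, G) → B^Δ(K, G)` induced by the composition of bisets. -/
def BDelta.comp {p : ℕ} [Fact p.Prime] {R : Type u} [CommRing R] {K H G : Type v}
    [Group K] [Group H] [Group G] [Finite K] [Finite G] :
    BDelta p R K H →ₗ[R] BDelta p R H G →ₗ[R] BDelta p R K G :=
  Groth.comp (fun _ _ => FinBiset.IsBifree.tensor)

/-- The objects of the category `R C^Δ`: finite groups. -/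
structure BifreeCat (p : ℕ) (R : Type u) : Type (v + 1) where
  grp : FiniteGrp.{v}

section Category

variable (p : ℕ) [hp : Fact p.Prime] (R : Type u) [CommRing R]

/-- The category `R C^Δ`: `Hom(G, H) = R B^Δ(H, G)`, the composite of `f : G ⟶ H` and
`g : H ⟶ K` is `g ·_H f`, and the identity of `G` is the class of the biset `G`. -/
instance bifreeCategory : Category (BifreeCat.{u, v} p R) where
  Hom G H := BDelta p R H.grp G.grp
  id G := Groth.mk R (FinBiset.refl G.grp) FinBiset.isBifree_refl
  comp f g := BDelta.comp g f
  id_comp f := Groth.comp_refl _ (isBifree_empty _ _ _) _ f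
  comp_id f := Groth.refl_comp _ (isBifree_empty _ _ _) _ f
  assoc f g h := (Groth.comp_assoc _ _ _ _ (isBifree_empty _ _ _) h g f).symm

instance : Preadditive (BifreeCat.{u, v} p R) where
  homGroup G H := inferInstanceAs (AddCommGroup (BDelta p R H.grp G.grp))
  add_comp _ _ _ f f' g := (BDelta.comp g).map_add f f'
  comp_add _ _ _ f g g' := BDelta.comp.map_add₂ g g' f

instance : Linear R (BifreeCat.{u, v} p R) where
  homModule G H := inferInstanceAs (Module R (BDelta p R H.grp G.grp))
  smul_comp _ _ _ r f g := (BDelta.comp g).map_smul r f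
  comp_smul _ _ _ f r g := BDelta.comp.map_smul₂ r g f

variable {p R}

/-- The object of `R C^Δ` given by a finite group. -/
def BifreeCat.of (G : FiniteGrp.{v}) : BifreeCat.{u, v} p R := ⟨G⟩

/-- The endomorphism `[Iso(θ)]` of `G` given by an automorphism `θ` of the group `G`. -/
def BifreeCat.isoAut {G : BifreeCat.{u, v} p R} (θ : MulAut G.grp) : G ⟶ G :=
  Groth.mk R (FinBiset.ofAut θ) (FinBiset.isBifree_ofAut θ)

/-- The ideal `I_G` of `End(G)` spanned by the endomorphisms that factor through a group of
smaller order. -/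
def BifreeCat.smallIdeal (G : BifreeCat.{u, v} p R) : Submodule R (G ⟶ G) :=
  Submodule.span R {f | ∃ (H : BifreeCat.{u, v} p R) (a : G ⟶ H) (b : H ⟶ G),
    Nat.card H.grp < Nat.card G.grp ∧ f = a ≫ b}

end Category

/-! ### Subfunctors, quotients, simple functors, composition factors

A `p`-bifree biset functor over `R` is an `R`-linear functor from `R C^Δ` to `R`-modules, that is,
`F : BifreeCat p R ⥤ ModuleCat R` with `F.Linear R`. -/

section Functors

variable {p : ℕ} [hp : Fact p.Prime] {R : Type u} [CommRing R]

/-- A subfunctor: a family of submodules that is stable under the action of all morphisms. -/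
@[ext]
structure SubFun (F : BifreeCat.{u, v} p R ⥤ ModuleCat.{w} R) where
  obj : ∀ G, Submodule R (F.obj G)
  map_mem : ∀ {G H} (f : G ⟶ H) (x : F.obj G), x ∈ obj G → (F.map f).hom x ∈ obj H

namespace SubFun

variable {F : BifreeCat.{u, v} p R ⥤ ModuleCat.{w} R}

instance : LE (SubFun F) := ⟨fun A B => A.obj ≤ B.obj⟩
instance : LT (SubFun F) := ⟨fun A B => A.obj < B.obj⟩
instance : Top (SubFun F) := ⟨⟨fun _ => ⊤, fun _ _ _ => trivial⟩⟩
instance : Bot (SubFun F) := ⟨⟨fun _ => ⊥, fun f x hx => by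
  rw [Submodule.mem_bot] at hx ⊢; rw [hx, map_zero]⟩⟩
instance : Min (SubFun F) := ⟨fun A B => ⟨fun G => A.obj G ⊓ B.obj G, fun f x hx =>
  ⟨A.map_mem f x hx.1, B.map_mem f x hx.2⟩⟩⟩
instance : Max (SubFun F) := ⟨fun A B => ⟨fun G => A.obj G ⊔ B.obj G, fun {G H} f x hx => by
  have h : A.obj G ⊔ B.obj G ≤ (A.obj H ⊔ B.obj H).comap (F.map f).hom :=
    sup_le (fun y hy => Submodule.mem_sup_left (A.map_mem f y hy))
      (fun y hy => Submodule.mem_sup_right (B.map_mem f y hy))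
  exact h hx⟩⟩
instance : InfSet (SubFun F) := ⟨fun s => ⟨fun G => ⨅ A ∈ s, A.obj G, fun f x hx => by
  simp only [Submodule.mem_iInf] at hx ⊢
  exact fun A hA => A.map_mem f x (hx A hA)⟩⟩
instance : SupSet (SubFun F) := ⟨fun s => ⟨fun G => ⨆ A ∈ s, A.obj G, fun {G H} f x hx => by
  have h : (⨆ A ∈ s, A.obj G) ≤ (⨆ A ∈ s, A.obj H).comap (F.map f).hom :=
    iSup₂_le fun A hA y hy => Submodule.mem_iSup_of_mem A
      (Submodule.mem_iSup_of_mem hA (A.map_mem f y hy))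
  exact h hx⟩⟩

/-- Subfunctors of `F` ordered by inclusion; suprema are sums and infima are intersections,
computed group by group. -/
instance : CompleteLattice (SubFun F) :=
  Function.Injective.completeLattice SubFun.obj (fun _ _ h => SubFun.ext h) Iff.rfl Iff.rfl
    (fun _ _ => rfl) (fun _ _ => rfl)
    (fun s => by funext G; simp only [iSup_apply]; rfl)
    (fun s => by funext G; simp only [iInf_apply]; rfl) rfl rfl

/-- The subfunctor generated by an element `x` of `F(G)`. -/
def generate (G : BifreeCat.{u, v} p R) (x : F.obj G) : SubFun F := sInf {A | x ∈ A.obj G}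

/-- A subfunctor as a functor. -/
@[simps]
def toFunctor (A : SubFun F) : BifreeCat.{u, v} p R ⥤ ModuleCat.{w} R where
  obj G := ModuleCat.of R (A.obj G)
  map f := ModuleCat.ofHom ((F.map f).hom.restrict (A.map_mem f))
  map_id G := by ext x; simp
  map_comp f g := by ext x; simp

/-- The quotient functor `F / A`. -/
@[simps]
def quotient (A : SubFun F) : BifreeCat.{u, v} p R ⥤ ModuleCat.{w} R where
  obj G := ModuleCat.of R (F.obj G ⧸ A.obj G)
  map {G H} f := ModuleCat.ofHom ((A.obj G).mapQ (A.obj H) (F.map f).hom (A.map_mem f))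
  map_id G := by ext x; simp
  map_comp f g := by ext x; simp

instance (A : SubFun F) [F.Additive] : A.toFunctor.Additive where
  map_add {_ _ f g} := by
    refine ModuleCat.hom_ext (LinearMap.ext fun x => Subtype.ext ?_)
    exact congrArg (fun l => l.hom x.1) (F.map_add (f := f) (g := g))

instance (A : SubFun F) [F.Linear R] : A.toFunctor.Linear R where
  map_smul f r := by
    refine ModuleCat.hom_ext (LinearMap.ext fun x => Subtype.ext ?_)
    exact congrArg (fun l => l.hom x.1) (F.map_smul r f)

instance (A : SubFun F) [F.Additive] : A.quotient.Additive where
  map_add {G H f g} := by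
    refine ModuleCat.hom_ext (Submodule.linearMap_qext _ (LinearMap.ext fun x => ?_))
    exact congrArg (fun l => (A.obj H).mkQ (l.hom x)) (F.map_add (f := f) (g := g))

instance (A : SubFun F) [F.Linear R] : A.quotient.Linear R where
  map_smul {G H} f r := by
    refine ModuleCat.hom_ext (Submodule.linearMap_qext _ (LinearMap.ext fun x => ?_))
    exact congrArg (fun l => (A.obj H).mkQ (l.hom x)) (F.map_smul r f)

/-- `A ∩ B` as a subfunctor of `B`. -/
def restrict (A B : SubFun F) : SubFun B.toFunctor where
  obj G := (A.obj G).comap (B.obj G).subtype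
  map_mem f x hx := A.map_mem f x.1 hx

/-- The subquotient `B / A` of `F`, for `A ≤ B`. -/
def subquotient (A B : SubFun F) : BifreeCat.{u, v} p R ⥤ ModuleCat.{w} R :=
  (A.restrict B).quotient

end SubFun

/-- A functor is simple if it is nonzero and has no subfunctors other than `0` and itself. -/
def IsSimpleFunctor (F : BifreeCat.{u, v} p R ⥤ ModuleCat.{w} R) : Prop :=
  IsSimpleOrder (SubFun F)

/-- `S` is a composition factor of `F` if `S` is simple and isomorphic to `B / A` for some
subfunctors `A ≤ B` of `F`. -/
def IsCompositionFactor (S F : BifreeCat.{u, v} p R ⥤ ModuleCat.{w} R) : Prop :=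
  IsSimpleFunctor S ∧ ∃ A B : SubFun F, A ≤ B ∧ Nonempty (A.subquotient B ≅ S)

end Functors

/-! ### The simple functors `S^Δ_{G,V}` -/

/-- The group `Inn(G)` of inner automorphisms. -/
def Inn (G : Type*) [Group G] : Subgroup (MulAut G) := (MulAut.conj : G →* MulAut G).range

instance innNormal (G : Type*) [Group G] : (Inn G).Normal := ⟨by
  rintro _ ⟨g, rfl⟩ θ
  exact ⟨θ g, by ext x; simp⟩⟩

/-- The group `Out(G) = Aut(G) / Inn(G)` of outer automorphisms. -/
abbrev Out (G : Type*) [Group G] : Type _ := MulAut G ⧸ Inn G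

section Simple

variable {p : ℕ} [hp : Fact p.Prime] {R : Type u} [CommRing R]
variable (G : BifreeCat.{u, v} p R) {V : Type u} [AddCommGroup V] [Module R V]

/-- The functor `H ↦ R B^Δ(H, G) ⊗_R V`. -/
def homTensor (V : Type u) [AddCommGroup V] [Module R V] :
    BifreeCat.{u, v} p R ⥤ ModuleCat.{max u (v + 1)} R where
  obj H := ModuleCat.of R ((G ⟶ H) ⊗[R] V)
  map f := ModuleCat.ofHom (LinearMap.rTensor V (Linear.rightComp R G f))
  map_id H := by
    refine ModuleCat.hom_ext (TensorProduct.ext' fun f v => ?_)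
    exact congrArg (· ⊗ₜ[R] v) (Category.comp_id f)
  map_comp g h := by
    refine ModuleCat.hom_ext (TensorProduct.ext' fun f v => ?_)
    exact congrArg (· ⊗ₜ[R] v) (Category.assoc f g h).symm

theorem homTensor_map_tmul {H H' : BifreeCat.{u, v} p R} (g : H ⟶ H') (f : G ⟶ H) (v : V) :
    ((homTensor G V).map g).hom (f ⊗ₜ[R] v) = (f ≫ g) ⊗ₜ[R] v := rfl

instance : (homTensor G V).Additive where
  map_add {H H' g h} := by
    refine ModuleCat.hom_ext (TensorProduct.ext' fun f v => ?_)
    exact (congrArg (· ⊗ₜ[R] v) (Preadditive.comp_add _ _ _ f g h)).trans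
      (TensorProduct.add_tmul _ _ v)

instance : (homTensor G V).Linear R where
  map_smul {H H'} g r := by
    refine ModuleCat.hom_ext (TensorProduct.ext' fun f v => ?_)
    exact congrArg (· ⊗ₜ[R] v) (Linear.comp_smul _ _ _ f r g)

/-- The relations that define `R B^Δ(H, G) ⊗_{E_G} V` as a quotient of `R B^Δ(H, G) ⊗_R V`. Here
`E_G = End(G)` is spanned by the `[Iso(θ)]` and by `I_G`, and it acts on the `R Out(G)`-module `V`
through `E_G / I_G ≅ R Out(G)`: `[Iso(θ)]` acts as the class of `θ`, and `I_G` acts as `0`. -/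
def tensorRel (ρ : Representation R (Out G.grp) V) : SubFun (homTensor G V) where
  obj H := Submodule.span R
    ({t | ∃ (f : G ⟶ H) (θ : MulAut G.grp) (v : V),
        t = (BifreeCat.isoAut θ ≫ f) ⊗ₜ[R] v - f ⊗ₜ[R] ρ (QuotientGroup.mk θ) v} ∪
      {t | ∃ (f : G ⟶ H) (a : G ⟶ G) (v : V), a ∈ G.smallIdeal ∧ t = (a ≫ f) ⊗ₜ[R] v})
  map_mem {H H'} g x hx := by
    refine Submodule.mem_comap.1 (Submodule.span_le.2 ?_ hx)
    rintro _ (⟨f, θ, v, rfl⟩ | ⟨f, a, v, ha, rfl⟩)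
    · refine Submodule.subset_span (Or.inl ⟨f ≫ g, θ, v, ?_⟩)
      refine (map_sub ((homTensor G V).map g).hom _ _).trans ?_
      rw [homTensor_map_tmul, homTensor_map_tmul, Category.assoc]
      rfl
    · refine Submodule.subset_span (Or.inr ⟨f ≫ g, a, v, ha, ?_⟩)
      exact (homTensor_map_tmul G g (a ≫ f) v).trans (by rw [Category.assoc])

/-- The functor `L_{G,V}`, `H ↦ R B^Δ(H, G) ⊗_{E_G} V`. -/
def functorL (ρ : Representation R (Out G.grp) V) :
    BifreeCat.{u, v} p R ⥤ ModuleCat.{max u (v + 1)} R :=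
  (tensorRel G ρ).quotient

/-- The subfunctor `J_{G,V}` of `L_{G,V}`: the elements of `L_{G,V}(H)` that are killed by all
morphisms from `H` to `G`. (The module `L_{G,V}(G) = E_G ⊗_{E_G} V` is `V`.) -/
def functorJ (ρ : Representation R (Out G.grp) V) : SubFun (functorL G ρ) where
  obj H := ⨅ y : H ⟶ G, LinearMap.ker ((functorL G ρ).map y).hom
  map_mem f x hx := by
    simp only [Submodule.mem_iInf, LinearMap.mem_ker] at hx ⊢
    intro y
    have := hx (f ≫ y)
    rwa [Functor.map_comp, ModuleCat.hom_comp, LinearMap.comp_apply] at this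

/-- The functor `S^Δ_{G,V} = L_{G,V} / J_{G,V}`, for an `R Out(G)`-module `V`. -/
def functorS (ρ : Representation R (Out G.grp) V) :
    BifreeCat.{u, v} p R ⥤ ModuleCat.{max u (v + 1)} R :=
  (functorJ G ρ).quotient

instance (ρ : Representation R (Out G.grp) V) : (functorL G ρ).Additive :=
  inferInstanceAs (tensorRel G ρ).quotient.Additive

instance (ρ : Representation R (Out G.grp) V) : (functorL G ρ).Linear R :=
  inferInstanceAs ((tensorRel G ρ).quotient.Linear R)

instance (ρ : Representation R (Out G.grp) V) : (functorS G ρ).Additive :=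
  inferInstanceAs (functorJ G ρ).quotient.Additive

instance (ρ : Representation R (Out G.grp) V) : (functorS G ρ).Linear R :=
  inferInstanceAs ((functorJ G ρ).quotient.Linear R)

/-- The functor `S^Δ_{G,R}`, for the trivial module `R` of `Out(G)`. -/
def functorSTriv : BifreeCat.{u, v} p R ⥤ ModuleCat.{max u (v + 1)} R :=
  functorS G (Representation.trivial R (Out G.grp) R)

end Simple

/-! ### The Burnside functor -/

section Burnside

/-- A finite `G`-set as a `(G, 1)`-biset. -/
def FinBiset.ofGSet (G : Type v) [Group G] (X : Type v) [Finite X] [MulAction G X] :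
    FinBiset G PUnit.{v + 1} where
  carrier := X
  right := { smul := fun _ x => x, one_smul := fun _ => rfl, mul_smul := fun _ _ _ => rfl }
  comm :=
    letI : MulAction PUnit.{v + 1}ᵐᵒᵖ X :=
      { smul := fun _ x => x, one_smul := fun _ => rfl, mul_smul := fun _ _ _ => rfl }
    @SMulCommClass.mk _ _ _ _ _ (fun _ _ _ => rfl)

/-- The Burnside group `R B(G) = R ⊗ B(G)`: the Grothendieck group of all finite `G`-sets, that is,
of all finite `(G, 1)`-bisets, over `R`. -/
abbrev Burn (R : Type u) [CommRing R] (G : Type v) [Group G] : Type (max u (v + 1)) :=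
  Groth R (fun _ : FinBiset G PUnit.{v + 1} => True)

/-- The action `B^Δ(H, G) × B(G) → B(H)`, `(X, U) ↦ X ×_G U`. -/
def Burn.act {p : ℕ} {R : Type u} [CommRing R] {H G : Type v} [Group H] [Group G] :
    BDelta p R H G →ₗ[R] Burn R G →ₗ[R] Burn R H :=
  Groth.comp (fun _ _ _ _ => trivial)

theorem Burn.act_refl {p : ℕ} [Fact p.Prime] {R : Type u} [CommRing R] {G : Type v} [Group G]
    [Finite G] (x : Burn R G) :
    Burn.act (Groth.mk R (FinBiset.refl G) (FinBiset.isBifree_refl (p := p))) x = x :=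
  Groth.refl_comp _ trivial _ x

theorem Burn.act_act {p : ℕ} [Fact p.Prime] {R : Type u} [CommRing R] {K H G : Type v} [Group K]
    [Group H] [Group G] [Finite K] [Finite G] (a : BDelta p R K H) (b : BDelta p R H G)
    (x : Burn R G) : Burn.act (BDelta.comp a b) x = Burn.act a (Burn.act b x) :=
  Groth.comp_assoc _ _ _ _ trivial a b x

variable (p : ℕ) [hp : Fact p.Prime] (R : Type u) [CommRing R]

/-- The Burnside functor `R B` as a `p`-bifree biset functor: a `p`-bifree `(H, G)`-biset `X` sends
a `G`-set `U` to the `H`-set `X ×_G U`. -/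
def burnside : BifreeCat.{u, v} p R ⥤ ModuleCat.{max u (v + 1)} R where
  obj G := ModuleCat.of R (Burn R G.grp)
  map f := ModuleCat.ofHom (Burn.act f)
  map_id G := by
    refine ModuleCat.hom_ext (LinearMap.ext fun x => ?_)
    exact Burn.act_refl x
  map_comp f g := by
    refine ModuleCat.hom_ext (LinearMap.ext fun x => ?_)
    exact Burn.act_act g f x

instance : (burnside.{u, v} p R).Additive where
  map_add {_ _ f g} := ModuleCat.hom_ext (Burn.act.map_add f g)

instance : (burnside.{u, v} p R).Linear R where
  map_smul f r := ModuleCat.hom_ext (Burn.act.map_smul r f)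

end Burnside

/-! ### Möbius function, deflation numbers, `B^Δ_p`-groups -/

section BGroups

open Classical in
/-- The value `μ(X, G)` of the Möbius function of the poset of subgroups of `G`. -/
def moebiusTop {G : Type*} [Group G] [Finite G] (X : Subgroup G) : ℤ :=
  letI : Fintype (Subgroup G) := Fintype.ofFinite _
  letI : LocallyFiniteOrder (Subgroup G) := Fintype.toLocallyFiniteOrder
  IncidenceAlgebra.mu ℤ X ⊤

open Classical in
/-- The deflation number `m_{G,N} = |G|⁻¹ ∑_{X N = G} |X| μ(X, G)`, the sum over the subgroups `X`
of `G` with `X N = G`. -/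
def deflationNumber {G : Type*} [Group G] [Finite G] (N : Subgroup G) : ℚ :=
  letI : Fintype (Subgroup G) := Fintype.ofFinite _
  (Nat.card G : ℚ)⁻¹ *
    ∑ X ∈ {X : Subgroup G | (X : Set G) * (N : Set G) = Set.univ}.toFinset,
      (Nat.card X : ℚ) * moebiusTop X

/-- `G` is a `B^Δ_p`-group if `m_{G,N} = 0` for every nontrivial normal `p'`-subgroup `N`. -/
def IsBGroup (p : ℕ) (G : Type*) [Group G] [Finite G] : Prop :=
  ∀ N : Subgroup G, N.Normal → N ≠ ⊥ → IsPPrimeGroup p N → deflationNumber N = 0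

/-- `G ≫ H`: the group `H` is isomorphic to the quotient of `G` by a normal `p'`-subgroup. -/
def Dominates (p : ℕ) (G H : Type*) [Group G] [Group H] : Prop :=
  ∃ (N : Subgroup G) (_ : N.Normal), IsPPrimeGroup p N ∧ Nonempty (G ⧸ N ≃* H)

/-- Finite `B^Δ_p`-groups. -/
def BGroup (p : ℕ) : Type (v + 1) := {G : FiniteGrp.{v} // IsBGroup p G}

instance isoSetoid (p : ℕ) : Setoid (BGroup.{v} p) where
  r G H := Nonempty (G.1 ≃* H.1)
  iseqv := ⟨fun _ => ⟨MulEquiv.refl _⟩, fun ⟨e⟩ => ⟨e.symm⟩, fun ⟨e⟩ ⟨f⟩ => ⟨e.trans f⟩⟩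

/-- The set `[B^Δ_p-gr]` of isomorphism classes of `B^Δ_p`-groups. -/
def BGroupClass (p : ℕ) : Type (v + 1) := Quotient (isoSetoid.{v} p)

/-- The isomorphism class of a `B^Δ_p`-group. -/
def BGroup.cls {p : ℕ} (G : BGroup.{v} p) : BGroupClass.{v} p := Quotient.mk _ G

/-- A set of isomorphism classes of `B^Δ_p`-groups is closed if it contains the class of `G`
whenever it contains the class of `H` and `G ≫ H`. -/
def IsClosedClass {p : ℕ} (A : Set (BGroupClass.{v} p)) : Prop :=
  ∀ G H : BGroup.{v} p, H.cls ∈ A → Dominates p G.1 H.1 → G.cls ∈ A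

end BGroups

/-! ### The idempotents `e^G_G` and the subfunctors they generate -/

section Idempotents

/-- The class `[G/X]` in `R B(G)`. -/
def Burn.coset (R : Type u) [CommRing R] {G : Type v} [Group G] [Finite G] (X : Subgroup G) :
    Burn R G :=
  Groth.mk R (FinBiset.ofGSet G (G ⧸ X)) trivial

/-- The mark at a subgroup `L`: the linear form on `R B(G)` that sends a `G`-set to the number of
its `L`-fixed points. -/
def Burn.mark (R : Type u) [CommRing R] {G : Type v} [Group G] (L : Subgroup G) :
    Burn R G →ₗ[R] R :=
  Groth.lift (fun X _ => (Nat.card {x : X // ∀ l ∈ L, l • x = x} : R)) (by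
    intro X Y Z _ _ _ e
    rw [← Nat.cast_add, ← Nat.card_sum]
    congr 1
    refine Nat.card_congr ((Equiv.subtypeEquiv (q := fun z : X.sum Y => ∀ l ∈ L, l • z = z)
      e.toEquiv ?_).trans ((Equiv.subtypeSum).trans (Equiv.sumCongr ?_ ?_)))
    · intro z
      refine forall₂_congr fun l _ => ?_
      rw [← e.map_left, e.toEquiv.apply_eq_iff_eq]
    · exact Equiv.subtypeEquivRight fun x => forall₂_congr fun l _ => Sum.inl_injective.eq_iff
    · exact Equiv.subtypeEquivRight fun x => forall₂_congr fun l _ => Sum.inr_injective.eq_iff)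

variable (K : Type u) [Field K]

/-- The primitive idempotent `e^G_G` of `K B(G)`, by Gluck's formula
`e^G_G = |G|⁻¹ ∑_{X ≤ G} |X| μ(X, G) [G/X]`. See `mark_idem`. -/
def Burn.idem (G : Type v) [Group G] [Finite G] : Burn K G :=
  letI : Fintype (Subgroup G) := Fintype.ofFinite _
  (Nat.card G : K)⁻¹ • ∑ X : Subgroup G, ((Nat.card X : K) * (moebiusTop X : K)) • Burn.coset K X

theorem card_mul_fixed {G : Type v} [Group G] [Finite G] (X L : Subgroup G) :
    Nat.card X * Nat.card {x : G ⧸ X // ∀ l ∈ L, l • x = x} =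
      Nat.card {g : G // L.map (MulAut.conj g⁻¹).toMonoidHom ≤ X} := by
  have := QuotientGroup.card_preimage_mk X {x : G ⧸ X | ∀ l ∈ L, l • x = x}
  refine this.symm.trans (Nat.card_congr (Equiv.subtypeEquivRight fun g => ?_))
  rw [Subgroup.map_le_iff_le_comap]
  change (∀ l ∈ L, l • (g : G ⧸ X) = g) ↔ ∀ l ∈ L, MulAut.conj g⁻¹ l ∈ X
  refine forall₂_congr fun l hl => ?_
  rw [MulAction.Quotient.smul_mk, eq_comm, QuotientGroup.eq]
  simp [mul_assoc]

theorem sum_moebiusTop {G : Type v} [Group G] [Finite G] [Fintype (Subgroup G)]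
    [DecidableEq (Subgroup G)] [DecidableLE (Subgroup G)] (L : Subgroup G) :
    ∑ X : Subgroup G, (if L ≤ X then moebiusTop X else 0) = if L = ⊤ then 1 else 0 := by
  classical
  let : LocallyFiniteOrder (Subgroup G) := Fintype.toLocallyFiniteOrder
  rw [← IncidenceAlgebra.sum_Icc_mu_left (𝕜 := ℤ) L ⊤, ← Finset.sum_filter]
  refine Finset.sum_congr ?_ fun X _ => ?_
  · ext X
    simp
  · unfold moebiusTop
    congr!

/-- The marks of `e^G_G` are `1` at `G` and `0` at every proper subgroup. -/
theorem mark_idem [CharZero K] (G : Type v) [Group G] [Finite G] (L : Subgroup G) [Decidable (L = ⊤)] :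
    Burn.mark K L (Burn.idem K G) = if L = ⊤ then 1 else 0 := by
  classical
  let : Fintype (Subgroup G) := Fintype.ofFinite _
  let : Fintype G := Fintype.ofFinite _
  have hG : (Nat.card G : K) ≠ 0 := Nat.cast_ne_zero.2 Nat.card_pos.ne'
  have hmark : ∀ X : Subgroup G, Burn.mark K L (Burn.coset K X) =
      (Nat.card {x : G ⧸ X // ∀ l ∈ L, l • x = x} : K) := fun X => Groth.lift_mk _ _ _ _
  have h1 : ∀ X : Subgroup G, (Nat.card X : K) * (moebiusTop X : K) *
      (Nat.card {x : G ⧸ X // ∀ l ∈ L, l • x = x} : K) =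
      ∑ g : G, (((if L.map (MulAut.conj g⁻¹).toMonoidHom ≤ X then moebiusTop X else 0 : ℤ)) : K) := by
    intro X
    rw [mul_right_comm, ← Nat.cast_mul, card_mul_fixed, Nat.card_eq_fintype_card,
      Fintype.card_subtype, ← Int.cast_sum, ← Finset.sum_filter, Finset.sum_const, nsmul_eq_mul]
    push_cast
    rfl
  have h2 : ∀ g : G, L.map (MulAut.conj g⁻¹).toMonoidHom = ⊤ ↔ L = ⊤ := by
    intro g
    rw [← (Subgroup.map_injective (f := (MulAut.conj g⁻¹).toMonoidHom)
      (MulAut.conj g⁻¹).injective).eq_iff (a := L) (b := ⊤),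
      Subgroup.map_top_of_surjective _ (MulAut.conj g⁻¹).surjective]
  unfold Burn.idem
  rw [map_smul, map_sum]
  simp only [map_smul, hmark, smul_eq_mul, h1]
  rw [Finset.sum_comm]
  simp only [← Int.cast_sum, sum_moebiusTop, h2]
  by_cases hL : L = ⊤ <;> simp [hL]

variable (p : ℕ) [hp : Fact p.Prime]

/-- The subfunctor `e^Δ_G` of `K B` generated by `e^G_G ∈ K B(G)`. -/
def eSub (G : FiniteGrp.{v}) : SubFun (burnside.{u, v} p K) :=
  SubFun.generate (BifreeCat.of G) (Burn.idem K G : Burn K G)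

/-- The subfunctor `j_G`: the sum of the `e^Δ_H` over the `B^Δ_p`-groups `H` with `H ≫ G` and
`H ≇ G`. -/
def jSub (G : FiniteGrp.{v}) : SubFun (burnside.{u, v} p K) :=
  ⨆ (H : BGroup.{v} p) (_ : Dominates p H.1 G) (_ : ¬ Nonempty (H.1 ≃* G)), eSub K p H.1

end Idempotents

end BifreeBiset

end

open BifreeBiset

/-! Everything rests on marks. In characteristic zero an element of `K B(G)` is determined by its
marks (`Burn.ext_mark`), and it is the sum over the subgroups `L` of its mark at `L`, times
`|L|/|G|`, times the element induced from `e^L_L` (`Burn.eq_sum_mark`). Conversely a homomorphism `φ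
: H → G` with `p'`-kernel gives a morphism that sends `x` to (mark of `x` at `φ(H)`) times `e^H_H`
(`Burn.exists_act_eq_mark_smul_idem`): restrict along `φ`, then multiply by `e^H_H`. Hence `x` lies
in a subfunctor `F` exactly when `F` contains `e^L_L` for every `L` at which `x` has nonzero mark.
So `F` is determined by the `e^Δ_G` inside it. Since the mark at `G` is linear, an `e^Δ_G` inside a
sum of subfunctors lies in one of the summands (`exists_eSub_le_of_le_sSup`).

It remains to compare the `e^Δ_G` with each other. Restriction along a surjection gives `e^Δ_G ⊆
e^Δ_H` whenever `G ≫ H`. The main computation is the mark at `G` of `X ×_H e^H_H`: it is `|H|⁻¹ ∑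
|R_x| m_{H,R_x}`, the sum over the points `x` whose left and right orbits coincide, `R_x` being the
right stabilizer (`Burn.mark_top_act_idem`). It has two uses. For the biset `G/N` the mark is
`m_{G,N}`, so `m_{G,N} ≠ 0` forces `e^Δ_{G/N} = e^Δ_G`, and by induction on the order every `e^Δ_G`
equals `e^Δ_H` for some `B^Δ_p`-group `H`. If `H` is a `B^Δ_p`-group, only points with `R_x = 1`
contribute, and such a point is a surjection `G → H` with `p'`-kernel; so `e^Δ_G ⊆ e^Δ_H` implies `G
≫ H`. The lattice isomorphism, the maximality of `j_G` and the description of simple subquotients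
are then order theory.

To identify `e^Δ_G / j_G`, map `f ⊗ c` to `c f(e^G_G)`. Automorphisms fix `e^G_G`, and `e^Δ_G`
vanishes at groups of order below `|G|`, so the map factors through `L_{G,K}`. By
`mem_span_isoAut_sup_smallIdeal`, `L_{G,K}(G)` is at most a line, spanned by a class over `e^G_G ∉
j_G(G)`; with the maximality of `j_G` this shows that `J_{G,K}` is the preimage of `j_G`. -/

noncomputable section

namespace BifreeBiset

/-! ### Decomposition of bisets into orbits -/

namespace FinBiset

variable {K H G : Type v} [Group K] [Group H] [Group G]

/-- The inverse of an isomorphism of bisets. -/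
def Iso.symm {X Y : FinBiset H G} (e : Iso X Y) : Iso Y X where
  toEquiv := e.toEquiv.symm
  map_left h y := by
    rw [Equiv.symm_apply_eq, e.map_left, Equiv.apply_symm_apply]
  map_right g y := by
    rw [Equiv.symm_apply_eq, e.map_right, Equiv.apply_symm_apply]

/-- The sub-biset given by a stable subset. -/
def sub (X : FinBiset H G) (S : Set X) (hl : ∀ (h : H), ∀ x ∈ S, h • x ∈ S)
    (hr : ∀ (g : Gᵐᵒᵖ), ∀ x ∈ S, g • x ∈ S) : FinBiset H G where
  carrier := S
  left :=
    { smul := fun h x => ⟨h • x.1, hl h x.1 x.2⟩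
      one_smul := fun x => Subtype.ext (one_smul H x.1)
      mul_smul := fun a b x => Subtype.ext (mul_smul a b x.1) }
  right :=
    { smul := fun g x => ⟨g • x.1, hr g x.1 x.2⟩
      one_smul := fun x => Subtype.ext (one_smul Gᵐᵒᵖ x.1)
      mul_smul := fun a b x => Subtype.ext (mul_smul a b x.1) }
  comm :=
    letI : MulAction H S :=
      { smul := fun h x => ⟨h • x.1, hl h x.1 x.2⟩
        one_smul := fun x => Subtype.ext (one_smul H x.1)
        mul_smul := fun a b x => Subtype.ext (mul_smul a b x.1) }
    letI : MulAction Gᵐᵒᵖ S :=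
      { smul := fun g x => ⟨g • x.1, hr g x.1 x.2⟩
        one_smul := fun x => Subtype.ext (one_smul Gᵐᵒᵖ x.1)
        mul_smul := fun a b x => Subtype.ext (mul_smul a b x.1) }
    @SMulCommClass.mk _ _ _ _ _ (fun a b x => Subtype.ext (smul_comm a b x.1))

theorem compl_stable {A X : Type*} [Group A] [MulAction A X] {S : Set X}
    (h : ∀ a : A, ∀ x ∈ S, a • x ∈ S) (a : A) (x : X) (hx : x ∈ Sᶜ) : a • x ∈ Sᶜ := by
  intro hax
  exact hx (by simpa using h a⁻¹ _ hax)

open Classical in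
/-- A biset is the disjoint union of a stable subset and its complement. -/
def splitSub (X : FinBiset H G) (S : Set X) (hl : ∀ (h : H), ∀ x ∈ S, h • x ∈ S)
    (hr : ∀ (g : Gᵐᵒᵖ), ∀ x ∈ S, g • x ∈ S) :
    Iso X ((X.sub S hl hr).sum (X.sub Sᶜ (compl_stable hl) (compl_stable hr))) :=
  Iso.symm
    { toEquiv := Equiv.Set.sumCompl S
      map_left := by rintro h (z | z) <;> rfl
      map_right := by rintro g (z | z) <;> rfl }

/-- `X` is the orbit of the point `x`. -/
def IsOrbitOf (X : FinBiset H G) (x : X) : Prop := ∀ y : X, ∃ (h : H) (g : G), y = h • op g • x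

/-- Strong induction on the cardinality: split off the orbit of one point, and the complement is
smaller. This reduces statements about Grothendieck groups to transitive bisets. -/
theorem orbit_induction {C : FinBiset H G → Prop}
    (hempty : ∀ X : FinBiset H G, IsEmpty X → C X)
    (hsum : ∀ (X Y Z : FinBiset H G), Iso Z (X.sum Y) → C X → C Y → C Z)
    (horb : ∀ (X : FinBiset H G) (x : X), X.IsOrbitOf x → C X) (X : FinBiset H G) : C X := by
  induction hn : Nat.card X using Nat.strong_induction_on generalizing X with
  | _ n ih =>
    rcases isEmpty_or_nonempty X with he | ⟨⟨x⟩⟩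
    · exact hempty X he
    let S : Set X := {y | ∃ (h : H) (g : G), y = h • op g • x}
    have hl : ∀ (h : H), ∀ y ∈ S, h • y ∈ S := by
      rintro h _ ⟨k, g, rfl⟩
      exact ⟨h * k, g, smul_smul _ _ _⟩
    have hr : ∀ (g : Gᵐᵒᵖ), ∀ y ∈ S, g • y ∈ S := by
      rintro g _ ⟨k, g', rfl⟩
      exact ⟨k, g' * g.unop, by rw [← smul_comm k g, smul_smul, op_mul, op_unop]⟩
    have hxS : x ∈ S := ⟨1, 1, by simp⟩
    refine hsum _ _ _ (X.splitSub S hl hr) (horb _ ⟨x, hxS⟩ ?_) (ih _ ?_ _ rfl)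
    · rintro ⟨_, h, g, rfl⟩
      exact ⟨h, g, rfl⟩
    · rw [← hn]
      exact Set.ncard_lt_card (s := Sᶜ) (fun h => (h ▸ Set.mem_univ x : x ∈ Sᶜ) hxS)

theorem Iso.stabilizer_eq {X Y : FinBiset H G} (e : Iso X Y) (x : X) :
    MulAction.stabilizer H (e.toEquiv x) = MulAction.stabilizer H x := by
  ext h
  rw [MulAction.mem_stabilizer_iff, MulAction.mem_stabilizer_iff, ← e.map_left,
    e.toEquiv.apply_eq_iff_eq]

end FinBiset

/-- For empty `X` one has `X ≅ X ⊔ X`, so `[X] = [X] + [X]`. -/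
theorem Groth.mk_eq_zero {R : Type u} [CommRing R] {H G : Type v} [Group H] [Group G]
    {P : FinBiset H G → Prop} (X : FinBiset H G) (hX : P X) (he : IsEmpty X) :
    Groth.mk R X hX = 0 := by
  have h := Groth.mk_sum R hX hX hX
    ⟨(Equiv.sumEmpty X X).symm, fun h x => he.elim x, fun h x => he.elim x⟩
  exact left_eq_add.1 h

/-! ### Stabilizer sums on Burnside groups -/

section StabSum

variable {K : Type u} [Field K] {G : Type v} [Group G]

theorem op_punit_smul {U : FinBiset G PUnit.{v + 1}} (a : PUnit.{v + 1}ᵐᵒᵖ) (u : U) : a • u = u := by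
  have : a = 1 := rfl
  rw [this, one_smul]

/-- Isomorphisms of `G`-sets as isomorphisms of `(G, 1)`-bisets. -/
def FinBiset.isoOfLeft {X Y : FinBiset G PUnit.{v + 1}} (e : X ≃ Y)
    (h : ∀ (g : G) (x : X), e (g • x) = g • e x) : FinBiset.Iso X Y where
  toEquiv := e
  map_left := h
  map_right g x := by rw [op_punit_smul, op_punit_smul]

variable {M : Type*} [AddCommGroup M] [Module K M]

/-- The linear map on `K B(G)` that sends a `G`-set `U` to `∑ u, f (stabilizer of u)`. -/
def Burn.stabSum (f : Subgroup G → M) : Burn K G →ₗ[K] M :=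
  Groth.lift (fun U _ => ∑ᶠ u : U, f (MulAction.stabilizer G u)) (by
    intro X Y Z _ _ _ e
    have := Fintype.ofFinite X
    have := Fintype.ofFinite Y
    let : Fintype (X.sum Y) := inferInstanceAs (Fintype (X.carrier ⊕ Y.carrier))
    have := Fintype.ofFinite Z
    rw [finsum_eq_sum_of_fintype, finsum_eq_sum_of_fintype, finsum_eq_sum_of_fintype,
      Fintype.sum_equiv e.toEquiv (fun z => f (MulAction.stabilizer G z))
        (fun z => f (MulAction.stabilizer G z)) (fun z => by rw [e.stabilizer_eq])]
    refine (Fintype.sum_sum_type (fun z : X.carrier ⊕ Y.carrier =>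
      f (MulAction.stabilizer G (α := X.sum Y) z))).trans ?_
    congr 1 <;> refine Finset.sum_congr rfl fun x _ => congrArg f ?_ <;> ext g
    · exact Sum.inl_injective.eq_iff
    · exact Sum.inr_injective.eq_iff)

theorem Burn.stabSum_mk (f : Subgroup G → M) (U : FinBiset G PUnit.{v + 1}) [Fintype U] :
    Burn.stabSum (K := K) f (Groth.mk K U trivial) = ∑ u : U, f (MulAction.stabilizer G u) := by
  rw [Burn.stabSum, Groth.lift_mk, finsum_eq_sum_of_fintype]

theorem Burn.mark_mk (L : Subgroup G) (U : FinBiset G PUnit.{v + 1}) :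
    Burn.mark K L (Groth.mk K U trivial) = (Nat.card {u : U // ∀ l ∈ L, l • u = u} : K) :=
  Groth.lift_mk _ _ _ _

-- Möbius inversion, with `g x = ∑ μ(y, x) f y`. It is the bridge from stabilizer sums to marks,
-- because `T ≤ Stab(u)` says that `u` is a `T`-fixed point.
open Classical in
theorem exists_moebius_inverse {α : Type*} [Fintype α] [PartialOrder α] (f : α → M) :
    ∃ g : α → M, ∀ z, f z = ∑ x, if x ≤ z then g x else 0 := by
  let : LocallyFiniteOrder α := Fintype.toLocallyFiniteOrder
  refine ⟨fun x => ∑ y, IncidenceAlgebra.mu ℤ y x • f y, fun z => ?_⟩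
  have h : ∀ x, (if x ≤ z then ∑ y, IncidenceAlgebra.mu ℤ y x • f y else 0) =
      ∑ y, (if x ∈ Finset.Icc y z then IncidenceAlgebra.mu ℤ y x else 0) • f y := by
    intro x
    split_ifs with hx
    · refine Finset.sum_congr rfl fun y _ => ?_
      by_cases hy : y ≤ x
      · simp [hy, hx]
      · simp [hy, IncidenceAlgebra.apply_eq_zero_of_not_le hy]
    · simp [hx]
  simp only [h]
  rw [Finset.sum_comm]
  simp only [← Finset.sum_smul, Finset.sum_ite_mem, Finset.univ_inter,
    IncidenceAlgebra.sum_Icc_mu_right]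
  simp

open Classical in
/-- A stabilizer sum in terms of marks. -/
theorem Burn.stabSum_eq [Finite G] [Fintype (Subgroup G)] (f g : Subgroup G → M)
    (hfg : ∀ Z, f Z = ∑ T, if T ≤ Z then g T else 0) (x : Burn K G) :
    Burn.stabSum f x = ∑ T, Burn.mark K T x • g T := by
  have h : Burn.stabSum (K := K) f = ∑ T, (Burn.mark K T).smulRight (g T) := by
    refine Groth.hom_ext fun U hU => ?_
    have := Fintype.ofFinite U
    rw [Burn.stabSum_mk]
    simp only [LinearMap.sum_apply, LinearMap.smulRight_apply]
    simp only [Burn.mark_mk, hfg]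
    -- After the exchange, the coefficient of `g T` is the number of points whose stabilizer
    -- contains `T`, that is, the mark at `T`.
    rw [Finset.sum_comm]
    refine Finset.sum_congr rfl fun T _ => ?_
    rw [← Finset.sum_filter, Finset.sum_const, ← Nat.cast_smul_eq_nsmul K, Nat.card_eq_fintype_card,
      Fintype.card_subtype]
    congr!
  rw [h]
  simp

/-- In the expansion by marks only the term at `⊤` survives for `e^G_G`. -/
theorem Burn.stabSum_idem [CharZero K] [Finite G] (f g : Subgroup G → M)
    [Fintype (Subgroup G)] [DecidableLE (Subgroup G)]
    (hfg : ∀ Z, f Z = ∑ T, if T ≤ Z then g T else 0) :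
    Burn.stabSum f (Burn.idem K G) = g ⊤ := by
  classical
  rw [Burn.stabSum_eq f g (fun Z => by rw [hfg]; congr!)]
  simp [mark_idem]

/-- This is the coefficient at `⊤` of `stabSum_idem` with the Möbius inversion written out; in this
form the sum that defines a deflation number can be recognized. -/
theorem Burn.stabSum_idem_eq_sum [CharZero K] [Finite G] [Fintype (Subgroup G)]
    (f : Subgroup G → M) :
    Burn.stabSum f (Burn.idem K G) = ∑ S : Subgroup G, moebiusTop S • f S := by
  classical
  obtain ⟨g, hg⟩ := exists_moebius_inverse f
  rw [Burn.stabSum_idem f g (fun Z => by rw [hg])]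
  simp only [hg, Finset.smul_sum]
  rw [Finset.sum_comm]
  have h : ∀ T : Subgroup G, ∑ S : Subgroup G, moebiusTop S • (if T ≤ S then g T else 0) =
      (if T = ⊤ then 1 else 0 : ℤ) • g T := by
    intro T
    rw [← sum_moebiusTop T, Finset.sum_smul]
    refine Finset.sum_congr rfl fun S _ => ?_
    split_ifs <;> simp
  rw [Finset.sum_congr rfl fun T _ => h T]
  simp

/-- A stabilizer sum that only depends on the restriction to a proper subgroup kills `e^G_G`. -/
theorem Burn.stabSum_idem_eq_zero [CharZero K] [Finite G] (f : Subgroup G → M) (Q : Subgroup G)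
    (hQ : Q ≠ ⊤) (hf : ∀ S, f S = f (S ⊓ Q)) : Burn.stabSum f (Burn.idem K G) = 0 := by
  classical
  have := Fintype.ofFinite (Subgroup G)
  obtain ⟨g, hg⟩ := exists_moebius_inverse f
  -- Since `T ≤ S ⊓ Q` means `T ≤ S` and `T ≤ Q`, the inverse of `f` may be cut off outside the
  -- subgroups of `Q`; the cut-off function vanishes at `⊤`.
  rw [Burn.stabSum_idem f (fun T => if T ≤ Q then g T else 0), if_neg]
  · exact fun h => hQ (top_le_iff.1 h)
  · intro Z
    rw [hf, hg]
    refine Finset.sum_congr rfl fun T _ => ?_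
    by_cases h1 : T ≤ Z <;> by_cases h2 : T ≤ Q <;> simp [h1, h2]

end StabSum

/-! ### Bisets attached to group homomorphisms -/

namespace FinBiset

variable {H G : Type v} [Group H] [Group G]

/-- For a homomorphism `φ : H → G` and an `H`-set `W`, the `(H, G)`-biset `W × G` with
`h · (w, g) · g' = (h w, φ(h) g g')`. -/
def twist (φ : H →* G) (W : Type v) [Finite W] [MulAction H W] [Finite G] : FinBiset H G where
  carrier := W × G
  left :=
    { smul := fun h a => (h • a.1, φ h * a.2)
      one_smul := fun a => by change ((1 : H) • a.1, φ 1 * a.2) = a; simp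
      mul_smul := fun h k a => by
        change ((h * k) • a.1, φ (h * k) * a.2) = (h • k • a.1, φ h * (φ k * a.2))
        simp [mul_smul, mul_assoc] }
  right :=
    { smul := fun g a => (a.1, a.2 * g.unop)
      one_smul := fun a => by change (a.1, a.2 * 1) = a; simp
      mul_smul := fun h k a => by
        change (a.1, a.2 * (k.unop * h.unop)) = (a.1, a.2 * k.unop * h.unop)
        simp [mul_assoc] }
  comm :=
    letI : MulAction H (W × G) :=
      { smul := fun h a => (h • a.1, φ h * a.2)
        one_smul := fun a => by change ((1 : H) • a.1, φ 1 * a.2) = a; simp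
        mul_smul := fun h k a => by
          change ((h * k) • a.1, φ (h * k) * a.2) = (h • k • a.1, φ h * (φ k * a.2))
          simp [mul_smul, mul_assoc] }
    letI : MulAction Gᵐᵒᵖ (W × G) :=
      { smul := fun g a => (a.1, a.2 * g.unop)
        one_smul := fun a => by change (a.1, a.2 * 1) = a; simp
        mul_smul := fun h k a => by
          change (a.1, a.2 * (k.unop * h.unop)) = (a.1, a.2 * k.unop * h.unop)
          simp [mul_assoc] }
    @SMulCommClass.mk _ _ _ _ _ (fun a b x => Prod.ext rfl (mul_assoc (φ a) x.2 b.unop).symm)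

/-- For a homomorphism `φ : G → H`, the `(H, G)`-biset `H` with `h · x · g = h x φ(g)`. -/
def viaHom (φ : G →* H) [Finite H] : FinBiset H G where
  carrier := H
  right :=
    { smul := fun g x => x * φ g.unop
      one_smul := fun x => by change x * φ 1 = x; simp
      mul_smul := fun a b x => by
        change x * φ (b.unop * a.unop) = x * φ b.unop * φ a.unop
        simp [mul_assoc] }
  comm :=
    letI : MulAction Gᵐᵒᵖ H :=
      { smul := fun g x => x * φ g.unop
        one_smul := fun x => by change x * φ 1 = x; simp
        mul_smul := fun a b x => by
          change x * φ (b.unop * a.unop) = x * φ b.unop * φ a.unop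
          simp [mul_assoc] }
    @SMulCommClass.mk _ _ _ _ _ (fun a b x => (mul_assoc a x (φ b.unop)).symm)

/-- The `H`-set `W × U`, for an `H`-set `W` and a `G`-set `U` on which `H` acts through `φ`. -/
def prodRes (φ : H →* G) (W : Type v) [Finite W] [MulAction H W] (U : FinBiset G PUnit.{v + 1}) :
    FinBiset H PUnit.{v + 1} :=
  letI : MulAction H (W × U) :=
    { smul := fun h a => (h • a.1, φ h • a.2)
      one_smul := fun a => by change ((1 : H) • a.1, φ 1 • a.2) = a; simp
      mul_smul := fun h k a => by
        change ((h * k) • a.1, φ (h * k) • a.2) = (h • k • a.1, φ h • φ k • a.2)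
        simp [mul_smul] }
  ofGSet H (W × U)

/-- `(W × G) ×_G U ≅ W × U`. -/
def twistTensor (φ : H →* G) (W : Type v) [Finite W] [MulAction H W] [Finite G]
    (U : FinBiset G PUnit.{v + 1}) : Iso ((twist φ W).tensor U) (prodRes φ W U) :=
  isoOfLeft
    { toFun := tlift (fun (a : W × G) u => ((a.1, a.2 • u) : W × U))
        (fun a g u => Prod.ext rfl (mul_smul (α := G) a.2 g u))
      invFun := fun b => tmk (X := twist φ W) ((b.1, 1) : W × G) b.2
      left_inv := by
        intro t
        obtain ⟨⟨w, g⟩, u, rfl⟩ := tmk_surj t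
        refine (tmk_smul (X := twist φ W) ((w, 1) : W × G) g u).symm.trans ?_
        exact congrArg (fun z : G => tmk (X := twist φ W) ((w, z) : W × G) u) (one_mul g)
      right_inv := fun b => Prod.ext rfl (one_smul G b.2) }
    (by
      intro h t
      obtain ⟨⟨w, g⟩, u, rfl⟩ := tmk_surj t
      exact Prod.ext rfl (mul_smul (α := G) (φ h) g u))

variable {p : ℕ}

theorem _root_.BifreeBiset.IsPPrimeGroup.of_injective {A B : Type*} [Group A] [Group B] [Finite B]
    (hB : IsPPrimeGroup p B) (f : A →* B) (hf : Function.Injective f) : IsPPrimeGroup p A :=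
  fun h => hB (h.trans (Subgroup.card_dvd_of_injective f hf))

theorem _root_.BifreeBiset.IsPPrimeGroup.of_le {A : Type*} [Group A] [Finite A] {S T : Subgroup A}
    (hT : IsPPrimeGroup p T) (h : S ≤ T) : IsPPrimeGroup p S :=
  hT.of_injective (Subgroup.inclusion h) (Subgroup.inclusion_injective h)

/-- The second coordinate forces left stabilizers into `ker φ`, and `G` acts freely on the right.
This is where the kernel has to be a `p'`-group. -/
theorem isBifree_twist [Fact p.Prime] (φ : H →* G) (W : Type v) [Finite W] [MulAction H W]
    [Finite H] [Finite G] (hφ : IsPPrimeGroup p φ.ker) : (twist φ W).IsBifree p := by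
  rintro ⟨w, g⟩
  constructor
  · refine hφ.of_le fun h hh => ?_
    have : φ h * g = g := congrArg Prod.snd hh
    simpa using this
  · refine isPPrimeGroup_of_eq_bot (eq_bot_iff.2 fun g' hg' => ?_)
    have : g * g'.unop = g := congrArg Prod.snd hg'
    simpa using this

theorem isBifree_viaHom [Fact p.Prime] (φ : G →* H) [Finite H] [Finite G]
    (hφ : IsPPrimeGroup p φ.ker) : (viaHom φ).IsBifree p := by
  intro x
  constructor
  · refine isPPrimeGroup_of_eq_bot (eq_bot_iff.2 fun h hh => ?_)
    exact (mul_eq_right (M := H)).1 hh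
  · have h1 : IsPPrimeGroup p φ.ker.op := by
      unfold IsPPrimeGroup
      rwa [Nat.card_congr (Subgroup.equivOp _).symm]
    have : Finite Gᵐᵒᵖ := Finite.of_equiv G opEquiv
    refine h1.of_le fun g hg => ?_
    exact (mul_eq_left (M := H)).1 hg

end FinBiset

theorem isPPrimeGroup_ker_subtype {p : ℕ} [Fact p.Prime] {G : Type*} [Group G] (L : Subgroup G) :
    IsPPrimeGroup p L.subtype.ker :=
  FinBiset.isPPrimeGroup_of_eq_bot L.ker_subtype

/-! ### Marks determine the elements of the Burnside group -/

section Marks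

variable {K : Type u} [Field K] {G : Type v} [Group G]

theorem Burn.mk_iso {U V : FinBiset G PUnit.{v + 1}} (e : FinBiset.Iso U V) :
    (Groth.mk K U trivial : Burn K G) = Groth.mk K V trivial :=
  Groth.mk_iso trivial trivial trivial e

theorem Burn.mk_eq_coset [Finite G] (U : FinBiset G PUnit.{v + 1}) (u : U)
    (hu : ∀ y : U, ∃ g : G, y = g • u) :
    (Groth.mk K U trivial : Burn K G) = Burn.coset K (MulAction.stabilizer G u) := by
  refine (Burn.mk_iso (FinBiset.isoOfLeft (Equiv.ofBijective
    (fun c : FinBiset.ofGSet G (G ⧸ MulAction.stabilizer G u) =>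
      MulAction.ofQuotientStabilizer G u c) ⟨?_, ?_⟩) ?_)).symm
  · exact MulAction.injective_ofQuotientStabilizer G u
  · intro y
    obtain ⟨g, rfl⟩ := hu y
    exact ⟨(g : G ⧸ MulAction.stabilizer G u), rfl⟩
  · intro g c
    exact MulAction.ofQuotientStabilizer_smul G u g c

theorem card_stabilizer_mul_card [Finite G] (U : FinBiset G PUnit.{v + 1}) (u : U)
    (hu : ∀ y : U, ∃ g : G, y = g • u) :
    Nat.card (MulAction.stabilizer G u) * Nat.card U = Nat.card G := by
  rw [← Nat.card_congr (Equiv.ofBijective (MulAction.ofQuotientStabilizer G u)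
    ⟨MulAction.injective_ofQuotientStabilizer G u, fun y => ?_⟩)]
  · exact Subgroup.card_mul_index _
  · obtain ⟨g, rfl⟩ := hu y
    exact ⟨(g : G ⧸ MulAction.stabilizer G u), rfl⟩

theorem Burn.act_mk {p : ℕ} {H : Type v} [Group H] (X : FinBiset H G) (hX : X.IsBifree p)
    (U : FinBiset G PUnit.{v + 1}) :
    Burn.act (Groth.mk K X hX) (Groth.mk K U trivial : Burn K G) = Groth.mk K (X.tensor U) trivial :=
  Groth.comp_mk _ _ _ _ _

theorem Burn.map_stabSum {M N : Type*} [AddCommGroup M] [Module K M] [AddCommGroup N] [Module K N]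
    (l : M →ₗ[K] N) (f : Subgroup G → M) (x : Burn K G) :
    l (Burn.stabSum f x) = Burn.stabSum (fun S => l (f S)) x := by
  suffices l ∘ₗ Burn.stabSum (K := K) f = Burn.stabSum (fun S => l (f S)) from
    LinearMap.congr_fun this x
  refine Groth.hom_ext fun U _ => ?_
  have := Fintype.ofFinite U
  rw [LinearMap.comp_apply, Burn.stabSum_mk, Burn.stabSum_mk, map_sum]

/-- Induction from a subgroup. -/
def BDelta.ind (p : ℕ) [Fact p.Prime] (K : Type u) [Field K] {G : Type v} [Group G] [Finite G]
    (L : Subgroup G) : BDelta p K G L :=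
  Groth.mk K (FinBiset.viaHom L.subtype)
    (FinBiset.isBifree_viaHom L.subtype (isPPrimeGroup_ker_subtype L))

/-- The point `[1, T]` generates `G ×_L (L/T)`, and its stabilizer is `T` seen inside `G`. -/
theorem Burn.act_ind_coset {p : ℕ} [Fact p.Prime] [Finite G] (L : Subgroup G) (T : Subgroup L) :
    Burn.act (BDelta.ind p K L) (Burn.coset K T) = Burn.coset K (T.map L.subtype) := by
  let X := FinBiset.viaHom L.subtype
  let U := FinBiset.ofGSet L (L ⧸ T)
  let t : X.tensor U := FinBiset.tmk (X := X) (Y := U) (1 : G) ((1 : L) : L ⧸ T)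
  refine (Burn.act_mk _ _ U).trans ((Burn.mk_eq_coset (X.tensor U) t ?_).trans ?_)
  · intro y
    obtain ⟨g, u, rfl⟩ := FinBiset.tmk_surj y
    obtain ⟨l, rfl⟩ := QuotientGroup.mk_surjective (s := T) u
    refine ⟨(show G from g) * l.1, FinBiset.tmk_eq_iff.2 ⟨l, ?_, ?_⟩⟩
    · exact mul_one (M := G) _
    · exact congrArg (QuotientGroup.mk (s := T)) (mul_one l).symm
  · congr 1
    ext g
    have h1 : g • t = t ↔ ∃ l : L, (1 : G) = g * 1 * l.1 ∧
        ((1 : L) : L ⧸ T) = l • ((1 : L) : L ⧸ T) := FinBiset.tmk_eq_iff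
    rw [MulAction.mem_stabilizer_iff, h1]
    have h2 : ∀ l : L, ((1 : L) : L ⧸ T) = l • ((1 : L) : L ⧸ T) ↔ l ∈ T := fun l => by
      rw [MulAction.Quotient.smul_mk, QuotientGroup.eq]
      simp
    simp only [h2, Subgroup.mem_map]
    constructor
    · rintro ⟨l, hl, hT⟩
      exact ⟨l⁻¹, inv_mem hT, by simpa using (eq_inv_of_mul_eq_one_left hl.symm).symm⟩
    · rintro ⟨l, hT, rfl⟩
      exact ⟨l⁻¹, by simp, inv_mem hT⟩

/-- Fixed points of a product are pairs of fixed points, and `T` acts on the second factor through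
its image under `φ`. -/
theorem Burn.mark_prodRes {H : Type v} [Group H] (φ : H →* G) (W : Type v)
    [Finite W] [MulAction H W] (U : FinBiset G PUnit.{v + 1}) (T : Subgroup H) :
    Burn.mark K T (Groth.mk K (FinBiset.prodRes φ W U) trivial) =
      Burn.mark K T (Groth.mk K (FinBiset.ofGSet H W) trivial) *
        Burn.mark K (T.map φ) (Groth.mk K U trivial) := by
  rw [Burn.mark_mk, Burn.mark_mk, Burn.mark_mk, ← Nat.cast_mul, ← Nat.card_prod]
  congr 1
  refine Nat.card_congr ((Equiv.subtypeEquiv (p := fun a : FinBiset.prodRes φ W U =>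
    ∀ l ∈ T, l • a = a) (q := fun a : FinBiset.ofGSet H W × U => (∀ l ∈ T, l • a.1 = a.1) ∧
      ∀ l ∈ T.map φ, l • a.2 = a.2) (Equiv.refl (W × U)) ?_).trans (Equiv.subtypeProdEquivProd
        (p := fun w : FinBiset.ofGSet H W => ∀ l ∈ T, l • w = w)
        (q := fun u : U => ∀ l ∈ T.map φ, l • u = u)))
  rintro ⟨w, u⟩
  have : ∀ l : H, (l • (show FinBiset.prodRes φ W U from (w, u)) =
      (show FinBiset.prodRes φ W U from (w, u))) ↔ l • w = w ∧ φ l • u = u := fun l => Prod.mk.injEq _ _ _ _ ▸ Iff.rfl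
  simp only [Subgroup.mem_map, forall_exists_index, and_imp,
    forall_apply_eq_imp_iff₂]
  refine (forall₂_congr fun l _ => this l).trans ?_
  exact forall₂_and

variable [CharZero K]

/-- Writing the identity as a stabilizer sum makes every element of `K B(G)` a combination of its
marks. The factor `|S|/|G|` averages over an orbit. -/
theorem Burn.eq_stabSum [Finite G] (x : Burn K G) :
    x = Burn.stabSum (fun S => ((Nat.card S : K) / Nat.card G) • Burn.coset K S) x := by
  set f : Subgroup G → Burn K G := fun S => ((Nat.card S : K) / Nat.card G) • Burn.coset K S with hf
  suffices LinearMap.id = Burn.stabSum (K := K) f from LinearMap.congr_fun this x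
  refine Groth.hom_ext fun U _ => ?_
  induction U using FinBiset.orbit_induction with
  | hempty U hU => rw [Groth.mk_eq_zero U _ hU, map_zero, map_zero]
  | hsum X Y Z e hX hY => rw [Groth.mk_sum K trivial trivial trivial e, map_add, map_add, hX, hY]
  | horb U u hu =>
    have hu' : ∀ y : U, ∃ g : G, y = g • u := fun y => by
      obtain ⟨h, g, rfl⟩ := hu y
      exact ⟨h, by rw [op_punit_smul]⟩
    have := Fintype.ofFinite U
    rw [Burn.stabSum_mk]
    have hG : (Nat.card G : K) ≠ 0 := Nat.cast_ne_zero.2 Nat.card_pos.ne'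
    have hU : (Nat.card U : K) ≠ 0 := Nat.cast_ne_zero.2 (Nat.card_pos_iff.2 ⟨⟨u⟩, inferInstance⟩).ne'
    -- Any `y` generates the orbit, so `[G/Stab(y)] = [U]` and `|Stab(y)|/|G| = 1/|U|`; the `|U|`
    -- equal terms add up to `[U]`.
    have key : ∀ y : U, f (MulAction.stabilizer G y) =
        (Nat.card U : K)⁻¹ • (Groth.mk K U trivial : Burn K G) := by
      intro y
      have hy : ∀ z : U, ∃ g : G, z = g • y := fun z => by
        obtain ⟨a, rfl⟩ := hu' y
        obtain ⟨b, rfl⟩ := hu' z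
        exact ⟨b * a⁻¹, by simp [mul_smul]⟩
      rw [hf, Burn.mk_eq_coset U y hy]
      rw [← card_stabilizer_mul_card U y hy] at hG
      have h1 := left_ne_zero_of_mul (Nat.cast_mul (α := K) _ _ ▸ hG)
      refine congrArg (fun c : K => c • Burn.coset K (MulAction.stabilizer G y)) ?_
      rw [← card_stabilizer_mul_card U y hy]
      push_cast
      field_simp
    rw [Finset.sum_congr rfl fun y _ => key y, Finset.sum_const, Finset.card_univ,
      ← Nat.card_eq_fintype_card, ← Nat.cast_smul_eq_nsmul K, smul_smul, mul_inv_cancel₀ hU,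
      one_smul, LinearMap.id_apply]

/-- `Burn.eq_stabSum` recovers an element by a stabilizer sum, and stabilizer sums depend only on
marks. -/
theorem Burn.ext_mark [Finite G] {x y : Burn K G}
    (h : ∀ L : Subgroup G, Burn.mark K L x = Burn.mark K L y) : x = y := by
  classical
  have := Fintype.ofFinite (Subgroup G)
  obtain ⟨g, hg⟩ := exists_moebius_inverse
    (fun S : Subgroup G => ((Nat.card S : K) / Nat.card G) • Burn.coset K S)
  rw [Burn.eq_stabSum x, Burn.eq_stabSum y, Burn.stabSum_eq _ g hg, Burn.stabSum_eq _ g hg]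
  simp only [h]

variable {p : ℕ} [Fact p.Prime]

/-- The decomposition of an element of `K B(G)` into primitive idempotents. -/
theorem Burn.eq_sum_mark [Finite G] [Fintype (Subgroup G)] (x : Burn K G) :
    x = ∑ L : Subgroup G, (Burn.mark K L x * ((Nat.card L : K) / Nat.card G)) •
      Burn.act (BDelta.ind p K L) (Burn.idem K L) := by
  classical
  obtain ⟨g, hg⟩ := exists_moebius_inverse
    (fun S : Subgroup G => ((Nat.card S : K) / Nat.card G) • Burn.coset K S)
  have hG : (Nat.card G : K) ≠ 0 := Nat.cast_ne_zero.2 Nat.card_pos.ne'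
  -- The Möbius coefficient at `L` only involves subgroups of `L`. It can therefore be computed
  -- inside `L`, where it belongs to `e^L_L`, and induced; the scalar comes from replacing `|S|/|L|`
  -- by `|S|/|G|`.
  have key : ∀ L : Subgroup G, Burn.act (BDelta.ind p K L) (Burn.idem K L) =
      ((Nat.card G : K) / Nat.card L) • g L := by
    intro L
    have := Fintype.ofFinite (Subgroup L)
    have hL : (Nat.card L : K) ≠ 0 := Nat.cast_ne_zero.2 Nat.card_pos.ne'
    conv_lhs => rw [Burn.eq_stabSum (Burn.idem K L), Burn.map_stabSum]
    rw [Burn.stabSum_idem _ (fun T => ((Nat.card G : K) / Nat.card L) • g (T.map L.subtype))]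
    · rw [← MonoidHom.range_eq_map, Subgroup.range_subtype]
    intro Z
    rw [map_smul, Burn.act_ind_coset]
    have hZ := hg (Z.map L.subtype)
    rw [Subgroup.card_map_of_injective L.subtype_injective] at hZ
    have : ((Nat.card Z : K) / Nat.card L) = ((Nat.card G : K) / Nat.card L) *
        ((Nat.card Z : K) / Nat.card G) := by field_simp
    rw [this, mul_smul, hZ, ← Finset.sum_filter, ← Finset.sum_filter, Finset.smul_sum]
    -- Subgroups of `G` below the image of `Z` correspond to subgroups of `L` below `Z`.
    refine Finset.sum_nbij' (fun T => T.subgroupOf L) (fun T => T.map L.subtype) ?_ ?_ ?_ ?_ ?_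
    · intro T hT
      simp only [Finset.mem_filter, Finset.mem_univ, true_and] at hT ⊢
      refine (Subgroup.comap_mono hT).trans ?_
      rw [Subgroup.comap_map_eq_self_of_injective L.subtype_injective]
    · intro T hT
      simp only [Finset.mem_filter, Finset.mem_univ, true_and] at hT ⊢
      exact Subgroup.map_mono hT
    · intro T hT
      simp only [Finset.mem_filter, Finset.mem_univ, true_and] at hT
      rw [Subgroup.map_subgroupOf_eq_of_le]
      exact hT.trans (Subgroup.map_subtype_le Z)
    · intro T hT
      exact Subgroup.comap_map_eq_self_of_injective L.subtype_injective T
    · intro T hT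
      simp only [Finset.mem_filter, Finset.mem_univ, true_and] at hT
      rw [Subgroup.map_subgroupOf_eq_of_le]
      exact hT.trans (Subgroup.map_subtype_le Z)
  conv_lhs => rw [Burn.eq_stabSum x, Burn.stabSum_eq _ g hg]
  refine Finset.sum_congr rfl fun L _ => ?_
  have hL : (Nat.card L : K) ≠ 0 := Nat.cast_ne_zero.2 Nat.card_pos.ne'
  rw [key, smul_smul]
  congr 1
  field_simp

/-- A homomorphism `φ : H → G` with `p'`-kernel yields a morphism `G ⟶ H` that sends `x ∈ K B(G)`
to the mark of `x` at the image of `φ` times `e^H_H`. -/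
theorem Burn.exists_act_eq_mark_smul_idem {H : Type v} [Group H] [Finite H] [Finite G]
    (φ : H →* G) (hφ : IsPPrimeGroup p φ.ker) :
    ∃ a : BDelta p K H G, ∀ x : Burn K G, Burn.act a x = Burn.mark K φ.range x • Burn.idem K H := by
  classical
  have := Fintype.ofFinite (Subgroup H)
  -- Gluck's formula for `e^H_H`, with `[H/Y]` replaced by the biset `H/Y × G`. Since that biset
  -- sends `U` to `H/Y × U`, the combination acts as restriction along `φ` followed by
  -- multiplication by `e^H_H`.
  refine ⟨(Nat.card H : K)⁻¹ • ∑ Y : Subgroup H, ((Nat.card Y : K) * (moebiusTop Y : K)) •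
    Groth.mk K (FinBiset.twist φ (H ⧸ Y)) (FinBiset.isBifree_twist φ _ hφ), fun x => ?_⟩
  refine Burn.ext_mark fun T => ?_
  have key : ∀ Y : Subgroup H, Burn.mark K T (Burn.act (Groth.mk K (FinBiset.twist φ (H ⧸ Y))
      (FinBiset.isBifree_twist φ _ hφ)) x) = Burn.mark K T (Burn.coset K Y) *
        Burn.mark K (T.map φ) x := by
    intro Y
    induction x using Groth.induction with
    | h0 => simp
    | hadd x y hx hy => simp only [map_add, hx, hy, mul_add]
    | hsmul r x hx => simp only [map_smul, hx, smul_eq_mul]; ring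
    | hmk U hU =>
      rw [Burn.act_mk, Burn.mk_iso (FinBiset.twistTensor φ (H ⧸ Y) U), Burn.mark_prodRes]
      rfl
  -- The marks of `e^H_H` vanish unless `T = ⊤`, and the image of `⊤` is `φ.range`.
  have h2 : Burn.mark K T (Burn.idem K H) * Burn.mark K (T.map φ) x =
      Burn.mark K φ.range x * Burn.mark K T (Burn.idem K H) := by
    rw [mark_idem]
    split_ifs with hT
    · rw [hT, ← MonoidHom.range_eq_map, one_mul, mul_one]
    · simp
  rw [map_smul (Burn.mark K T), smul_eq_mul, ← h2]
  unfold Burn.idem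
  simp only [map_smul, map_sum, LinearMap.smul_apply, LinearMap.sum_apply, key, smul_eq_mul,
    Finset.sum_mul, mul_assoc]
  congr!

end Marks

/-! ### The mark at the whole group of `X ×_H e^H_H` -/

/-- As `S R = H`, the group `S` acts transitively on `H/R`, and the stabilizer of the base coset is
`S ∩ R`. -/
theorem card_inf_mul_card {H : Type*} [Group H] [Finite H] {S R : Subgroup H}
    (h : (S : Set H) * (R : Set H) = Set.univ) :
    Nat.card (R ⊓ S : Subgroup H) * Nat.card H = Nat.card R * Nat.card S := by
  have h1 : MulAction.stabilizer S ((1 : H) : H ⧸ R) = R.subgroupOf S := by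
    ext s
    rw [MulAction.mem_stabilizer_iff, Subgroup.mem_subgroupOf]
    change ((s.1 * 1 : H) : H ⧸ R) = _ ↔ _
    rw [eq_comm, QuotientGroup.eq]
    simp
  have h2 : MulAction.orbit S ((1 : H) : H ⧸ R) = Set.univ := by
    refine Set.eq_univ_of_forall fun c => ?_
    obtain ⟨g, rfl⟩ := QuotientGroup.mk_surjective c
    obtain ⟨s, hs, r, hr, rfl⟩ := Set.mem_mul.1 (h.symm ▸ Set.mem_univ g : g ∈ (S : Set H) * R)
    refine ⟨⟨s, hs⟩, ?_⟩
    change ((s * 1 : H) : H ⧸ R) = _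
    rw [QuotientGroup.eq]
    simpa using hr
  have h3 := MulAction.index_stabilizer S ((1 : H) : H ⧸ R)
  rw [h1, h2, Set.ncard_univ] at h3
  have h4 := (R.subgroupOf S).card_mul_index
  have h5 := Subgroup.card_map_of_injective S.subtype_injective (K := R.subgroupOf S)
  rw [Subgroup.subgroupOf_map_subtype] at h5
  rw [h3, ← h5] at h4
  rw [← h4, ← R.card_mul_index, Subgroup.index]
  ring

namespace FinBiset

variable {G H : Type v} [Group G] [Group H]

/-- The right stabilizer of a point, as a subgroup of `H`. -/
def rightStab {X : FinBiset G H} (x : X) : Subgroup H := (MulAction.stabilizer Hᵐᵒᵖ x).unop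

theorem mem_rightStab {X : FinBiset G H} {x : X} {h : H} : h ∈ rightStab x ↔ op h • x = x := Iff.rfl

/-- The left and the right orbit of the point `x` coincide. -/
def IsLinked {X : FinBiset G H} (x : X) : Prop :=
  (∀ g : G, ∃ h : H, g • x = op h • x) ∧ ∀ h : H, ∃ g : G, op h • x = g • x

/-- The elements of `H` that move `x` inside its left orbit. -/
def rightLink {X : FinBiset G H} (x : X) : Subgroup H where
  carrier := {h | ∃ g : G, op h • x = g • x}
  one_mem' := ⟨1, by simp⟩
  mul_mem' := by
    rintro a b ⟨g, hg⟩ ⟨k, hk⟩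
    exact ⟨g * k, by rw [op_mul, mul_smul, hg, ← smul_comm, hk, mul_smul]⟩
  inv_mem' := by
    rintro a ⟨g, hg⟩
    exact ⟨g⁻¹, by rw [MulOpposite.op_inv, inv_smul_eq_iff, ← smul_comm, hg, inv_smul_smul]⟩

/-- The pairs that represent `[x, u]` form the orbit of `(x, u)` under `h · (x, u) = (x h⁻¹, h u)`,
so this is orbit–stabilizer. -/
theorem card_tmk_fiber [Finite H] {X : FinBiset G H} {U : FinBiset H PUnit.{v + 1}} (x : X) (u : U) :
    Nat.card (rightStab x ⊓ MulAction.stabilizer H u : Subgroup H) *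
      Nat.card {b : X × U // (tmk b.1 b.2 : tensor X U) = tmk x u} = Nat.card H := by
  let act : MulAction H (X × U) :=
    { smul := fun h a => (op h⁻¹ • a.1, h • a.2)
      one_smul := fun a => by change (op (1 : H)⁻¹ • a.1, (1 : H) • a.2) = a; simp
      mul_smul := fun h k a => by
        change (op (h * k)⁻¹ • a.1, (h * k) • a.2) = (op h⁻¹ • op k⁻¹ • a.1, h • k • a.2)
        simp [mul_smul] }
  have hs : ∀ (h : H) (a : X × U), h • a = (op h⁻¹ • a.1, h • a.2) := fun _ _ => rfl
  have h1 : MulAction.stabilizer H (x, u) = rightStab x ⊓ MulAction.stabilizer H u := by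
    ext h
    rw [MulAction.mem_stabilizer_iff, hs, Prod.mk.injEq, Subgroup.mem_inf, mem_rightStab,
      MulAction.mem_stabilizer_iff, MulOpposite.op_inv, inv_smul_eq_iff, eq_comm]
  have h2 : {b : X × U | (tmk b.1 b.2 : tensor X U) = tmk x u} = MulAction.orbit H (x, u) := by
    ext b
    rw [Set.mem_ofPred_eq, MulAction.mem_orbit_iff, tmk_eq_iff]
    constructor
    · rintro ⟨h, hx, hu⟩
      refine ⟨h, ?_⟩
      rw [hs, Prod.ext_iff]
      exact ⟨by simp [hx], hu.symm⟩
    · rintro ⟨h, rfl⟩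
      exact ⟨h, by simp [hs], rfl⟩
  have h3 := MulAction.index_stabilizer H (x, u)
  have h4 := (MulAction.stabilizer H (x, u)).card_mul_index
  rw [h3, ← h2, h1] at h4
  exact h4

end FinBiset

open FinBiset

/-! ### Counting fixed points of `X ×_H U` -/

section

variable {K : Type u} [Field K] [CharZero K] {G H : Type v} [Group G] [Group H] [Finite H]

open Classical in
/-- The weight of a point `x` and a stabilizer `S` in the count of the fixed points of
`X ×_H U`. -/
def fixWeight (K : Type u) [Field K] {X : FinBiset G H} (x : X) (S : Subgroup H) : K :=
  if ∀ g : G, ∃ h ∈ S, op h • g • x = x then (Nat.card (rightStab x ⊓ S : Subgroup H) : K) else 0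

/-- Pairs `(x, u)` are counted instead of their classes. The class is fixed when every `g x` is
brought back to `x` by some `h` in the stabilizer of `u`, and the weight `|R_x ∩ Stab(u)|` is `|H|`
over the number of pairs in the class. The result is a stabilizer sum in `U`. -/
theorem card_fixed_tensor (X : FinBiset G H) (U : FinBiset H PUnit.{v + 1}) [Fintype X] [Fintype U] :
    (Nat.card H : K) * Nat.card {t : tensor X U // ∀ g ∈ (⊤ : Subgroup G), g • t = t} =
      ∑ x : X, ∑ u : U, fixWeight K x (MulAction.stabilizer H u) := by
  classical
  have := Fintype.ofFinite (tensor X U)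
  let q : X × U → tensor X U := fun a => tmk a.1 a.2
  have hfix : ∀ a : X × U, (∀ g ∈ (⊤ : Subgroup G), g • q a = q a) ↔
      ∀ g : G, ∃ h ∈ MulAction.stabilizer H a.2, op h • g • a.1 = a.1 := by
    intro a
    simp only [Subgroup.mem_top, true_imp_iff]
    refine forall_congr' fun g => ?_
    refine (tmk_eq_iff (x := g • a.1) (x' := a.1) (y := a.2) (y' := a.2)).trans ?_
    refine exists_congr fun h => ?_
    rw [MulAction.mem_stabilizer_iff, and_comm, eq_comm, eq_comm (a := a.1)]
  rw [← Fintype.sum_prod_type' (f := fun x u => fixWeight K x (MulAction.stabilizer H u)),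
    ← Finset.sum_fiberwise _ q,
    Nat.card_eq_fintype_card (α := {t : tensor X U // ∀ g ∈ (⊤ : Subgroup G), g • t = t}),
    Fintype.card_subtype, Finset.card_filter, Nat.cast_sum, Finset.mul_sum]
  refine Finset.sum_congr rfl fun t _ => ?_
  obtain ⟨x, u, rfl⟩ := tmk_surj t
  have hH : (Nat.card H : K) ≠ 0 := Nat.cast_ne_zero.2 Nat.card_pos.ne'
  set n := Nat.card {b : X × U // (tmk b.1 b.2 : tensor X U) = tmk x u} with hn
  have hn0 : (n : K) ≠ 0 := by
    have := card_tmk_fiber x u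
    intro h0
    rw [← this, Nat.cast_mul, h0, mul_zero] at hH
    exact hH rfl
  -- The weight is constant on the fibre, which has `n` elements, so a fixed class contributes `n ·
  -- |H|/n = |H|`.
  have hterm : ∀ a ∈ Finset.univ.filter (fun a => q a = tmk x u),
      fixWeight K a.1 (MulAction.stabilizer H a.2) =
        if ∀ g ∈ (⊤ : Subgroup G), g • (tmk x u : tensor X U) = tmk x u then
          (Nat.card H : K) / n else 0 := by
    intro a ha
    have ha : q a = tmk x u := (Finset.mem_filter.1 ha).2
    unfold fixWeight
    rw [← ha]
    refine ite_congr (propext (hfix a).symm) (fun _ => ?_) (fun _ => rfl)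
    have h1 := card_tmk_fiber a.1 a.2
    have h2 : Nat.card {b : X × U // (tmk b.1 b.2 : tensor X U) = tmk a.1 a.2} = n := by
      rw [hn, ← ha]
    rw [h2] at h1
    rw [← h1, Nat.cast_mul, mul_div_cancel_right₀ _ hn0]
  rw [Finset.sum_congr rfl hterm, Finset.sum_const, ← Fintype.card_subtype, ← Nat.card_eq_fintype_card]
  change _ = n • _
  rw [nsmul_eq_mul]
  split_ifs
  · field_simp
    simp
  · simp

variable {p : ℕ}

theorem Burn.mark_top_act (X : FinBiset G H) (hX : X.IsBifree p) [Fintype X] (y : Burn K H) :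
    Burn.mark K ⊤ (Burn.act (Groth.mk K X hX) y) =
      (Nat.card H : K)⁻¹ * ∑ x : X, Burn.stabSum (fixWeight K x) y := by
  have hH : (Nat.card H : K) ≠ 0 := Nat.cast_ne_zero.2 Nat.card_pos.ne'
  induction y using Groth.induction with
  | h0 => simp
  | hadd x y hx hy => simp only [map_add, hx, hy, Finset.sum_add_distrib, mul_add]
  | hsmul r x hx => simp only [map_smul, hx, smul_eq_mul, ← Finset.mul_sum]; ring
  | hmk U hU =>
    have := Fintype.ofFinite U
    rw [Burn.act_mk, Burn.mark_mk, eq_inv_mul_iff_mul_eq₀ hH, card_fixed_tensor]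
    simp only [Burn.stabSum_mk]

-- The weight depends on `S` only through `S ∩ rightLink x`, so it kills `e^H_H` when `rightLink x`
-- is proper. If `rightLink x` is everything but some `g x` leaves the right orbit of `x`, every
-- weight is zero. For a linked point the condition on `S` becomes `S R = H` with `R = rightStab x`,
-- and the sum over `S` turns into `|R| m_{H,R}`.
open Classical in
theorem Burn.stabSum_fixWeight_idem {X : FinBiset G H} (x : X) :
    Burn.stabSum (fixWeight K x) (Burn.idem K H) =
      if IsLinked x then (Nat.card (rightStab x) : K) * (deflationNumber (rightStab x) : ℚ) else 0 := by
  have hsub : rightStab x ≤ rightLink x := fun h hh => ⟨1, by rw [one_smul]; exact hh⟩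
  by_cases hQ : rightLink x = ⊤
  swap
  · rw [if_neg]
    · refine Burn.stabSum_idem_eq_zero _ (rightLink x) hQ fun S => ?_
      unfold fixWeight
      have h1 : rightStab x ⊓ (S ⊓ rightLink x) = rightStab x ⊓ S := by
        rw [inf_left_comm, inf_eq_left.2 hsub, inf_comm]
      rw [h1]
      -- An `h` with `g x h = x` satisfies `x h = g⁻¹ x`, so it lies in `rightLink x` automatically.
      refine ite_congr (propext (forall_congr' fun g => ⟨?_, ?_⟩)) (fun _ => rfl) (fun _ => rfl)
      · rintro ⟨h, hS, hx⟩
        refine ⟨h, ⟨hS, g⁻¹, ?_⟩, hx⟩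
        rw [eq_inv_smul_iff, smul_comm, hx]
      · rintro ⟨h, hS, hx⟩
        exact ⟨h, hS.1, hx⟩
    · exact fun hx => hQ (eq_top_iff.2 fun h _ => hx.2 h)
  have := Fintype.ofFinite (Subgroup H)
  rw [Burn.stabSum_idem_eq_sum]
  split_ifs with hx
  swap
  · refine Finset.sum_eq_zero fun S _ => ?_
    unfold fixWeight
    rw [if_neg, smul_zero]
    intro hS
    refine hx ⟨fun g => ?_, fun h => (hQ.symm ▸ Subgroup.mem_top h : h ∈ rightLink x)⟩
    obtain ⟨h, -, hh⟩ := hS g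
    exact ⟨h⁻¹, by rw [MulOpposite.op_inv, eq_inv_smul_iff, hh]⟩
  · have hH : (Nat.card H : K) ≠ 0 := Nat.cast_ne_zero.2 Nat.card_pos.ne'
    have hcond : ∀ S : Subgroup H, (∀ g : G, ∃ h ∈ S, op h • g • x = x) ↔
        (S : Set H) * (rightStab x : Set H) = Set.univ := by
      intro S
      constructor
      · intro hS
        refine Set.eq_univ_of_forall fun h => ?_
        obtain ⟨g, hg⟩ := hx.2 h⁻¹
        obtain ⟨s, hs, hsx⟩ := hS g
        refine Set.mem_mul.2 ⟨s, hs, s⁻¹ * h, ?_, mul_inv_cancel_left s h⟩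
        have : h⁻¹ * s ∈ rightStab x := by
          rw [mem_rightStab, op_mul, mul_smul, hg, hsx]
        simpa using inv_mem this
      · intro hS g
        obtain ⟨h, hh⟩ := hx.1 g
        obtain ⟨s, hs, r, hr, hsr⟩ := Set.mem_mul.1 (hS.symm ▸ Set.mem_univ h⁻¹ :
          h⁻¹ ∈ (S : Set H) * (rightStab x : Set H))
        refine ⟨s, hs, ?_⟩
        rw [hh, smul_smul, ← op_mul]
        change h * s ∈ rightStab x
        have : h * s = r⁻¹ := by rw [← inv_inv h, ← hsr]; group
        rw [this]
        exact inv_mem hr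
    unfold deflationNumber
    push_cast
    rw [Set.toFinset_ofPred, Finset.sum_filter, Finset.mul_sum, Finset.mul_sum]
    refine Finset.sum_congr (by ext; simp) fun S _ => ?_
    unfold fixWeight
    simp only [hcond]
    split_ifs with hS
    · have h1 := congrArg (Nat.cast (R := K)) (card_inf_mul_card hS)
      push_cast at h1
      rw [zsmul_eq_mul, eq_comm]
      field_simp
      linear_combination (-(moebiusTop S : K)) * h1
    · simp

open Classical in
/-- The mark at `G` of `X ×_H e^H_H`. -/
theorem Burn.mark_top_act_idem (X : FinBiset G H) (hX : X.IsBifree p) [Fintype X] :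
    Burn.mark K ⊤ (Burn.act (Groth.mk K X hX) (Burn.idem K H)) =
      (Nat.card H : K)⁻¹ * ∑ x : X, if IsLinked x then
        (Nat.card (rightStab x) : K) * (deflationNumber (rightStab x) : ℚ) else 0 := by
  rw [Burn.mark_top_act]
  simp only [Burn.stabSum_fixWeight_idem]

end

/-! ### Domination of groups -/

section Dominates

variable {p : ℕ} {G H : Type*} [Group G] [Group H]

theorem dominates_of_surjective (φ : G →* H) (hs : Function.Surjective φ)
    (hφ : IsPPrimeGroup p φ.ker) : Dominates p G H :=
  ⟨φ.ker, inferInstance, hφ, ⟨QuotientGroup.quotientKerEquivOfSurjective φ hs⟩⟩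

theorem Dominates.exists_hom (h : Dominates p G H) :
    ∃ φ : G →* H, Function.Surjective φ ∧ IsPPrimeGroup p φ.ker := by
  obtain ⟨N, hN, hp, ⟨e⟩⟩ := h
  refine ⟨e.toMonoidHom.comp (QuotientGroup.mk' N), e.surjective.comp (QuotientGroup.mk'_surjective N),
    ?_⟩
  have : (e.toMonoidHom.comp (QuotientGroup.mk' N)).ker = N := by
    ext g
    simp
  rwa [this]

theorem dominates_of_mulEquiv [Fact p.Prime] (e : G ≃* H) : Dominates p G H :=
  dominates_of_surjective e.toMonoidHom e.surjective
    (FinBiset.isPPrimeGroup_of_eq_bot ((MonoidHom.ker_eq_bot_iff _).2 e.injective))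

theorem Dominates.card_le [Finite G] (h : Dominates p G H) : Nat.card H ≤ Nat.card G := by
  obtain ⟨φ, hs, -⟩ := h.exists_hom
  exact Nat.card_le_card_of_surjective φ hs

theorem Dominates.nonempty_mulEquiv [Finite G] (h : Dominates p G H)
    (hc : Nat.card G ≤ Nat.card H) : Nonempty (G ≃* H) := by
  have hcard := le_antisymm hc h.card_le
  obtain ⟨φ, hs, -⟩ := h.exists_hom
  have : Finite H := Finite.of_surjective φ hs
  exact ⟨MulEquiv.ofBijective φ ((Nat.bijective_iff_surjective_and_card φ).2 ⟨hs, hcard⟩)⟩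

end Dominates

/-- Because `H` acts freely on the orbit of `x`, the equation `g x = x f(g)` defines a homomorphism
`f`. Linkedness makes it surjective, and its kernel is the left stabilizer of `x`, a `p'`-group by
bifreeness. -/
theorem dominates_of_isLinked {p : ℕ} {G H : Type v} [Group G] [Group H] [Finite H]
    {X : FinBiset G H} (hX : X.IsBifree p) {x : X} (hx : FinBiset.IsLinked x)
    (hR : FinBiset.rightStab x = ⊥) : Dominates p G H := by
  have hinj : ∀ {a b : H}, op a • x = op b • x → a = b := by
    intro a b hab
    have : a * b⁻¹ ∈ FinBiset.rightStab x := by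
      rw [FinBiset.mem_rightStab, op_mul, mul_smul, hab, smul_smul, ← op_mul]
      simp
    rw [hR, Subgroup.mem_bot] at this
    exact mul_inv_eq_one.1 this
  choose f hf using hx.1
  let φ : G →* H := MonoidHom.mk' f fun a b => hinj (by
    rw [← hf, mul_smul, hf b, op_mul, mul_smul, smul_comm, hf a])
  refine dominates_of_surjective φ (fun h => ?_) ?_
  · obtain ⟨g, hg⟩ := hx.2 h
    exact ⟨g, hinj ((hf g).symm.trans hg.symm)⟩
  · have : φ.ker = MulAction.stabilizer G x := by
      ext g
      rw [MonoidHom.mem_ker, MulAction.mem_stabilizer_iff, hf g]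
      constructor
      · intro h
        rw [show f g = 1 from h, op_one, one_smul]
      · intro h
        exact hinj (h.trans (by simp))
    rw [this]
    exact (hX x).1

/-- Right stabilizers are constant along left orbits and get conjugated along right orbits; here the
two orbits coincide. -/
theorem FinBiset.rightStab_normal {G H : Type v} [Group G] [Group H]
    {X : FinBiset G H} {x : X} (hx : FinBiset.IsLinked x) : (FinBiset.rightStab x).Normal := by
  refine ⟨fun h hh k => ?_⟩
  obtain ⟨g, hg⟩ := hx.2 k
  rw [FinBiset.mem_rightStab] at hh ⊢
  rw [op_mul, op_mul, mul_smul, mul_smul, hg, ← smul_comm g (op h), hh, ← hg, smul_smul, ← op_mul]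
  simp

/-! ### Subfunctors of the Burnside functor -/

namespace SubFun

/-- Morphisms can be added and scaled and `F` is linear, so the images of `x` under single morphisms
already form a subfunctor. -/
theorem mem_generate {p : ℕ} [Fact p.Prime] {R : Type u} [CommRing R]
    {F : BifreeCat.{u, v} p R ⥤ ModuleCat.{w} R} [F.Additive] [F.Linear R]
    {G H : BifreeCat.{u, v} p R} {x : F.obj G} {y : F.obj H} :
    y ∈ (generate G x).obj H ↔ ∃ f : G ⟶ H, (F.map f).hom x = y := by
  have hmem : ∀ z : F.obj H, z ∈ (generate G x).obj H ↔ ∀ A : SubFun F, x ∈ A.obj G → z ∈ A.obj H := by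
    intro z
    change z ∈ (⨅ A ∈ {A : SubFun F | x ∈ A.obj G}, A.obj H) ↔ _
    simp only [Submodule.mem_iInf, Set.mem_ofPred_eq]
  rw [hmem]
  constructor
  · intro h
    let A : SubFun F :=
      { obj := fun H =>
          { carrier := {y | ∃ f : G ⟶ H, (F.map f).hom x = y}
            zero_mem' := ⟨0, by rw [F.map_zero]; rfl⟩
            add_mem' := by
              rintro _ _ ⟨f, rfl⟩ ⟨g, rfl⟩
              exact ⟨f + g, by rw [F.map_add]; rfl⟩
            smul_mem' := by
              rintro r _ ⟨f, rfl⟩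
              exact ⟨r • f, by rw [F.map_smul]; rfl⟩ }
        map_mem := by
          rintro H H' g _ ⟨f, rfl⟩
          exact ⟨f ≫ g, by rw [F.map_comp]; rfl⟩ }
    exact h A ⟨𝟙 G, by rw [F.map_id]; rfl⟩
  · rintro ⟨f, rfl⟩ A hA
    exact A.map_mem f x hA

theorem generate_le {p : ℕ} [Fact p.Prime] {R : Type u} [CommRing R]
    {F : BifreeCat.{u, v} p R ⥤ ModuleCat.{w} R} {G : BifreeCat.{u, v} p R} {x : F.obj G}
    {A : SubFun F} (h : x ∈ A.obj G) : generate G x ≤ A :=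
  sInf_le (α := SubFun F) (Set.mem_ofPred_eq ▸ h)

theorem self_mem_generate {p : ℕ} [Fact p.Prime] {R : Type u} [CommRing R]
    {F : BifreeCat.{u, v} p R ⥤ ModuleCat.{w} R} {G : BifreeCat.{u, v} p R} {x : F.obj G} :
    x ∈ (generate G x).obj G := by
  change x ∈ (⨅ A ∈ {A : SubFun F | x ∈ A.obj G}, A.obj G)
  simp only [Submodule.mem_iInf, Set.mem_ofPred_eq]
  exact fun _ h => h

variable {p : ℕ} [Fact p.Prime] {K : Type u} [Field K]

/-- The value of a subfunctor of `K B` at a finite group. -/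
def eval (F : SubFun (burnside.{u, v} p K)) (G : Type v) [Group G] [Finite G] :
    Submodule K (Burn K G) :=
  F.obj (BifreeCat.of (FiniteGrp.of G))

theorem act_mem (F : SubFun (burnside.{u, v} p K)) {G H : Type v} [Group G] [Finite G] [Group H]
    [Finite H] (a : BDelta p K H G) {x : Burn K G} (hx : x ∈ F.eval G) : Burn.act a x ∈ F.eval H :=
  F.map_mem (G := BifreeCat.of (FiniteGrp.of G)) (H := BifreeCat.of (FiniteGrp.of H)) a x hx

variable [CharZero K]

theorem mark_smul_idem_mem (F : SubFun (burnside.{u, v} p K)) {G H : Type v} [Group G] [Finite G]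
    [Group H] [Finite H] (φ : H →* G) (hφ : IsPPrimeGroup p φ.ker) {x : Burn K G}
    (hx : x ∈ F.eval G) : Burn.mark K φ.range x • Burn.idem K H ∈ F.eval H := by
  obtain ⟨a, ha⟩ := Burn.exists_act_eq_mark_smul_idem (K := K) φ hφ
  rw [← ha]
  exact F.act_mem a hx

/-- `mark_smul_idem_mem` for the inclusion of `L`; the nonzero mark is then divided out. -/
theorem idem_mem_of_mark_ne_zero (F : SubFun (burnside.{u, v} p K)) {G : Type v} [Group G]
    [Finite G] {x : Burn K G} (hx : x ∈ F.eval G) (L : Subgroup G) (hL : Burn.mark K L x ≠ 0) :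
    Burn.idem K L ∈ F.eval L := by
  have := F.mark_smul_idem_mem L.subtype (isPPrimeGroup_ker_subtype L) hx
  rw [Subgroup.range_subtype] at this
  exact (Submodule.smul_mem_iff _ hL).1 this

theorem idem_mem_of_mark_top_ne_zero (F : SubFun (burnside.{u, v} p K)) {G : Type v} [Group G]
    [Finite G] {x : Burn K G} (hx : x ∈ F.eval G) (h : Burn.mark K ⊤ x ≠ 0) :
    Burn.idem K G ∈ F.eval G := by
  have := F.mark_smul_idem_mem (MonoidHom.id G) (FinBiset.isPPrimeGroup_of_eq_bot
    ((MonoidHom.ker_eq_bot_iff _).2 Function.injective_id)) hx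
  rw [MonoidHom.range_eq_top.2 Function.surjective_id] at this
  exact (Submodule.smul_mem_iff _ h).1 this

/-- Expand `x` by `Burn.eq_sum_mark`. Together with `idem_mem_of_mark_ne_zero`, membership in a
subfunctor is decided by the support of the marks. -/
theorem mem_of_idem_mem (F : SubFun (burnside.{u, v} p K)) {G : Type v} [Group G] [Finite G]
    {x : Burn K G} (h : ∀ L : Subgroup G, Burn.mark K L x ≠ 0 → Burn.idem K L ∈ F.eval L) :
    x ∈ F.eval G := by
  have := Fintype.ofFinite (Subgroup G)
  rw [Burn.eq_sum_mark (p := p) x]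
  refine Submodule.sum_mem _ fun L _ => ?_
  by_cases hL : Burn.mark K L x = 0
  · rw [hL, zero_mul, zero_smul]
    exact zero_mem _
  · exact Submodule.smul_mem _ _ (F.act_mem _ (h L hL))

end SubFun

/-! ### The subfunctors `e^Δ_G`: inclusions, domination and primeness -/

section ESub

theorem BGroup.cls_eq {p : ℕ} {G H : BGroup.{v} p} : G.cls = H.cls ↔ Nonempty (G.1 ≃* H.1) :=
  Quotient.eq (r := isoSetoid p)

/-- By linearity one biset has a nonzero mark, so it has a linked point `x` with `m_{H,R} ≠ 0`,
where `R = rightStab x`. As `R` is a normal `p'`-subgroup of a `B^Δ_p`-group, it is trivial, and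
`dominates_of_isLinked` applies. -/
theorem dominates_of_mark_top_ne_zero {p : ℕ} {K : Type u} [Field K] [CharZero K]
    {G : Type v} [Group G] {H : Type v} [Group H]
    [Finite H] (hH : IsBGroup p H) (f : BDelta p K G H)
    (hf : Burn.mark K ⊤ (Burn.act f (Burn.idem K H)) ≠ 0) : Dominates p G H := by
  classical
  induction f using Groth.induction with
  | h0 => simp at hf
  | hadd a b ha hb =>
    by_cases h : Burn.mark K ⊤ (Burn.act a (Burn.idem K H)) = 0
    · refine hb fun h' => hf ?_
      rw [map_add, LinearMap.add_apply, map_add, h, h', add_zero]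
    · exact ha h
  | hsmul r a ha =>
    refine ha fun h => hf ?_
    rw [map_smul, LinearMap.smul_apply, map_smul, h, smul_zero]
  | hmk X hX =>
    have := Fintype.ofFinite X
    rw [Burn.mark_top_act_idem] at hf
    obtain ⟨x, -, hx⟩ := Finset.exists_ne_zero_of_sum_ne_zero (right_ne_zero_of_mul hf)
    have hlink : FinBiset.IsLinked x := by
      by_contra h
      exact hx (if_neg h)
    rw [if_pos hlink] at hx
    refine dominates_of_isLinked hX hlink ?_
    by_contra hR
    refine hx ?_
    have hp : IsPPrimeGroup p (FinBiset.rightStab x) := by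
      have h := (hX x).2
      unfold IsPPrimeGroup at h ⊢
      rwa [Nat.card_congr (Subgroup.equivOp (FinBiset.rightStab x))]
    rw [hH _ (FinBiset.rightStab_normal hlink) hR hp]
    simp

variable {p : ℕ} [Fact p.Prime] {K : Type u} [Field K]

theorem eSub_le_iff {G : FiniteGrp.{v}} {F : SubFun (burnside.{u, v} p K)} :
    eSub K p G ≤ F ↔ Burn.idem K G ∈ F.eval G :=
  ⟨fun h => h _ SubFun.self_mem_generate, fun h => SubFun.generate_le h⟩

theorem mem_eSub_iff {G H : FiniteGrp.{v}} {x : Burn K H} :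
    x ∈ (eSub K p G).eval H ↔ ∃ f : BDelta p K H G, Burn.act f (Burn.idem K G) = x :=
  SubFun.mem_generate

theorem idem_mem_eSub (G : FiniteGrp.{v}) : Burn.idem K G ∈ (eSub K p G).eval G :=
  eSub_le_iff.1 le_rfl

variable [CharZero K]

theorem mark_top_idem (G : Type v) [Group G] [Finite G] : Burn.mark K ⊤ (Burn.idem K G) = 1 := by
  classical
  rw [mark_idem, if_pos rfl]

/-- Subfunctors are determined by the `e^Δ_G` they contain: each nonzero mark of `x ∈ F` at `L` puts
`e^L_L` into `F`, hence into `F'`, and these elements rebuild `x`. -/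
theorem SubFun.le_of_forall_eSub_le {F F' : SubFun (burnside.{u, v} p K)}
    (h : ∀ G : FiniteGrp.{v}, eSub K p G ≤ F → eSub K p G ≤ F') : F ≤ F' := by
  intro G x hx
  refine F'.mem_of_idem_mem (G := G.grp) (x := x) fun L hL => ?_
  exact eSub_le_iff.1 (h (FiniteGrp.of L) (eSub_le_iff.2 (F.idem_mem_of_mark_ne_zero hx L hL)))

/-- Along a surjection `G → H` the element `e^H_H` is sent to its mark at `H`, which is `1`, times
`e^G_G`. -/
theorem eSub_le_of_dominates {G H : FiniteGrp.{v}} (h : Dominates p G H) :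
    eSub K p G ≤ eSub K p H := by
  obtain ⟨φ, hs, hφ⟩ := h.exists_hom
  rw [eSub_le_iff]
  have := (eSub K p H).mark_smul_idem_mem φ hφ (idem_mem_eSub H)
  rwa [MonoidHom.range_eq_top.2 hs, mark_top_idem, one_smul] at this

theorem eSub_eq_of_mulEquiv {G H : FiniteGrp.{v}} (e : G ≃* H) : eSub K p G = eSub K p H :=
  le_antisymm (eSub_le_of_dominates (dominates_of_mulEquiv e))
    (eSub_le_of_dominates (dominates_of_mulEquiv e.symm))

/-- Deflate by the `(G/N, G)`-biset `G/N`. All its `|G/N|` points are linked with right stabilizer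
`N`, so the image of `e^G_G` has mark `|G|⁻¹ |G/N| |N| m_{G,N} = m_{G,N}` at `G/N`. -/
theorem SubFun.idem_quotient_mem (F : SubFun (burnside.{u, v} p K)) {G : Type v} [Group G] [Finite G]
    (N : Subgroup G) [N.Normal] (hN : IsPPrimeGroup p N) (hm : deflationNumber N ≠ 0)
    (h : Burn.idem K G ∈ F.eval G) : Burn.idem K (G ⧸ N) ∈ F.eval (G ⧸ N) := by
  classical
  have hker : IsPPrimeGroup p (QuotientGroup.mk' N).ker := by rwa [QuotientGroup.ker_mk']
  let X := FinBiset.viaHom (QuotientGroup.mk' N)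
  have hX : X.IsBifree p := FinBiset.isBifree_viaHom _ hker
  have := Fintype.ofFinite X
  have hR : ∀ x : X, FinBiset.rightStab x = N := by
    intro x
    ext g
    rw [← QuotientGroup.eq_one_iff (N := N)]
    exact mul_eq_left (M := G ⧸ N)
  have hlink : ∀ x : X, FinBiset.IsLinked x := by
    intro (x : G ⧸ N)
    constructor
    · intro c
      obtain ⟨g, hg⟩ := QuotientGroup.mk_surjective (x⁻¹ * c * x)
      refine ⟨g, ?_⟩
      change c * x = x * (g : G ⧸ N)
      rw [hg]
      group
    · intro g
      refine ⟨x * (g : G ⧸ N) * x⁻¹, ?_⟩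
      change x * (g : G ⧸ N) = x * (g : G ⧸ N) * x⁻¹ * x
      group
  refine F.idem_mem_of_mark_top_ne_zero (F.act_mem (Groth.mk K X hX) h) ?_
  rw [Burn.mark_top_act_idem]
  simp only [hlink, hR, if_true]
  rw [Finset.sum_const, nsmul_eq_mul, Finset.card_univ, ← Nat.card_eq_fintype_card]
  refine mul_ne_zero (inv_ne_zero (Nat.cast_ne_zero.2 Nat.card_pos.ne')) (mul_ne_zero ?_
    (mul_ne_zero (Nat.cast_ne_zero.2 Nat.card_pos.ne') (Rat.cast_ne_zero.2 hm)))
  exact Nat.cast_ne_zero.2 (Nat.card_pos (α := G ⧸ N)).ne'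

theorem eSub_quotient_le {G : FiniteGrp.{v}} (N : Subgroup G) [N.Normal] (hN : IsPPrimeGroup p N)
    (hm : deflationNumber N ≠ 0) : eSub K p (FiniteGrp.of (G ⧸ N)) ≤ eSub K p G :=
  eSub_le_iff.2 ((eSub K p G).idem_quotient_mem N hN hm (idem_mem_eSub G))

/-- If `G` is not a `B^Δ_p`-group, some nontrivial normal `p'`-subgroup `N` has `m_{G,N} ≠ 0`. Then
`e^Δ_G` and `e^Δ_{G/N}` contain each other, and `G/N` is smaller. -/
theorem exists_bGroup_eSub_eq (G : FiniteGrp.{v}) :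
    ∃ H : BGroup.{v} p, eSub K p G = eSub K p H.1 := by
  induction hn : Nat.card G using Nat.strong_induction_on generalizing G with
  | _ n ih =>
    by_cases hG : IsBGroup p G
    · exact ⟨⟨G, hG⟩, rfl⟩
    unfold IsBGroup at hG
    push Not at hG
    obtain ⟨N, hN, hbot, hp, hm⟩ := hG
    have hlt : Nat.card (FiniteGrp.of (G ⧸ N)) < n := by
      rw [← hn, Subgroup.card_eq_card_quotient_mul_card_subgroup N]
      exact lt_mul_of_one_lt_right Nat.card_pos (N.one_lt_card_iff_ne_bot.2 hbot)
    obtain ⟨H, hH⟩ := ih _ hlt _ rfl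
    refine ⟨H, hH ▸ le_antisymm (eSub_le_of_dominates ?_) (eSub_quotient_le N hp hm)⟩
    exact ⟨N, hN, hp, ⟨MulEquiv.refl _⟩⟩

theorem dominates_of_eSub_le {G : FiniteGrp.{v}} {H : BGroup.{v} p}
    (h : eSub K p G ≤ eSub K p H.1) : Dominates p G H.1 := by
  obtain ⟨f, hf⟩ := mem_eSub_iff.1 (eSub_le_iff.1 h)
  refine dominates_of_mark_top_ne_zero (K := K) H.2 f ?_
  rw [hf, mark_top_idem]
  exact one_ne_zero

/-- A nonzero `x` has a nonzero mark at some `L`, whence `e^Δ_L ⊆ e^Δ_H` and `L ≫ H`. In particular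
`e^Δ_H` vanishes at groups of order below `|H|`. -/
theorem exists_dominates_of_mem_eSub {G : FiniteGrp.{v}} {H : BGroup.{v} p} {x : Burn K G}
    (hx : x ∈ (eSub K p H.1).eval G) (h0 : x ≠ 0) : ∃ L : Subgroup G, Dominates p L H.1 := by
  by_contra! h
  refine h0 (Burn.ext_mark fun L => ?_)
  rw [map_zero]
  by_contra hL
  exact h L (dominates_of_eSub_le (K := K) (G := FiniteGrp.of L)
    (eSub_le_iff.2 (SubFun.idem_mem_of_mark_ne_zero _ hx L hL)))

theorem card_le_of_mem_eSub {G : FiniteGrp.{v}} {H : BGroup.{v} p} {x : Burn K G}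
    (hx : x ∈ (eSub K p H.1).eval G) (h0 : x ≠ 0) : Nat.card H.1 ≤ Nat.card G := by
  obtain ⟨L, hL⟩ := exists_dominates_of_mem_eSub hx h0
  exact hL.card_le.trans (Subgroup.card_le_card_group L)

/-- The `e^Δ_G` are completely join-prime: if no member of `s` contains `e^G_G`, the mark at `G`
vanishes on each member, hence on their sum, whereas it is `1` at `e^G_G`. -/
theorem exists_eSub_le_of_le_sSup {G : FiniteGrp.{v}} {s : Set (SubFun (burnside.{u, v} p K))}
    (h : eSub K p G ≤ sSup s) : ∃ F ∈ s, eSub K p G ≤ F := by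
  by_contra! hs
  have h1 : Burn.idem K G ∈ (sSup s).eval G := eSub_le_iff.1 h
  have h2 : (sSup s).eval G ≤ LinearMap.ker (Burn.mark K (⊤ : Subgroup G)) := by
    change (⨆ F ∈ s, F.eval G) ≤ _
    refine iSup₂_le fun F hF x hx => ?_
    by_contra hx'
    exact hs F hF (eSub_le_iff.2 (F.idem_mem_of_mark_top_ne_zero hx hx'))
  have h3 := h2 h1
  rw [LinearMap.mem_ker, mark_top_idem] at h3
  exact one_ne_zero h3

theorem eSub_le_sup {G : FiniteGrp.{v}} {F F' : SubFun (burnside.{u, v} p K)}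
    (h : eSub K p G ≤ F ⊔ F') : eSub K p G ≤ F ∨ eSub K p G ≤ F' := by
  rw [← sSup_pair] at h
  obtain ⟨A, rfl | rfl, hA⟩ := exists_eSub_le_of_le_sSup h
  · exact Or.inl hA
  · exact Or.inr hA

theorem SubFun.eq_iSup_eSub (F : SubFun (burnside.{u, v} p K)) :
    F = ⨆ (H : BGroup.{v} p) (_ : eSub K p H.1 ≤ F), eSub K p H.1 := by
  refine le_antisymm (SubFun.le_of_forall_eSub_le fun G hG => ?_) (iSup₂_le fun _ h => h)
  obtain ⟨H, hH⟩ := exists_bGroup_eSub_eq (p := p) (K := K) G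
  rw [hH] at hG ⊢
  exact le_iSup₂_of_le H hG le_rfl

theorem exists_eSub_le_of_le_iSup {ι : Sort*} {G : FiniteGrp.{v}}
    {F : ι → SubFun (burnside.{u, v} p K)} (h : eSub K p G ≤ ⨆ i, F i) :
    ∃ i, eSub K p G ≤ F i := by
  obtain ⟨_, ⟨i, rfl⟩, hi⟩ := exists_eSub_le_of_le_sSup h
  exact ⟨i, hi⟩

/-- The isomorphism from the lattice of subfunctors of `K B` to the lattice of closed sets of
classes of `B^Δ_p`-groups. -/
def subFunOrderIso (p : ℕ) [Fact p.Prime] (K : Type u) [Field K] [CharZero K] :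
    SubFun (burnside.{u, v} p K) ≃o {A : Set (BGroupClass.{v} p) // IsClosedClass A} where
  toFun F := ⟨{c | ∃ H : BGroup.{v} p, H.cls = c ∧ eSub K p H.1 ≤ F}, by
    rintro G H ⟨H', h, hH'⟩ hGH
    obtain ⟨e⟩ := BGroup.cls_eq.1 h
    exact ⟨G, rfl, (eSub_le_of_dominates hGH).trans ((eSub_eq_of_mulEquiv e).symm.le.trans hH')⟩⟩
  invFun A := ⨆ (H : BGroup.{v} p) (_ : H.cls ∈ A.1), eSub K p H.1
  left_inv F := by
    refine Eq.trans ?_ F.eq_iSup_eSub.symm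
    refine iSup_congr fun H => iSup_congr_Prop ?_ fun _ => rfl
    constructor
    · rintro ⟨H', h, hH'⟩
      obtain ⟨e⟩ := BGroup.cls_eq.1 h
      exact (eSub_eq_of_mulEquiv e).symm.le.trans hH'
    · exact fun h => ⟨H, rfl, h⟩
  right_inv A := by
    refine Subtype.ext (Set.ext fun c => ?_)
    constructor
    · rintro ⟨G, rfl, hG⟩
      -- By primeness `e^Δ_G` lies in a single `e^Δ_H` with `H` in `A`; then `G ≫ H`, and closedness
      -- applies.
      obtain ⟨H, hG⟩ := exists_eSub_le_of_le_iSup hG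
      obtain ⟨hH, hG⟩ := exists_eSub_le_of_le_iSup hG
      exact A.2 G H hH (dominates_of_eSub_le hG)
    · intro hc
      obtain ⟨H, rfl⟩ := Quotient.exists_rep c
      exact ⟨H, rfl, le_iSup₂_of_le H hc le_rfl⟩
  map_rel_iff' {F F'} := by
    constructor
    · intro h
      rw [F.eq_iSup_eSub]
      refine iSup₂_le fun H hH => ?_
      obtain ⟨H', h', hH'⟩ := h ⟨H, rfl, hH⟩
      obtain ⟨e⟩ := BGroup.cls_eq.1 h'
      exact (eSub_eq_of_mulEquiv e).symm.le.trans hH'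
    · rintro h c ⟨H, rfl, hH⟩
      exact ⟨H, rfl, hH.trans h⟩

/-! ### The maximal subfunctor of `e^Δ_G` -/

theorem jSub_le_eSub (G : FiniteGrp.{v}) : jSub K p G ≤ eSub K p G :=
  iSup_le fun _ => iSup₂_le fun h _ => eSub_le_of_dominates h

/-- By primeness `e^Δ_G` would lie in one of the summands `e^Δ_H`; then `G ≫ H` as well as `H ≫ G`,
which makes the two groups isomorphic. -/
theorem not_eSub_le_jSub (G : BGroup.{v} p) : ¬ eSub K p G.1 ≤ jSub K p G.1 := by
  intro h
  obtain ⟨H, h⟩ := exists_eSub_le_of_le_iSup h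
  obtain ⟨hd, h⟩ := exists_eSub_le_of_le_iSup h
  obtain ⟨hn, h⟩ := exists_eSub_le_of_le_iSup h
  exact hn (hd.nonempty_mulEquiv (dominates_of_eSub_le h).card_le)

theorem jSub_lt_eSub (G : BGroup.{v} p) : jSub K p G.1 < eSub K p G.1 :=
  lt_of_le_not_ge (jSub_le_eSub _) (not_eSub_le_jSub G)

/-- `F` is a sum of `e^Δ_H` with `H ≫ G`, and none of these `H` is isomorphic to `G`, since
otherwise `F` would contain `e^Δ_G`. -/
theorem le_jSub_of_lt (G : BGroup.{v} p) {F : SubFun (burnside.{u, v} p K)}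
    (hF : F < eSub K p G.1) : F ≤ jSub K p G.1 := by
  rw [F.eq_iSup_eSub]
  refine iSup₂_le fun H hH => ?_
  refine le_iSup_of_le H (le_iSup₂_of_le (dominates_of_eSub_le (hH.trans hF.le)) ?_ le_rfl)
  rintro ⟨e⟩
  exact hF.not_ge ((eSub_eq_of_mulEquiv e).symm.le.trans hH)

end ESub

/-! ### The structure of `End(G)` modulo the morphisms that factor through smaller groups -/

namespace FinBiset

variable {M H G : Type v} [Group M] [Group H] [Group G]

/-- An isomorphism out of `W ×_M Y` from a balanced map. -/
def isoOfBalanced {W : FinBiset H M} {Y : FinBiset M G} {X : FinBiset H G} (f : W → Y → X)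
    (hf : ∀ w (m : M) y, f (op m • w) y = f w (m • y))
    (hl : ∀ (h : H) w y, f (h • w) y = h • f w y)
    (hr : ∀ (g : G) w y, f w (op g • y) = op g • f w y)
    (hinj : ∀ w w' y y', f w y = f w' y' → ∃ m : M, w' = op m • w ∧ y = m • y')
    (hsurj : ∀ x, ∃ w y, f w y = x) : Iso (tensor W Y) X where
  toEquiv := Equiv.ofBijective (tlift f hf) (by
    constructor
    · intro s t hst
      obtain ⟨w, y, rfl⟩ := tmk_surj s
      obtain ⟨w', y', rfl⟩ := tmk_surj t
      exact tmk_eq_iff.2 (hinj _ _ _ _ hst)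
    · intro x
      obtain ⟨w, y, rfl⟩ := hsurj x
      exact ⟨tmk w y, rfl⟩)
  map_left h t := by
    obtain ⟨w, y, rfl⟩ := tmk_surj t
    exact hl h w y
  map_right g t := by
    obtain ⟨w, y, rfl⟩ := tmk_surj t
    exact hr g w y

/-- The elements of `H` that move `x` inside its right orbit. -/
def leftLink {X : FinBiset H G} (x : X) : Subgroup H where
  carrier := {h | ∃ g : G, h • x = op g • x}
  one_mem' := ⟨1, by simp⟩
  mul_mem' := by
    rintro a b ⟨g, hg⟩ ⟨k, hk⟩
    exact ⟨g * k, by rw [mul_smul, hk, smul_comm, hg, op_mul, mul_smul]⟩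
  inv_mem' := by
    rintro a ⟨g, hg⟩
    exact ⟨g⁻¹, by rw [inv_smul_eq_iff, smul_comm, hg, MulOpposite.op_inv, inv_smul_smul]⟩

/-- The right orbit of `x`, with the left action of `leftLink x`. -/
def rightOrbit {X : FinBiset H G} (x : X) : FinBiset (leftLink x) G :=
  letI : SMulCommClass (leftLink x) Gᵐᵒᵖ X := ⟨fun a b y => smul_comm a.1 b y⟩
  sub ⟨X⟩ {y : X | ∃ g : G, y = op g • x}
    (by
      rintro ⟨h, k, hk⟩ _ ⟨g, rfl⟩
      exact ⟨k * g, by change h • op g • x = _; rw [smul_comm, hk, op_mul, mul_smul]⟩)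
    (by
      rintro k _ ⟨g, rfl⟩
      exact ⟨g * k.unop, by rw [op_mul, mul_smul, op_unop]⟩)

/-- A transitive biset factors through the left link of a point. -/
def tensorRightOrbit [Finite H] {X : FinBiset H G} {x : X} (hx : X.IsOrbitOf x) :
    Iso (tensor (viaHom (leftLink x).subtype) (rightOrbit x)) X :=
  isoOfBalanced (fun (h : H) y => h • y.1) (fun (h : H) m y => mul_smul h m.1 y.1)
    (fun h (k : H) y => mul_smul h k y.1) (fun g (k : H) y => smul_comm k (op g) y.1)
    (by
      rintro (h : H) (h' : H) ⟨y, g, rfl⟩ ⟨y', g', rfl⟩ (e : h • op g • x = h' • op g' • x)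
      have e' : (h⁻¹ * h') • x = op (g * g'⁻¹) • x := by
        rw [mul_smul, op_mul, mul_smul, MulOpposite.op_inv, inv_smul_eq_iff, smul_comm h,
          eq_inv_smul_iff, ← smul_comm h', ← e]
      refine ⟨⟨h⁻¹ * h', g * g'⁻¹, e'⟩, ?_, ?_⟩
      · exact (mul_inv_cancel_left h h').symm
      · refine Subtype.ext ?_
        change op g • x = (h⁻¹ * h') • op g' • x
        rw [mul_smul, ← e, inv_smul_smul])
    (by
      intro y
      obtain ⟨h, g, rfl⟩ := hx y
      exact ⟨(h : H), ⟨op g • x, g, rfl⟩, rfl⟩)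

/-- A biset on which a normal subgroup of `H` acts trivially, as a biset for the quotient. -/
def quotLeft (X : FinBiset H G) (A : Subgroup H) [A.Normal] (hA : ∀ a ∈ A, ∀ x : X, a • x = x) :
    FinBiset (H ⧸ A) G :=
  letI : MulAction (H ⧸ A) X := MulAction.compHom X
    (QuotientGroup.lift A (MulAction.toPermHom H X) fun a ha => Equiv.ext (hA a ha))
  { carrier := X
    comm := ⟨by
      intro c g x
      obtain ⟨h, rfl⟩ := QuotientGroup.mk_surjective c
      exact smul_comm h g x⟩ }

/-- A biset on which a normal subgroup of `H` acts trivially is inflated from the quotient. -/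
def tensorQuotLeft [Finite H] (X : FinBiset H G) (A : Subgroup H) [A.Normal]
    (hA : ∀ a ∈ A, ∀ x : X, a • x = x) :
    Iso (tensor (twist (QuotientGroup.mk' A) PUnit.{v + 1}) (X.quotLeft A hA)) X :=
  isoOfBalanced (fun (c : PUnit.{v + 1} × (H ⧸ A)) (y : X.quotLeft A hA) => c.2 • y)
    (fun c m y => mul_smul (α := H ⧸ A) c.2 m y)
    (fun h c y => mul_smul (α := H ⧸ A) (h : H ⧸ A) c.2 y)
    (fun g c y => smul_comm (M := H ⧸ A) (N := Gᵐᵒᵖ) (α := X.quotLeft A hA) c.2 (op g) y)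
    (by
      rintro ⟨⟨⟩, c⟩ ⟨⟨⟩, c'⟩ y y' e
      refine ⟨c⁻¹ * c', ?_, ?_⟩
      · exact Prod.ext rfl (mul_inv_cancel_left c c').symm
      · rw [mul_smul, eq_inv_smul_iff]
        exact e)
    (fun x => ⟨(⟨⟩, 1), x, one_smul (H ⧸ A) (α := X.quotLeft A hA) x⟩)

variable {p : ℕ}

theorem IsBifree.sum_left {X Y Z : FinBiset H G} (e : Iso Z (X.sum Y)) (hZ : Z.IsBifree p) :
    X.IsBifree p := by
  intro x
  have h := hZ (e.toEquiv.symm (inl x))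
  have h1 : MulAction.stabilizer H (e.toEquiv.symm (inl x)) = MulAction.stabilizer H x := by
    ext g
    rw [MulAction.mem_stabilizer_iff, MulAction.mem_stabilizer_iff, ← e.toEquiv.apply_eq_iff_eq,
      e.map_left, Equiv.apply_symm_apply]
    exact Sum.inl_injective.eq_iff
  have h2 : MulAction.stabilizer Gᵐᵒᵖ (e.toEquiv.symm (inl x)) = MulAction.stabilizer Gᵐᵒᵖ x := by
    ext g
    rw [MulAction.mem_stabilizer_iff, MulAction.mem_stabilizer_iff, ← e.toEquiv.apply_eq_iff_eq,
      ← op_unop g, e.map_right, Equiv.apply_symm_apply]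
    exact Sum.inl_injective.eq_iff
  rwa [h1, h2] at h

theorem IsBifree.sum_right {X Y Z : FinBiset H G} (e : Iso Z (X.sum Y)) (hZ : Z.IsBifree p) :
    Y.IsBifree p :=
  hZ.sum_left (e :=
    { toEquiv := e.toEquiv.trans (Equiv.sumComm X Y)
      map_left := fun h z => by
        change Equiv.sumComm X Y (e.toEquiv (h • z)) = _
        rw [e.map_left]
        obtain ⟨x, hx⟩ | ⟨x, hx⟩ := sum_cases (e.toEquiv z) <;>
          change _ = h • Equiv.sumComm X Y (e.toEquiv z) <;> rw [hx] <;> rfl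
      map_right := fun h z => by
        change Equiv.sumComm X Y (e.toEquiv (op h • z)) = _
        rw [e.map_right]
        obtain ⟨x, hx⟩ | ⟨x, hx⟩ := sum_cases (e.toEquiv z) <;>
          change _ = op h • Equiv.sumComm X Y (e.toEquiv z) <;> rw [hx] <;> rfl })

theorem isBifree_rightOrbit [Finite H] {X : FinBiset H G} (hX : X.IsBifree p) (x : X) :
    (rightOrbit x).IsBifree p := by
  intro y
  have h2 : MulAction.stabilizer Gᵐᵒᵖ y = MulAction.stabilizer Gᵐᵒᵖ (show X from y.1) := by
    ext g
    exact Subtype.ext_iff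
  refine ⟨(hX y.1).1.of_injective
    (((leftLink x).subtype.comp (Subgroup.subtype _)).codRestrict _ ?_) ?_, h2 ▸ (hX y.1).2⟩
  · rintro ⟨m, hm⟩
    exact congrArg Subtype.val hm
  · intro a b hab
    have h3 := congrArg Subtype.val hab
    exact Subtype.ext (Subtype.ext h3)

theorem isBifree_quotLeft [Fact p.Prime] {X : FinBiset H G} (hX : X.IsBifree p) (A : Subgroup H)
    [A.Normal] (hA : ∀ a ∈ A, ∀ x : X, a • x = x) (hA' : ∀ x : X, MulAction.stabilizer H x ≤ A) :
    (X.quotLeft A hA).IsBifree p := by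
  intro x
  refine ⟨isPPrimeGroup_of_eq_bot (eq_bot_iff.2 fun c hc => ?_), (hX x).2⟩
  obtain ⟨h, rfl⟩ := QuotientGroup.mk_surjective c
  exact (QuotientGroup.eq_one_iff h).2 (hA' x hc)

/-- A biset that is regular on both sides comes from an automorphism. -/
theorem exists_iso_ofAut [Finite G] {X : FinBiset G G} {x : X}
    (hl : Function.Bijective fun h : G => h • x) (hr : Function.Bijective fun g : G => op g • x) :
    ∃ θ : MulAut G, Nonempty (Iso (ofAut θ) X) := by
  -- `f g` is the element with `f(g) x = x g`; commuting actions make `f` multiplicative.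
  choose f hf using fun g : G => hl.2 (op g • x)
  have hf : ∀ g, f g • x = op g • x := hf
  let φ : G →* G := MonoidHom.mk' f fun a b => hl.1 (by
    change f (a * b) • x = (f a * f b) • x
    rw [hf, op_mul, mul_smul, mul_smul (f a), hf b, smul_comm (f a) (op b), hf a])
  have hφ : Function.Bijective φ := by
    refine Finite.injective_iff_bijective.1 fun a b hab => hr.1 ?_
    change op a • x = op b • x
    rw [← hf, ← hf]
    exact congrArg (· • x) hab
  refine ⟨MulEquiv.ofBijective φ hφ, ⟨⟨Equiv.ofBijective _ hl, ?_, ?_⟩⟩⟩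
  · intro h k
    exact mul_smul h (show G from k) x
  · intro g (k : G)
    change (k * f g) • x = op g • k • x
    rw [mul_smul, hf, smul_comm]

end FinBiset

section EndomorphismRing

variable {p : ℕ} [Fact p.Prime] {R : Type u} [CommRing R]

theorem mk_mem_smallIdeal {G : BifreeCat.{u, v} p R} {M : Type v} [Group M] [Finite M]
    (hM : Nat.card M < Nat.card G.grp) {X : FinBiset G.grp G.grp} (hX : X.IsBifree p)
    {W : FinBiset G.grp M} (hW : W.IsBifree p) {Y : FinBiset M G.grp} (hY : Y.IsBifree p)
    (e : Iso (tensor W Y) X) : (Groth.mk R X hX : G ⟶ G) ∈ G.smallIdeal := by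
  refine Submodule.subset_span ⟨BifreeCat.of (FiniteGrp.of M), Groth.mk R Y hY, Groth.mk R W hW,
    hM, ?_⟩
  refine (Groth.mk_iso (isBifree_empty _ _ _) hX (hW.tensor hY) e.symm).trans ?_
  exact (Groth.comp_mk _ _ _ _ _).symm

/-- `End(G)` is spanned by the `[Iso(θ)]` and by the ideal `I_G`. -/
theorem mem_span_isoAut_sup_smallIdeal {G : BifreeCat.{u, v} p R} (f : G ⟶ G) :
    f ∈ Submodule.span R (Set.range (BifreeCat.isoAut (G := G))) ⊔ G.smallIdeal := by
  set V := Submodule.span R (Set.range (BifreeCat.isoAut (G := G))) ⊔ G.smallIdeal with hV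
  suffices ∀ (X : FinBiset G.grp G.grp) (hX : X.IsBifree p), (Groth.mk R X hX : G ⟶ G) ∈ V from
    Groth.induction (C := fun f => f ∈ V) (zero_mem V) this (fun _ _ => add_mem)
      (fun r _ => Submodule.smul_mem V r) f
  intro X
  induction X using FinBiset.orbit_induction with
  | hempty X he =>
    intro hX
    have : (Groth.mk R X hX : G ⟶ G) = 0 := Groth.mk_eq_zero X hX he
    rw [this]
    exact zero_mem V
  | hsum X Y Z e ihX ihY =>
    intro hZ
    have : (Groth.mk R Z hZ : G ⟶ G) = Groth.mk R X (hZ.sum_left e) + Groth.mk R Y (hZ.sum_right e) :=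
      Groth.mk_sum R _ _ _ e
    rw [this]
    exact add_mem (ihX _) (ihY _)
  | horb X x hx =>
    intro hX
    by_cases hP : leftLink x = ⊤
    swap
    -- If `leftLink x` is proper, `X` is induced from it and so factors through a smaller group.
    · refine Submodule.mem_sup_right (mk_mem_smallIdeal ?_ hX
        (isBifree_viaHom _ (isPPrimeGroup_ker_subtype (leftLink x)))
        (isBifree_rightOrbit hX x) (tensorRightOrbit hx))
      exact lt_of_le_of_ne (Subgroup.card_le_card_group _) fun h =>
        hP (Subgroup.eq_top_of_card_eq _ h)
    have hlink : ∀ h : G.grp, ∃ g : G.grp, h • x = op g • x := fun h =>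
      (hP.symm ▸ Subgroup.mem_top h : h ∈ leftLink x)
    have hx' : ∀ y : X, ∃ g : G.grp, y = op g • x := by
      intro y
      obtain ⟨h, g, rfl⟩ := hx y
      obtain ⟨k, hk⟩ := hlink h
      exact ⟨k * g, by rw [smul_comm, hk, op_mul, mul_smul]⟩
    -- The right orbit of `x` is now all of `X`, so every point has the same left stabilizer `A`. It
    -- is normal and acts trivially; if it is nontrivial, `X` factors through `G/A`.
    set A := MulAction.stabilizer G.grp x with hA
    have hstab : ∀ y : X, MulAction.stabilizer G.grp y = A := by
      intro y
      obtain ⟨g, rfl⟩ := hx' y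
      ext h
      rw [MulAction.mem_stabilizer_iff, hA, MulAction.mem_stabilizer_iff, smul_comm,
        smul_left_cancel_iff]
    have hnormal : A.Normal := ⟨fun a ha h => by
      have : a ∈ MulAction.stabilizer G.grp (h⁻¹ • x) := (hstab _).symm ▸ ha
      rw [MulAction.mem_stabilizer_iff] at this
      rw [hA, MulAction.mem_stabilizer_iff, mul_smul, mul_smul, this, smul_inv_smul]⟩
    by_cases hbot : A = ⊥
    swap
    · have htriv : ∀ a ∈ A, ∀ y : X, a • y = y := fun a ha y => by
        rw [← hstab y] at ha
        exact ha
      refine Submodule.mem_sup_right (mk_mem_smallIdeal ?_ hX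
        (isBifree_twist (QuotientGroup.mk' A) PUnit.{v + 1} ?_)
        (isBifree_quotLeft hX A htriv fun y => (hstab y).le) (tensorQuotLeft X A htriv))
      · rw [Subgroup.card_eq_card_quotient_mul_card_subgroup A]
        exact lt_mul_of_one_lt_right Nat.card_pos (A.one_lt_card_iff_ne_bot.2 hbot)
      · rw [QuotientGroup.ker_mk']
        exact (hX x).1
    have hinj : Function.Injective fun h : G.grp => h • x := by
      intro h k hhk
      have : k⁻¹ * h ∈ A := by
        rw [hA, MulAction.mem_stabilizer_iff, mul_smul, inv_smul_eq_iff]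
        exact hhk
      rw [hbot, Subgroup.mem_bot] at this
      exact (inv_mul_eq_one.1 this).symm
    have hsurj : Function.Surjective fun g : G.grp => op g • x := fun y => by
      obtain ⟨g, rfl⟩ := hx' y
      exact ⟨g, rfl⟩
    -- The left action is free and the right action transitive, so comparing cardinalities makes
    -- both regular.
    have hcard : Nat.card G.grp = Nat.card X :=
      le_antisymm (Nat.card_le_card_of_injective _ hinj) (Nat.card_le_card_of_surjective _ hsurj)
    obtain ⟨θ, ⟨e⟩⟩ := exists_iso_ofAut
      ((Nat.bijective_iff_injective_and_card _).2 ⟨hinj, hcard⟩)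
      ((Nat.bijective_iff_surjective_and_card _).2 ⟨hsurj, hcard⟩)
    refine Submodule.mem_sup_left (Submodule.subset_span ⟨θ, ?_⟩)
    exact Groth.mk_iso (isBifree_empty _ _ _) _ _ e

end EndomorphismRing

/-! ### Subquotients -/

namespace SubFun

variable {p : ℕ} [Fact p.Prime] {R : Type u} [CommRing R]
variable {F F' : BifreeCat.{u, v} p R ⥤ ModuleCat.{w} R}

/-- The preimage of a subfunctor under a natural transformation. -/
def comap (η : F ⟶ F') (A : SubFun F') : SubFun F where
  obj G := (A.obj G).comap (η.app G).hom
  map_mem {G H} f x hx := by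
    have h := congrArg (fun l => l.hom x) (η.naturality f)
    change (η.app H).hom ((F.map f).hom x) ∈ A.obj H
    refine Eq.subst (motive := fun z => z ∈ A.obj H) h.symm ?_
    exact A.map_mem f _ hx

/-- Isomorphic functors have isomorphic lattices of subfunctors. -/
def orderIsoOfIso (e : F ≅ F') : SubFun F ≃o SubFun F' where
  toFun := comap e.inv
  invFun := comap e.hom
  left_inv A := by
    refine SubFun.ext (funext fun G => Submodule.ext fun x => ?_)
    change (e.inv.app G).hom ((e.hom.app G).hom x) ∈ A.obj G ↔ _
    rw [show (e.inv.app G).hom ((e.hom.app G).hom x) = x from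
      congrArg (fun l => l.hom x) (e.hom_inv_id_app G)]
  right_inv A := by
    refine SubFun.ext (funext fun G => Submodule.ext fun x => ?_)
    change (e.hom.app G).hom ((e.inv.app G).hom x) ∈ A.obj G ↔ _
    rw [show (e.hom.app G).hom ((e.inv.app G).hom x) = x from
      congrArg (fun l => l.hom x) (e.inv_hom_id_app G)]
  map_rel_iff' {A B} := by
    constructor
    · intro h G x hx
      have h1 : ∀ x, (e.inv.app G).hom ((e.hom.app G).hom x) = x := fun x =>
        congrArg (fun l => l.hom x) (e.hom_inv_id_app G)
      have h2 := h G (x := (e.hom.app G).hom x) (by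
        change (e.inv.app G).hom ((e.hom.app G).hom x) ∈ A.obj G
        rwa [h1])
      change (e.inv.app G).hom ((e.hom.app G).hom x) ∈ B.obj G at h2
      rwa [h1] at h2
    · exact fun h G x hx => h G hx

theorem _root_.BifreeBiset.IsSimpleFunctor.of_iso (e : F ≅ F') (h : IsSimpleFunctor F) :
    IsSimpleFunctor F' :=
  (orderIsoOfIso e).isSimpleOrder_iff.1 h

theorem mem_bot_obj {G : BifreeCat.{u, v} p R} {x : F.obj G} :
    x ∈ (⊥ : SubFun F).obj G ↔ x = 0 := Submodule.mem_bot R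

theorem mem_top_obj {G : BifreeCat.{u, v} p R} (x : F.obj G) : x ∈ (⊤ : SubFun F).obj G :=
  Submodule.mem_top

/-- The class of an element in a subquotient. -/
def subquotientMk (A B : SubFun F) (G : BifreeCat.{u, v} p R) :
    B.obj G →ₗ[R] (A.subquotient B).obj G :=
  ((A.restrict B).obj G).mkQ

theorem subquotientMk_surjective (A B : SubFun F) (G : BifreeCat.{u, v} p R) :
    Function.Surjective (subquotientMk A B G) :=
  Submodule.mkQ_surjective ((A.restrict B).obj G)

theorem subquotientMk_eq_zero {A B : SubFun F} {G : BifreeCat.{u, v} p R} {x : B.obj G} :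
    subquotientMk A B G x = 0 ↔ x.1 ∈ A.obj G :=
  Submodule.Quotient.mk_eq_zero ((A.restrict B).obj G)

/-- The image `C/A` is a subfunctor of `B/A`, hence zero or everything. -/
theorem eq_or_eq_of_isSimple {A B C : SubFun F} (h : IsSimpleFunctor (A.subquotient B))
    (hAC : A ≤ C) (hCB : C ≤ B) : C = A ∨ C = B := by
  let D : SubFun (A.subquotient B) :=
    { obj := fun G => ((C.obj G).comap (B.obj G).subtype).map (subquotientMk A B G)
      map_mem := by
        rintro G H f _ ⟨x, hx, rfl⟩
        exact ⟨⟨(F.map f).hom x.1, B.map_mem f x.1 x.2⟩, C.map_mem f x.1 hx, rfl⟩ }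
  rcases h.eq_bot_or_eq_top D with hD | hD
  · refine Or.inl (le_antisymm (fun G x hx => ?_) hAC)
    have h1 : subquotientMk A B G ⟨x, hCB G hx⟩ ∈ D.obj G := ⟨⟨x, hCB G hx⟩, hx, rfl⟩
    rw [hD, mem_bot_obj, subquotientMk_eq_zero] at h1
    exact h1
  · refine Or.inr (le_antisymm hCB fun G x hx => ?_)
    have h1 : subquotientMk A B G ⟨x, hx⟩ ∈ D.obj G := hD ▸ mem_top_obj _
    obtain ⟨y, hy, hyx⟩ := h1
    rw [← sub_eq_zero, ← map_sub, subquotientMk_eq_zero] at hyx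
    have h3 : y.1 - x ∈ C.obj G := hAC G hyx
    have h4 : y.1 ∈ C.obj G := hy
    simpa using sub_mem h4 h3

/-- The preimage in `B` of a subfunctor of `B/A` lies between `A` and `B`; strictness of `A < B`
makes the quotient nonzero. -/
theorem isSimple_subquotient {A B : SubFun F} (hAB : A < B)
    (h : ∀ C, A ≤ C → C ≤ B → C = A ∨ C = B) : IsSimpleFunctor (A.subquotient B) := by
  have key : ∀ D : SubFun (A.subquotient B), D = ⊥ ∨ D = ⊤ := by
    intro D
    let C : SubFun F :=
      { obj := fun G => ((D.obj G).comap (subquotientMk A B G)).map (B.obj G).subtype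
        map_mem := by
          rintro G H f _ ⟨x, hx, rfl⟩
          exact ⟨⟨(F.map f).hom x.1, B.map_mem f x.1 x.2⟩, D.map_mem f _ hx, rfl⟩ }
    have hC : ∀ (G) (x : B.obj G), subquotientMk A B G x ∈ D.obj G → x.1 ∈ C.obj G :=
      fun G x hx => ⟨x, hx, rfl⟩
    have hAC : A ≤ C := fun G x hx => hC G ⟨x, hAB.le G hx⟩ (by
      rw [subquotientMk_eq_zero.2 hx]
      exact zero_mem _)
    have hCB : C ≤ B := by
      rintro G _ ⟨x, -, rfl⟩
      exact x.2
    rcases h C hAC hCB with hCA | hCB'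
    · refine Or.inl (le_bot_iff.1 fun G q hq => ?_)
      obtain ⟨x, rfl⟩ := subquotientMk_surjective A B G q
      have h1 := hC G x hq
      rw [hCA] at h1
      exact mem_bot_obj.2 (subquotientMk_eq_zero.2 h1)
    · refine Or.inr (top_le_iff.1 fun G q _ => ?_)
      obtain ⟨x, rfl⟩ := subquotientMk_surjective A B G q
      have h1 : x.1 ∈ C.obj G := by
        rw [hCB']
        exact x.2
      obtain ⟨y, hy, hyx⟩ := h1
      rw [← Subtype.ext (a1 := y) (a2 := x) hyx]
      exact hy
  have hne : (⊥ : SubFun (A.subquotient B)) ≠ ⊤ := by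
    intro hbt
    refine hAB.not_ge fun G x hx => ?_
    have h1 : subquotientMk A B G ⟨x, hx⟩ ∈ (⊥ : SubFun (A.subquotient B)).obj G :=
      hbt ▸ mem_top_obj _
    rwa [mem_bot_obj, subquotientMk_eq_zero] at h1
  have : Nontrivial (SubFun (A.subquotient B)) := ⟨⊥, ⊤, hne⟩
  exact ⟨key⟩

/-- The natural transformation out of a quotient functor. -/
def quotientLift (A : SubFun F) (η : F ⟶ F') (h : ∀ G, ∀ x ∈ A.obj G, (η.app G).hom x = 0) :
    A.quotient ⟶ F' where
  app G := ModuleCat.ofHom ((A.obj G).liftQ (η.app G).hom (h G))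
  naturality G H f := by
    refine ModuleCat.hom_ext (Submodule.linearMap_qext _ (LinearMap.ext fun x => ?_))
    exact congrArg (fun l => l.hom x) (η.naturality f)

/-- The first isomorphism theorem. -/
def quotientIso (A : SubFun F) (η : F ⟶ F') (hs : ∀ G, Function.Surjective (η.app G).hom)
    (h : ∀ G x, x ∈ A.obj G ↔ (η.app G).hom x = 0) : A.quotient ≅ F' :=
  NatIso.ofComponents (fun G => LinearEquiv.toModuleIso (X₁ := F.obj G ⧸ A.obj G)
      ((Submodule.quotEquivOfEq _ _ (Submodule.ext (h G))).trans
        ((η.app G).hom.quotKerEquivOfSurjective (hs G)))) (by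
    intro G H f
    refine ModuleCat.hom_ext (Submodule.linearMap_qext _ (LinearMap.ext fun x => ?_))
    exact congrArg (fun l => l.hom x) (η.naturality f))

/-- The projection onto a subquotient. -/
def toSubquotient (A B C : SubFun F) (hCB : C ≤ B) : C.toFunctor ⟶ A.subquotient B where
  app G := ModuleCat.ofHom (subquotientMk A B G ∘ₗ Submodule.inclusion (hCB G))
  naturality _ _ _ := rfl

/-- The second isomorphism theorem. -/
theorem nonempty_subquotient_iso {A B C D : SubFun F} (hsup : C ⊔ A = B) (hinf : C ⊓ A = D) :
    Nonempty (D.subquotient C ≅ A.subquotient B) := by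
  have hCB : C ≤ B := hsup ▸ le_sup_left
  refine ⟨quotientIso (D.restrict C) (toSubquotient A B C hCB) ?_ ?_⟩
  · intro G q
    obtain ⟨⟨x, hx⟩, rfl⟩ := subquotientMk_surjective A B G q
    have hx' : x ∈ C.obj G ⊔ A.obj G := by
      rw [← hsup] at hx
      exact hx
    obtain ⟨c, hc, a, ha, rfl⟩ := Submodule.mem_sup.1 hx'
    refine ⟨⟨c, hc⟩, ?_⟩
    change subquotientMk A B G ⟨c, hCB G hc⟩ = subquotientMk A B G ⟨c + a, hx⟩
    rw [eq_comm, ← sub_eq_zero, ← map_sub, subquotientMk_eq_zero]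
    change c + a - c ∈ A.obj G
    simpa using ha
  · rintro G ⟨x, hx⟩
    refine Iff.trans ?_ (subquotientMk_eq_zero (A := A) (B := B) (x := ⟨x, hCB G hx⟩)).symm
    change x ∈ D.obj G ↔ x ∈ A.obj G
    rw [← hinf]
    exact ⟨fun h => h.2, fun h => ⟨hx, h⟩⟩

end SubFun

/-! ### The simple quotient of `e^Δ_G` -/

section SimpleQuotient

/-- `Iso(θ) ×_G U` is the set `U` on which `G` acts through `θ⁻¹`. -/
def FinBiset.ofAutTensor {G : Type v} [Group G] [Finite G] (θ : MulAut G)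
    (U : FinBiset G PUnit.{v + 1}) :
    Iso ((ofAut θ).tensor U) (prodRes θ.symm.toMonoidHom PUnit.{v + 1} U) :=
  isoOfLeft
    { toFun := tlift (fun (x : G) u => ((⟨⟩, θ.symm x • u) : PUnit.{v + 1} × U))
        (fun (x : G) g u => by
          change ((⟨⟩, θ.symm (x * θ g) • u) : PUnit.{v + 1} × U) = (⟨⟩, θ.symm x • g • u)
          rw [map_mul, MulEquiv.symm_apply_apply, mul_smul])
      invFun := fun b => tmk (X := ofAut θ) (1 : G) b.2
      left_inv := by
        intro t
        obtain ⟨x, u, rfl⟩ := tmk_surj t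
        refine (tmk_smul (X := ofAut θ) (1 : G) (θ.symm (show G from x)) u).symm.trans ?_
        refine congrArg (fun z : G => tmk (X := ofAut θ) z u) ?_
        exact (one_mul (θ (θ.symm (show G from x)))).trans (θ.apply_symm_apply _)
      right_inv := by
        rintro ⟨⟨⟩, u⟩
        change ((⟨⟩, θ.symm 1 • u) : PUnit.{v + 1} × U) = _
        rw [map_one, one_smul] }
    (by
      intro h t
      obtain ⟨x, u, rfl⟩ := tmk_surj t
      change ((⟨⟩, θ.symm (h * (show G from x)) • u) : PUnit.{v + 1} × U) =
        (⟨⟩, θ.symm h • θ.symm (show G from x) • u)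
      rw [map_mul, mul_smul])

variable {p : ℕ} [Fact p.Prime] {K : Type u} [Field K] (G : BifreeCat.{u, v} p K)

/-- The functor `L_{G,K}` for the trivial module `K`. -/
abbrev functorLTriv : BifreeCat.{u, v} p K ⥤ ModuleCat.{max u (v + 1)} K :=
  functorL G (Representation.trivial K (Out G.grp) K)

/-- The class of an element of `K B^Δ(H, G) ⊗ K` in `L_{G,K}(H)`. -/
def functorLMk (H : BifreeCat.{u, v} p K) :
    (G ⟶ H) ⊗[K] K →ₗ[K] (functorLTriv G).obj H :=
  ((tensorRel G (Representation.trivial K (Out G.grp) K)).obj H).mkQ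

theorem functorLMk_surjective (H : BifreeCat.{u, v} p K) : Function.Surjective (functorLMk G H) :=
  Submodule.mkQ_surjective ((tensorRel G (Representation.trivial K (Out G.grp) K)).obj H)

/-- The action of morphisms on `e^G_G`. -/
def evalIdem (H : BifreeCat.{u, v} p K) : (G ⟶ H) →ₗ[K] (burnside p K).obj H :=
  (Burn.act (p := p) (R := K) (H := H.grp) (G := G.grp)).flip (Burn.idem K G.grp)

theorem evalIdem_comp {H H' : BifreeCat.{u, v} p K} (f : G ⟶ H) (g : H ⟶ H') :
    evalIdem G H' (f ≫ g) = ((burnside p K).map g).hom (evalIdem G H f) :=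
  Burn.act_act g f _

theorem evalIdem_id : evalIdem G G (𝟙 G) = Burn.idem K G.grp :=
  Burn.act_refl _

theorem evalIdem_mem {H : BifreeCat.{u, v} p K} (f : G ⟶ H) :
    evalIdem G H f ∈ (eSub K p G.grp).obj H :=
  (eSub K p G.grp).act_mem f (idem_mem_eSub G.grp)

/-- The natural transformation `f ⊗ v ↦ v · f(e^G_G)`. -/
def homTensorToESub : homTensor G K ⟶ (eSub K p G.grp).toFunctor where
  app H := ModuleCat.ofHom ((evalIdem G H).codRestrict _ (evalIdem_mem G) ∘ₗ
    (TensorProduct.rid K (G ⟶ H)).toLinearMap)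
  naturality {H H'} g := by
    refine ModuleCat.hom_ext (TensorProduct.ext' fun f c => Subtype.ext ?_)
    change evalIdem G H' (c • (f ≫ g)) = ((burnside p K).map g).hom (evalIdem G H (c • f))
    rw [← Linear.smul_comp, evalIdem_comp]

/-- `L_{G,K}(G)` is spanned by the class of `1 ⊗ 1`. -/
theorem exists_eq_functorLMk {G : BifreeCat.{u, v} p K} (s : (functorLTriv G).obj G) :
    ∃ c : K, s = functorLMk G G (𝟙 G ⊗ₜ[K] c) := by
  obtain ⟨t, rfl⟩ := functorLMk_surjective G G s
  let l : (G ⟶ G) →ₗ[K] (functorLTriv G).obj G :=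
    functorLMk G G ∘ₗ (TensorProduct.mk K (G ⟶ G) K).flip 1
  have hl : ∀ f, l f = functorLMk G G (f ⊗ₜ[K] (1 : K)) := fun f => rfl
  -- The first relation identifies `[Iso(θ)] ⊗ 1` with `1 ⊗ 1`, as the module is trivial; the second
  -- kills `I_G ⊗ 1`.
  have hspan : ∀ f, l f ∈ Submodule.span K {l (𝟙 G)} := by
    intro f
    refine (sup_le (c := (Submodule.span K {l (𝟙 G)}).comap l) ?_ ?_)
      (mem_span_isoAut_sup_smallIdeal f)
    · refine Submodule.span_le.2 ?_
      rintro _ ⟨θ, rfl⟩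
      refine Submodule.mem_span_singleton.2 ⟨1, ?_⟩
      rw [one_smul, eq_comm, ← sub_eq_zero, hl, hl, ← map_sub]
      refine (Submodule.Quotient.mk_eq_zero _).2 (Submodule.subset_span (Or.inl ⟨𝟙 _, θ, 1, ?_⟩))
      rw [Category.comp_id]
      rfl
    · intro a ha
      refine Submodule.mem_span_singleton.2 ⟨0, ?_⟩
      rw [zero_smul, eq_comm, hl]
      refine (Submodule.Quotient.mk_eq_zero _).2 (Submodule.subset_span (Or.inr ⟨𝟙 _, a, 1, ha, ?_⟩))
      rw [Category.comp_id]
  obtain ⟨f, rfl⟩ := (TensorProduct.rid K (G ⟶ G)).symm.surjective t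
  obtain ⟨c, hc⟩ := Submodule.mem_span_singleton.1 (hspan f)
  refine ⟨c, ?_⟩
  change l f = _
  rw [← hc, hl, ← map_smul, TensorProduct.smul_tmul', TensorProduct.smul_tmul, smul_eq_mul, mul_one]

variable [CharZero K]

theorem isSimple_eSub_quotient (G : BGroup.{v} p) :
    IsSimpleFunctor ((jSub K p G.1).subquotient (eSub K p G.1)) := by
  refine SubFun.isSimple_subquotient (jSub_lt_eSub G) fun C hj he => ?_
  rcases he.lt_or_eq with h | h
  · exact Or.inl (le_antisymm (le_jSub_of_lt G h) hj)
  · exact Or.inr h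

/-- `[Iso(θ)]` permutes the marks by `T ↦ θ⁻¹(T)`, which fixes `⊤`, the only subgroup where `e^G_G`
has a nonzero mark. -/
theorem act_ofAut_idem {G : Type v} [Group G] [Finite G] (θ : MulAut G) :
    Burn.act (Groth.mk K (FinBiset.ofAut θ) (FinBiset.isBifree_ofAut (p := p) θ)) (Burn.idem K G) =
      Burn.idem K G := by
  classical
  refine Burn.ext_mark fun T => ?_
  have key : ∀ x : Burn K G, Burn.mark K T
      (Burn.act (Groth.mk K (FinBiset.ofAut θ) (FinBiset.isBifree_ofAut (p := p) θ)) x) =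
        Burn.mark K (T.map θ.symm.toMonoidHom) x := by
    intro x
    induction x using Groth.induction with
    | h0 => simp
    | hadd x y hx hy => simp only [map_add, hx, hy]
    | hsmul r x hx => simp only [map_smul, hx]
    | hmk U hU =>
      rw [Burn.act_mk, Burn.mk_iso (FinBiset.ofAutTensor θ U), Burn.mark_prodRes, Burn.mark_mk]
      have : Nat.card {u : FinBiset.ofGSet G PUnit.{v + 1} // ∀ l ∈ T, l • u = u} = 1 :=
        Nat.card_eq_one_iff_unique.2 ⟨⟨fun a b => Subtype.ext rfl⟩, ⟨⟨⟨⟩, fun _ _ => rfl⟩⟩⟩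
      rw [this, Nat.cast_one, one_mul]
  rw [key, mark_idem, mark_idem]
  refine if_congr ?_ rfl rfl
  rw [← (Subgroup.map_injective (f := θ.symm.toMonoidHom) θ.symm.injective).eq_iff (a := T) (b := ⊤),
    Subgroup.map_top_of_surjective _ θ.symm.surjective]

theorem evalIdem_isoAut (θ : MulAut G.grp) :
    evalIdem G G (BifreeCat.isoAut θ) = evalIdem G G (𝟙 G) :=
  (act_ofAut_idem θ).trans (evalIdem_id G).symm

variable {G}

/-- A morphism through a smaller group `H` passes through `e^Δ_G(H)`, which is zero since `G` is a
`B^Δ_p`-group. -/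
theorem evalIdem_smallIdeal (hG : IsBGroup p G.grp) {a : G ⟶ G} (ha : a ∈ G.smallIdeal) :
    evalIdem G G a = 0 := by
  refine (Submodule.span_le (p := LinearMap.ker (evalIdem G G))).2 ?_ ha
  rintro _ ⟨H, b, c, hlt, rfl⟩
  have h1 : evalIdem G H b = 0 := by
    by_contra h0
    exact hlt.not_ge (card_le_of_mem_eSub (G := H.grp) (H := ⟨G.grp, hG⟩) (evalIdem_mem G b) h0)
  rw [SetLike.mem_coe, LinearMap.mem_ker, evalIdem_comp, h1, map_zero]

theorem homTensorToESub_tensorRel (hG : IsBGroup p G.grp) (H : BifreeCat.{u, v} p K)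
    (t : (homTensor G K).obj H)
    (ht : t ∈ (tensorRel G (Representation.trivial K (Out G.grp) K)).obj H) :
    ((homTensorToESub G).app H).hom t = 0 := by
  refine (Submodule.span_le (p := LinearMap.ker ((homTensorToESub G).app H).hom)).2 ?_ ht
  rintro _ (⟨f, θ, c, rfl⟩ | ⟨f, a, c, ha, rfl⟩)
  · refine LinearMap.mem_ker.2 ((map_sub _ _ _).trans (sub_eq_zero.2 (Subtype.ext ?_)))
    change evalIdem G H (c • (BifreeCat.isoAut θ ≫ f)) = evalIdem G H (c • f)
    rw [map_smul, map_smul, evalIdem_comp, evalIdem_isoAut, ← evalIdem_comp, Category.id_comp]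
  · refine LinearMap.mem_ker.2 (Subtype.ext ?_)
    change evalIdem G H (c • (a ≫ f)) = 0
    rw [map_smul, evalIdem_comp, evalIdem_smallIdeal hG ha, map_zero, smul_zero]

/-- The natural transformation `L_{G,K} ⟶ e^Δ_G`. -/
def functorLToESub (hG : IsBGroup p G.grp) : functorLTriv G ⟶ (eSub K p G.grp).toFunctor :=
  (tensorRel G (Representation.trivial K (Out G.grp) K)).quotientLift
    (homTensorToESub G) (homTensorToESub_tensorRel hG)

theorem functorLToESub_mk (hG : IsBGroup p G.grp) {H : BifreeCat.{u, v} p K} (f : G ⟶ H) (c : K) :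
    (((functorLToESub hG).app H).hom (functorLMk G H (f ⊗ₜ[K] c))).1 = evalIdem G H (c • f) := rfl

theorem functorLToESub_surjective (hG : IsBGroup p G.grp) (H : BifreeCat.{u, v} p K) :
    Function.Surjective ((functorLToESub hG).app H).hom := by
  rintro ⟨x, hx⟩
  obtain ⟨f, hf⟩ := mem_eSub_iff.1 hx
  refine ⟨functorLMk G H ((f : G ⟶ H) ⊗ₜ[K] 1), Subtype.ext ?_⟩
  rw [functorLToESub_mk, one_smul]
  exact hf

/-- Every element of `L_{G,K}(G)` is the class of some `1 ⊗ c`, which maps to `c e^G_G`; since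
`e^G_G ∉ j_G(G)`, this lies in `j_G(G)` only for `c = 0`. -/
theorem functorLToESub_mem_jSub_iff (hG : IsBGroup p G.grp) (s : (functorLTriv G).obj G) :
    (((functorLToESub hG).app G).hom s).1 ∈ (jSub K p G.grp).obj G ↔ s = 0 := by
  constructor
  · intro h
    obtain ⟨c, rfl⟩ := exists_eq_functorLMk s
    rw [functorLToESub_mk, map_smul] at h
    have hc : c = 0 := by
      by_contra hc
      have h1 := (Submodule.smul_mem_iff _ hc).1 h
      rw [evalIdem_id] at h1
      exact not_eSub_le_jSub (K := K) ⟨G.grp, hG⟩ (eSub_le_iff.2 h1)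
    rw [hc, TensorProduct.tmul_zero, map_zero]
  · rintro rfl
    rw [map_zero]
    exact zero_mem _

/-- The elements that all morphisms to `G` send into `j_G(G)` form a subfunctor `C`. The identity of
`G` shows that `C` misses `e^G_G`, so `e^Δ_G ∩ C` is proper and lies in `j_G` by maximality. -/
theorem mem_jSub_iff (hG : IsBGroup p G.grp) {H : BifreeCat.{u, v} p K} {x : (burnside p K).obj H}
    (hx : x ∈ (eSub K p G.grp).obj H) :
    x ∈ (jSub K p G.grp).obj H ↔ ∀ y : H ⟶ G,
      ((burnside p K).map y).hom x ∈ (jSub K p G.grp).obj G := by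
  refine ⟨fun h y => (jSub K p G.grp).map_mem y x h, fun h => ?_⟩
  let C : SubFun (burnside.{u, v} p K) :=
    { obj := fun H => ⨅ y : H ⟶ G, ((jSub K p G.grp).obj G).comap ((burnside p K).map y).hom
      map_mem := by
        intro H H' f x hx
        simp only [Submodule.mem_iInf, Submodule.mem_comap] at hx ⊢
        intro y
        have := hx (f ≫ y)
        rwa [Functor.map_comp, ModuleCat.hom_comp, LinearMap.comp_apply] at this }
  have hC : ∀ {H : BifreeCat.{u, v} p K} (x : (burnside p K).obj H), x ∈ C.obj H ↔ ∀ y : H ⟶ G,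
      ((burnside p K).map y).hom x ∈ (jSub K p G.grp).obj G := fun x => by
    simp only [C, Submodule.mem_iInf, Submodule.mem_comap]
  have hlt : eSub K p G.grp ⊓ C < eSub K p G.grp := by
    refine lt_of_le_of_ne inf_le_left fun h => not_eSub_le_jSub (K := K) ⟨G.grp, hG⟩ ?_
    have h1 : evalIdem G G (𝟙 G) ∈ C.obj G := inf_eq_left.1 h G (evalIdem_mem G (𝟙 G))
    have h2 := (hC _).1 h1 (𝟙 G)
    rw [← evalIdem_comp, Category.comp_id, evalIdem_id] at h2
    exact eSub_le_iff.2 h2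
  exact le_jSub_of_lt ⟨G.grp, hG⟩ hlt H ⟨hx, (hC x).2 h⟩

/-- `J_{G,K}` is the kernel of the surjection `L_{G,K} ⟶ e^Δ_G / j_G`: lying in `J` and lying over
`j_G` are both tested on morphisms to `G`, and there they agree by `functorLToESub_mem_jSub_iff`. -/
theorem nonempty_functorSTriv_iso (hG : IsBGroup p G.grp) :
    Nonempty ((jSub K p G.grp).subquotient (eSub K p G.grp) ≅ functorSTriv G) := by
  refine ⟨Iso.symm (SubFun.quotientIso (functorJ G (Representation.trivial K (Out G.grp) K))
    (functorLToESub hG ≫ SubFun.toSubquotient (jSub K p G.grp) _ _ le_rfl) ?_ ?_)⟩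
  · intro H q
    obtain ⟨x, rfl⟩ := SubFun.subquotientMk_surjective _ _ H q
    obtain ⟨t, rfl⟩ := functorLToESub_surjective hG H x
    exact ⟨t, rfl⟩
  · intro H t
    have hnat : ∀ y : H ⟶ G,
        (((functorLToESub hG).app _).hom (((functorLTriv G).map y).hom t)).1 =
          ((burnside p K).map y).hom (((functorLToESub hG).app H).hom t).1 := fun y =>
      congrArg (fun l => (l.hom t).1) ((functorLToESub hG).naturality y)
    have h1 : t ∈ (functorJ G (Representation.trivial K (Out G.grp) K)).obj H ↔
        ∀ y : H ⟶ G, ((functorLTriv G).map y).hom t = 0 := by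
      change t ∈ (⨅ y : H ⟶ G, LinearMap.ker ((functorLTriv G).map y).hom) ↔ _
      simp only [Submodule.mem_iInf, LinearMap.mem_ker]
    rw [h1]
    refine Iff.trans ?_ (SubFun.subquotientMk_eq_zero (x := ((functorLToESub hG).app H).hom t)).symm
    refine Iff.trans ?_ (mem_jSub_iff hG (((functorLToESub hG).app H).hom t).2).symm
    refine forall_congr' fun y => ?_
    rw [← hnat]
    exact (functorLToESub_mem_jSub_iff hG _).symm

end SimpleQuotient

/-! ### Composition factors of the Burnside functor -/

section CompositionFactors

variable {p : ℕ} [Fact p.Prime] {K : Type u} [Field K] [CharZero K]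

/-- Some `e^Δ_G` lies in `F'` but not in `F`, and simplicity gives `e^Δ_G + F = F'`. For a second
such group, primeness puts each `e^Δ` inside the other, so the groups dominate each other. If `j_G`
were not in `F`, then `j_G + F = F'`, and primeness would put `e^Δ_G` into `j_G` or `F`. Maximality
of `j_G` and the second isomorphism theorem finish. -/
theorem exists_bGroup_of_isSimple {F F' : SubFun (burnside.{u, v} p K)} (hlt : F < F')
    (hs : IsSimpleFunctor (F.subquotient F')) :
    ∃ G : BGroup.{v} p, (eSub K p G.1 ≤ F' ∧ ¬ eSub K p G.1 ≤ F) ∧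
      (∀ G' : BGroup.{v} p, eSub K p G'.1 ≤ F' → ¬ eSub K p G'.1 ≤ F →
        Nonempty (G'.1 ≃* G.1)) ∧
      eSub K p G.1 ⊔ F = F' ∧ eSub K p G.1 ⊓ F = jSub K p G.1 ∧
      Nonempty (F.subquotient F' ≅ functorSTriv (BifreeCat.of G.1)) := by
  obtain ⟨G, hG', hG⟩ : ∃ G : BGroup.{v} p, eSub K p G.1 ≤ F' ∧ ¬ eSub K p G.1 ≤ F := by
    by_contra! h
    refine hlt.not_ge ?_
    rw [F'.eq_iSup_eSub]
    exact iSup₂_le h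
  have hsup : ∀ H : BGroup.{v} p, eSub K p H.1 ≤ F' → ¬ eSub K p H.1 ≤ F →
      eSub K p H.1 ⊔ F = F' := fun H hH' hH =>
    (SubFun.eq_or_eq_of_isSimple hs le_sup_right (sup_le hH' hlt.le)).resolve_left
      fun h => hH (h ▸ le_sup_left)
  have hdom : ∀ H H' : BGroup.{v} p, eSub K p H.1 ≤ F' → ¬ eSub K p H.1 ≤ F →
      eSub K p H'.1 ≤ F' → ¬ eSub K p H'.1 ≤ F → Dominates p H'.1 H.1 := by
    intro H H' h1 h2 h3 h4
    rw [← hsup H h1 h2] at h3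
    exact dominates_of_eSub_le ((eSub_le_sup h3).resolve_right h4)
  have hj : jSub K p G.1 ≤ F := by
    rcases SubFun.eq_or_eq_of_isSimple hs le_sup_right
      (sup_le ((jSub_le_eSub G.1).trans hG') hlt.le) with h | h
    · exact h ▸ le_sup_left
    · rw [← h] at hG'
      exact ((eSub_le_sup hG').elim (not_eSub_le_jSub G) hG).elim
  have hinf : eSub K p G.1 ⊓ F = jSub K p G.1 := by
    refine le_antisymm (le_jSub_of_lt G (lt_of_le_of_ne inf_le_left fun h => ?_))
      (le_inf (jSub_le_eSub _) hj)
    exact hG (inf_eq_left.1 h)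
  refine ⟨G, ⟨hG', hG⟩, fun H hH' hH => ?_, hsup G hG' hG, hinf, ?_⟩
  · exact (hdom G H hG' hG hH' hH).nonempty_mulEquiv (hdom H G hH' hH hG' hG).card_le
  · obtain ⟨e⟩ := SubFun.nonempty_subquotient_iso (hsup G hG' hG) hinf
    obtain ⟨e'⟩ := nonempty_functorSTriv_iso (G := BifreeCat.of G.1) (K := K) G.2
    exact ⟨e.symm ≪≫ e'⟩

theorem isCompositionFactor_burnside_iff (S : BifreeCat.{u, v} p K ⥤ ModuleCat.{max u (v + 1)} K) :
    IsCompositionFactor S (burnside.{u, v} p K) ↔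
      ∃ G : BGroup.{v} p, Nonempty (S ≅ functorSTriv (BifreeCat.of G.1)) := by
  constructor
  · rintro ⟨hS, A, B, hAB, ⟨e⟩⟩
    have hs : IsSimpleFunctor (A.subquotient B) := hS.of_iso e.symm
    -- For `A = B` the subquotient is zero, hence not simple.
    have hlt : A < B := by
      refine lt_of_le_of_ne hAB ?_
      rintro rfl
      have : Nontrivial (SubFun (A.subquotient A)) := hs.toNontrivial
      refine bot_ne_top (α := SubFun (A.subquotient A)) (top_le_iff.1 fun G q _ => ?_)
      obtain ⟨x, rfl⟩ := SubFun.subquotientMk_surjective A A G q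
      exact SubFun.mem_bot_obj.2 (SubFun.subquotientMk_eq_zero.2 x.2)
    obtain ⟨G, -, -, -, -, ⟨e'⟩⟩ := exists_bGroup_of_isSimple hlt hs
    exact ⟨G, ⟨e.symm ≪≫ e'⟩⟩
  · rintro ⟨G, ⟨e⟩⟩
    obtain ⟨e'⟩ := nonempty_functorSTriv_iso (G := BifreeCat.of G.1) (K := K) G.2
    let i : (jSub K p G.1).subquotient (eSub K p G.1) ≅ S := e' ≪≫ e.symm
    exact ⟨(isSimple_eSub_quotient G).of_iso i, _, _, jSub_le_eSub G.1, ⟨i⟩⟩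

/-- The class of `e^G_G` in `e^Δ_G / j_G` is nonzero, so its image in `e^Δ_H / j_H` lifts to a
nonzero element of `e^Δ_H(G)`, to which `exists_dominates_of_mem_eSub` applies. -/
theorem exists_dominates_of_iso {G H : BGroup.{v} p}
    (e : (functorSTriv (BifreeCat.of G.1) : BifreeCat.{u, v} p K ⥤ ModuleCat K) ≅
      functorSTriv (BifreeCat.of H.1)) : ∃ L : Subgroup G.1, Dominates p L H.1 := by
  obtain ⟨eG⟩ := nonempty_functorSTriv_iso (G := BifreeCat.of G.1) (K := K) G.2
  obtain ⟨eH⟩ := nonempty_functorSTriv_iso (G := BifreeCat.of H.1) (K := K) H.2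
  let i : (jSub K p G.1).subquotient (eSub K p G.1) ≅ (jSub K p H.1).subquotient (eSub K p H.1) :=
    eG ≪≫ e ≪≫ eH.symm
  let q := SubFun.subquotientMk (jSub K p G.1) (eSub K p G.1) (BifreeCat.of G.1)
    ⟨Burn.idem K G.1, idem_mem_eSub G.1⟩
  obtain ⟨x, hx⟩ := SubFun.subquotientMk_surjective _ _ _ ((i.hom.app _).hom q)
  by_contra! h
  have hx0 : x = 0 := by
    by_contra h0
    obtain ⟨L, hL⟩ := exists_dominates_of_mem_eSub (G := G.1) (H := H) x.2
      fun h => h0 (Subtype.ext h)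
    exact h L hL
  rw [hx0, map_zero] at hx
  have hq : (i.inv.app _).hom ((i.hom.app _).hom q) = q :=
    congrArg (fun l => l.hom q) (i.hom_inv_id_app _)
  rw [← hx, map_zero] at hq
  exact not_eSub_le_jSub G (eSub_le_iff.2 (SubFun.subquotientMk_eq_zero.1 hq.symm))

/-- Applied in both directions, `exists_dominates_of_iso` gives `|H| ≤ |L| ≤ |G| ≤ |H|`. Hence `L =
G`, and the surjection `L → H` is bijective. -/
theorem nonempty_mulEquiv_of_iso {G H : BGroup.{v} p}
    (e : (functorSTriv (BifreeCat.of G.1) : BifreeCat.{u, v} p K ⥤ ModuleCat K) ≅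
      functorSTriv (BifreeCat.of H.1)) : Nonempty (G.1 ≃* H.1) := by
  obtain ⟨L, hL⟩ := exists_dominates_of_iso e
  obtain ⟨M, hM⟩ := exists_dominates_of_iso e.symm
  have h1 : Nat.card G.1 ≤ Nat.card H.1 := hM.card_le.trans (Subgroup.card_le_card_group M)
  have hcard : Nat.card L = Nat.card G.1 :=
    le_antisymm (Subgroup.card_le_card_group L) (h1.trans hL.card_le)
  obtain ⟨f⟩ := hL.nonempty_mulEquiv (hcard.le.trans h1)
  have hL' := Subgroup.eq_top_of_card_eq L hcard
  exact ⟨(Subgroup.topEquiv.symm.trans (MulEquiv.subgroupCongr hL'.symm)).trans f⟩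

end CompositionFactors

end BifreeBiset

end

/-! ### Assembly of the theorem -/

theorem mainTheorem1 (p : ℕ) [Fact p.Prime] (K : Type u) [Field K] [CharZero K] :
    -- the lattice of subfunctors of `K B`
    (∃ Θ : SubFun (burnside.{u, v} p K) ≃o {A : Set (BGroupClass.{v} p) // IsClosedClass A},
      (∀ F : SubFun (burnside.{u, v} p K),
        (Θ F).1 = {c | ∃ H : BGroup.{v} p, H.cls = c ∧ eSub K p H.1 ≤ F}) ∧
      (∀ A : {A : Set (BGroupClass.{v} p) // IsClosedClass A},
        Θ.symm A = ⨆ (H : BGroup.{v} p) (_ : H.cls ∈ A.1), eSub K p H.1)) ∧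
    -- the unique maximal subfunctor of `e^Δ_G` and the simple quotient
    (∀ G : BGroup.{v} p,
      jSub K p G.1 < eSub K p G.1 ∧
      (∀ F : SubFun (burnside.{u, v} p K), F < eSub K p G.1 → F ≤ jSub K p G.1) ∧
      Nonempty ((jSub K p G.1).subquotient (eSub K p G.1) ≅ functorSTriv (BifreeCat.of G.1))) ∧
    -- the simple subquotients of `K B`
    (∀ F F' : SubFun (burnside.{u, v} p K), F < F' → IsSimpleFunctor (F.subquotient F') →
      ∃ G : BGroup.{v} p,
        (eSub K p G.1 ≤ F' ∧ ¬ eSub K p G.1 ≤ F) ∧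
        (∀ G' : BGroup.{v} p, eSub K p G'.1 ≤ F' → ¬ eSub K p G'.1 ≤ F →
          Nonempty (G'.1 ≃* G.1)) ∧
        eSub K p G.1 ⊔ F = F' ∧
        eSub K p G.1 ⊓ F = jSub K p G.1 ∧
        Nonempty (F.subquotient F' ≅ functorSTriv (BifreeCat.of G.1))) ∧
    -- the composition factors of `K B`
    (∀ (S : BifreeCat.{u, v} p K ⥤ ModuleCat.{max u (v + 1)} K) [S.Additive] [S.Linear K],
      IsCompositionFactor S (burnside.{u, v} p K) ↔
        ∃ G : BGroup.{v} p, Nonempty (S ≅ functorSTriv (BifreeCat.of G.1))) ∧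
    -- non-isomorphic groups give non-isomorphic composition factors
    (∀ G H : BGroup.{v} p,
      Nonempty ((functorSTriv (BifreeCat.of G.1) : BifreeCat.{u, v} p K ⥤ ModuleCat K) ≅
        functorSTriv (BifreeCat.of H.1)) → Nonempty (G.1 ≃* H.1)) := by
  refine ⟨⟨subFunOrderIso p K, fun _ => rfl, fun _ => rfl⟩, fun G => ⟨jSub_lt_eSub G,
    fun _ => le_jSub_of_lt G, nonempty_functorSTriv_iso (G := BifreeCat.of G.1) G.2⟩,
    fun _ _ => exists_bGroup_of_isSimple, fun S _ _ => isCompositionFactor_burnside_iff S,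
    fun _ _ ⟨e⟩ => nonempty_mulEquiv_of_iso e⟩
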